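/- Let $k$ be a field, $n\ge 1$, $R=k[[x_1,\dots,x_{n-1}]]$ with $\mathfrak m=\ker(R\to k,\ x_i\mapsto 0)$, and $S=k[[x_1,\dots,x_{n-1},y_1,\dots,y_{n-1}]]$. Regard $R$ as an $S$-module through the ring homomorphism $S\to R$ with $x_i\mapsto x_i$, $y_i\mapsto x_i$, and put $L=\operatorname{Tor}^S_{n-1}(R,R)$, which is an $R$-module because $S$ acts on it through $S\to R$. Call an $R$-module of finite length if it is finitely generated and each of its elements is annihilated by a power of $\mathfrak m$. A skew homomorphism $M\to M'$ of $R$-modules is a pair $(\sigma,\tau)$, where $\sigma$ is a ring automorphism of $R$ with $\sigma(k)=k$ and $\tau:M\to M'$ is an additive map with $\tau(rm)=\sigma(r)\tau(m)$ for all $r\in R$, $m\in M$; write $\sigma_0=\sigma|_k$. An automorphism $\sigma$ as above induces an automorphism of $S$, the completion of $R\otimes_kR$ (extending $\sigma\otimes\sigma$), and hence a $\sigma$-semilinear automorphism $\sigma_L$ of $L$. Then: (1) $L$ is a free $R$-module of rank one. (2) For all $R$-modules $M$ of finite length there are isomorphisms of $R$-modules $$\theta_M:\ L\otimes_R\operatorname{Ext}^{n-1}_R(M,R)\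 \xrightarrow{\ \cong\ }\ \operatorname{Hom}_k(M,k)$$ (where $(r f)(m)=f(rm)$ on the right) that are natural with respect to skew homomorphisms: for every skew homomorphism $(\sigma,\tau):M\to M'$ of modules of finite length, $$\theta_M\circ\bigl((\sigma^{-1})_L\otimes(\sigma,\tau)^*\bigr)=(\sigma,\tau)^\vee\circ\theta_{M'},$$ where $(\sigma,\tau)^\vee(f)=\sigma_0^{-1}\circ f\circ\tau$ for $f\in\operatorname{Hom}_k(M',k)$, and $(\sigma,\tau)^*:\operatorname{Ext}^{n-1}_R(M',R)\to\operatorname{Ext}^{n-1}_R(M,R)$ is obtained by restricting scalars along $\sigma$, precomposing with $\tau$ and postcomposing with $\sigma^{-1}:R\to R$. -/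

import Mathlib

open CategoryTheory MonoidalCategory

universe u

attribute [-instance] CategoryTheory.catToReflQuiver CategoryTheory.ReflQuiver.toQuiver

namespace SkewDuality

section PowerSeriesLemmas

open MvPowerSeries

variable {k : Type u} [Field k] {α β : Type}

theorem exists_eq_C_add_sum_X_mul [Fintype α] (f : MvPowerSeries α k) :
    ∃ g : α → MvPowerSeries α k, f = C (constantCoeff f) + ∑ i, X i * g i := by
  classical
  have hne : ∀ e : α →₀ ℕ, e ≠ 0 → ∃ i, e i ≠ 0 := fun e he => by
    by_contra! h
    exact he (Finsupp.ext h)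
  let g : α → MvPowerSeries α k := fun i e =>
    if h : e + Finsupp.single i 1 ≠ 0 then
      if (hne _ h).choose = i then coeff (e + Finsupp.single i 1) f else 0
    else 0
  refine ⟨g, ?_⟩
  ext e
  rw [map_add, map_sum, coeff_C]
  by_cases he : e = 0
  · subst he
    simp [coeff_zero_X_mul]
  · rw [if_neg he, zero_add]
    rw [Finset.sum_eq_single (hne e he).choose]
    · have hi := (hne e he).choose_spec
      set i := (hne e he).choose with hidef
      have hle : Finsupp.single i 1 ≤ e := by
        simpa [Finsupp.single_le_iff] using Nat.one_le_iff_ne_zero.mpr hi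
      have hsub : e - Finsupp.single i 1 + Finsupp.single i 1 = e := tsub_add_cancel_of_le hle
      rw [X, coeff_monomial_mul, if_pos hle, one_mul]
      change _ = g i (e - Finsupp.single i 1)
      simp only [g, hsub]
      rw [dif_pos he, if_pos hidef.symm]
    · intro j _ hj
      rw [X, coeff_monomial_mul]
      split_ifs with hle
      · have hsub : e - Finsupp.single j 1 + Finsupp.single j 1 = e := tsub_add_cancel_of_le hle
        rw [one_mul]
        change g j (e - Finsupp.single j 1) = 0
        simp only [g, hsub]
        rw [dif_pos he, if_neg hj.symm]
      · rfl
    · simp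

/-- A ring homomorphism between power series rings over a field that sends the variables to
series without constant term is determined by its values on constants and on variables. -/
theorem ringHom_ext [Finite α] {φ ψ : MvPowerSeries α k →+* MvPowerSeries β k}
    (hC : ∀ a, φ (C a) = ψ (C a)) (hX : ∀ i, φ (X i) = ψ (X i))
    (h0 : ∀ i, constantCoeff (φ (X i)) = 0) : φ = ψ := by
  have := Fintype.ofFinite α
  have key : ∀ N : ℕ, ∀ f, ∀ e : β →₀ ℕ, e.degree < N → coeff e (φ f - ψ f) = 0 := by
    intro N
    induction N with
    | zero => intro f e he; omega
    | succ N ih =>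
      intro f e he
      obtain ⟨g, hg⟩ := exists_eq_C_add_sum_X_mul f
      have h1 : φ f - ψ f = ∑ i, φ (X i) * (φ (g i) - ψ (g i)) := by
        conv_lhs => rw [hg]
        simp only [map_add, map_sum, map_mul, hC, hX, mul_sub, Finset.sum_sub_distrib]
        ring
      rw [h1, map_sum]
      refine Finset.sum_eq_zero fun i _ => coeff_of_lt_order ?_
      have h2 : (N : ℕ∞) ≤ (φ (g i) - ψ (g i)).order := nat_le_order (ih (g i))
      have h3 : (1 : ℕ∞) ≤ (φ (X i)).order := one_le_order_iff_constCoeff_eq_zero.mpr (h0 i)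
      refine lt_of_lt_of_le ?_ ((add_le_add h3 h2).trans le_order_mul)
      have : e.degree < 1 + N := by omega
      exact_mod_cast this
  ext f e
  have := key (e.degree + 1) f e (Nat.lt_succ_self _)
  rw [map_sub, sub_eq_zero] at this
  exact this

/-- A ring isomorphism between power series rings over a field maps variables to series without
constant term. -/
theorem constantCoeff_ringEquiv_X (σ : MvPowerSeries α k ≃+* MvPowerSeries β k) (i : α) :
    constantCoeff (σ (X i)) = 0 := by
  by_contra h
  have h1 : IsUnit (σ (X i)) := isUnit_iff_constantCoeff.mpr (isUnit_iff_ne_zero.mpr h)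
  have h2 : IsUnit (X i : MvPowerSeries α k) := (MulEquiv.isUnit_map σ).mp h1
  have h3 := isUnit_iff_constantCoeff.mp h2
  simp at h3

end PowerSeriesLemmas

section Rings

variable (k : Type u) [Field k] (d : ℕ)

/-- `R = k⟦x₁, …, x_d⟧`. -/
abbrev PSR : Type u := MvPowerSeries (Fin d) k

/-- `S = k⟦x₁, …, x_d, y₁, …, y_d⟧`; `Sum.inl i` indexes `xᵢ` and `Sum.inr i` indexes `yᵢ`. -/
abbrev PSS : Type u := MvPowerSeries (Fin d ⊕ Fin d) k

/-- The completed multiplication map `S → R`, `xᵢ ↦ xᵢ`, `yᵢ ↦ xᵢ`. -/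
noncomputable def mulMap : PSS k d →+* PSR k d :=
  (MvPowerSeries.rename (Sum.elim id id) : PSS k d →ₐ[k] PSR k d).toRingHom

/-- The inclusion `R → S`, `xᵢ ↦ xᵢ`. -/
noncomputable def inclX : PSR k d →+* PSS k d :=
  (MvPowerSeries.rename Sum.inl : PSR k d →ₐ[k] PSS k d).toRingHom

/-- The inclusion `R → S`, `xᵢ ↦ yᵢ`. -/
noncomputable def inclY : PSR k d →+* PSS k d :=
  (MvPowerSeries.rename Sum.inr : PSR k d →ₐ[k] PSS k d).toRingHom

end Rings

section Automorphisms

open MvPowerSeries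

variable {k : Type u} [Field k] {d : ℕ}

theorem mulMap_inclX (f : PSR k d) : mulMap k d (inclX k d f) = f := by
  change rename (Sum.elim id id) (rename Sum.inl f) = f
  rw [rename_rename]
  exact rename_id_apply f

variable (k d) in
/-- A ring automorphism `σ` of `R = k⟦x₁, …, x_d⟧` that carries the field of constants `k ⊆ R`
onto itself, with its (uniquely determined) restriction `σ₀` to `k`. The case `σ₀ = id` is that of
the `k`-algebra automorphisms. -/
structure PSAut where
  /-- the automorphism `σ` of `R` -/
  ringEquiv : PSR k d ≃+* PSR k d
  /-- the restriction `σ₀` of `σ` to the constants -/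
  const : k ≃+* k
  map_C : ∀ a, ringEquiv (C a) = C (const a)

namespace PSAut

/-- The inverse automorphism. -/
noncomputable def symm (s : PSAut k d) : PSAut k d where
  ringEquiv := s.ringEquiv.symm
  const := s.const.symm
  map_C a := by rw [RingEquiv.symm_apply_eq, s.map_C, RingEquiv.apply_symm_apply]

/-- The images in `S` of the variables `xᵢ`, `yᵢ`: the series `σ(xᵢ)`, written in the variables
`x`, respectively `y`. -/
noncomputable def doubleVar (s : PSAut k d) : Fin d ⊕ Fin d → PSS k d :=
  Sum.elim (fun i => inclX k d (s.ringEquiv (X i))) (fun i => inclY k d (s.ringEquiv (X i)))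

theorem constantCoeff_doubleVar (s : PSAut k d) (j : Fin d ⊕ Fin d) :
    constantCoeff (s.doubleVar j) = 0 := by
  rcases j with i | i
  · exact (constantCoeff_rename _ _).trans (constantCoeff_ringEquiv_X s.ringEquiv i)
  · exact (constantCoeff_rename _ _).trans (constantCoeff_ringEquiv_X s.ringEquiv i)

/-- The endomorphism of `S`, the completion of `R ⊗_k R`, that extends `σ ⊗ σ`: apply `σ₀` to the
coefficients and substitute `σ(xᵢ)` for `xᵢ` and the same series in `y` for `yᵢ`. -/
noncomputable def doubleHom (s : PSAut k d) : PSS k d →+* PSS k d :=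
  (substAlgHom (R := k) (hasSubst_of_constantCoeff_zero s.constantCoeff_doubleVar)).toRingHom.comp
    (MvPowerSeries.map (s.const : k →+* k))

theorem doubleHom_C (s : PSAut k d) (a : k) : s.doubleHom (C a) = C (s.const a) := by
  have h := (substAlgHom (R := k)
    (hasSubst_of_constantCoeff_zero s.constantCoeff_doubleVar)).commutes (s.const a)
  rw [doubleHom, RingHom.comp_apply, MvPowerSeries.map_C]
  exact h

theorem doubleHom_X (s : PSAut k d) (j : Fin d ⊕ Fin d) :
    s.doubleHom (X j) = s.doubleVar j := by
  rw [doubleHom, RingHom.comp_apply, MvPowerSeries.map_X]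
  exact substAlgHom_X _ j

theorem doubleHom_inclX (s : PSAut k d) (f : PSR k d) :
    s.doubleHom (inclX k d f) = inclX k d (s.ringEquiv f) := by
  have hX : ∀ i, inclX k d (X i) = X (Sum.inl i) := fun i => rename_X _ i
  have hC : ∀ a, inclX k d (C a) = C a := fun a => rename_C _ a
  have h : s.doubleHom.comp (inclX k d) = (inclX k d).comp (s.ringEquiv : PSR k d →+* PSR k d) := by
    refine ringHom_ext (fun a => ?_) (fun i => ?_) (fun i => ?_)
    · simp [hC, doubleHom_C, s.map_C]
    · simp [hX, doubleHom_X, doubleVar]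
    · simp [hX, doubleHom_X, constantCoeff_doubleVar]
  exact DFunLike.congr_fun h f

theorem doubleHom_inclY (s : PSAut k d) (f : PSR k d) :
    s.doubleHom (inclY k d f) = inclY k d (s.ringEquiv f) := by
  have hX : ∀ i, inclY k d (X i) = X (Sum.inr i) := fun i => rename_X _ i
  have hC : ∀ a, inclY k d (C a) = C a := fun a => rename_C _ a
  have h : s.doubleHom.comp (inclY k d) = (inclY k d).comp (s.ringEquiv : PSR k d →+* PSR k d) := by
    refine ringHom_ext (fun a => ?_) (fun i => ?_) (fun i => ?_)
    · simp [hC, doubleHom_C, s.map_C]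
    · simp [hX, doubleHom_X, doubleVar]
    · simp [hX, doubleHom_X, constantCoeff_doubleVar]
  exact DFunLike.congr_fun h f

theorem doubleHom_symm_comp (s : PSAut k d) :
    s.symm.doubleHom.comp s.doubleHom = RingHom.id (PSS k d) := by
  refine ringHom_ext (fun a => ?_) (fun j => ?_) (fun j => ?_)
  · simp [doubleHom_C, symm]
  all_goals
    rw [RingHom.comp_apply, doubleHom_X]
    rcases j with i | i
  · rw [doubleVar, Sum.elim_inl, doubleHom_inclX]
    simp only [symm, RingEquiv.symm_apply_apply, RingHom.id_apply]
    exact rename_X _ i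
  · rw [doubleVar, Sum.elim_inr, doubleHom_inclY]
    simp only [symm, RingEquiv.symm_apply_apply, RingHom.id_apply]
    exact rename_X _ i
  · rw [doubleVar, Sum.elim_inl, doubleHom_inclX]
    refine (constantCoeff_rename _ _).trans ?_
    simp [symm]
  · rw [doubleVar, Sum.elim_inr, doubleHom_inclY]
    refine (constantCoeff_rename _ _).trans ?_
    simp [symm]

/-- The automorphism of `S`, the completion of `R ⊗_k R`, induced by `σ ⊗ σ`. -/
noncomputable def double (s : PSAut k d) : PSS k d ≃+* PSS k d :=
  RingEquiv.ofRingHom s.doubleHom s.symm.doubleHom s.symm.doubleHom_symm_comp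
    s.doubleHom_symm_comp

theorem mulMap_double (s : PSAut k d) (f : PSS k d) :
    mulMap k d (s.double f) = s.ringEquiv (mulMap k d f) := by
  have hX : ∀ j, mulMap k d (X j) = X (Sum.elim id id j) := fun j => rename_X _ j
  have hC : ∀ a, mulMap k d (C a) = C a := fun a => rename_C _ a
  have hY : ∀ g, mulMap k d (inclY k d g) = g := fun g => by
    change rename (Sum.elim id id) (rename Sum.inr g) = g
    rw [rename_rename]
    exact rename_id_apply g
  have h : (mulMap k d).comp s.doubleHom =
      (s.ringEquiv : PSR k d →+* PSR k d).comp (mulMap k d) := by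
    have hv : ∀ j, mulMap k d (s.doubleVar j) = s.ringEquiv (X (Sum.elim id id j)) := by
      rintro (i | i)
      · exact mulMap_inclX _
      · exact hY _
    refine ringHom_ext (fun a => ?_) (fun j => ?_) (fun j => ?_)
    · simp [hC, doubleHom_C, s.map_C]
    · simp [hX, doubleHom_X, hv]
    · simp [doubleHom_X, hv, constantCoeff_ringEquiv_X]
  exact DFunLike.congr_fun h f

end PSAut

end Automorphisms

section Tor

variable {A B : Type u} [CommRing A] [CommRing B]

/-- For `f : X → X'` semilinear along `e : A ≃+* B`, the maps `X ⊗_A Y → X' ⊗_B Y`,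
`x ⊗ y ↦ f(x) ⊗ y`, natural in the `B`-module `Y`. -/
noncomputable def tensorChange (e : A ≃+* B) {X : ModuleCat.{u} A} {X' : ModuleCat.{u} B}
    (f : X ⟶ (ModuleCat.restrictScalars e.toRingHom).obj X') :
    ModuleCat.restrictScalars e.toRingHom ⋙ (tensoringLeft (ModuleCat.{u} A)).obj X ⟶
      (tensoringLeft (ModuleCat.{u} B)).obj X' ⋙ ModuleCat.restrictScalars e.toRingHom where
  app Y := (f ▷ (ModuleCat.restrictScalars e.toRingHom).obj Y) ≫
    Functor.LaxMonoidal.μ (ModuleCat.restrictScalars e.toRingHom) X' Y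
  naturality Y Z g := by
    change X ◁ (ModuleCat.restrictScalars e.toRingHom).map g ≫
      f ▷ (ModuleCat.restrictScalars e.toRingHom).obj Z ≫
        Functor.LaxMonoidal.μ (ModuleCat.restrictScalars e.toRingHom) X' Z =
      (f ▷ (ModuleCat.restrictScalars e.toRingHom).obj Y ≫
        Functor.LaxMonoidal.μ (ModuleCat.restrictScalars e.toRingHom) X' Y) ≫
      (ModuleCat.restrictScalars e.toRingHom).map (X' ◁ g)
    rw [whisker_exchange_assoc, Category.assoc, Functor.LaxMonoidal.μ_natural_right]

/-- For `f : X → X'` and `g : Y → Y'` semilinear along `e : A ≃+* B`, the induced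
semilinear map `Tor^A_n(X, Y) → Tor^B_n(X', Y')`. If `P` is a projective resolution of `Y'` over
`B`, then `P` is one over `A` as well, and the map is the composite of `Tor(X, g)` with the map
on homology induced by `X ⊗_A P → X' ⊗_B P`, `x ⊗ p ↦ f(x) ⊗ p`. -/
noncomputable def torChange (e : A ≃+* B) (n : ℕ) {X Y : ModuleCat.{u} A} {X' Y' : ModuleCat.{u} B}
    (f : X ⟶ (ModuleCat.restrictScalars e.toRingHom).obj X')
    (g : Y ⟶ (ModuleCat.restrictScalars e.toRingHom).obj Y') :
    ((Tor (ModuleCat.{u} A) n).obj X).obj Y ⟶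
      (ModuleCat.restrictScalars e.toRingHom).obj
        (((Tor (ModuleCat.{u} B) n).obj X').obj Y') :=
  let F := ModuleCat.restrictScalars.{u} e.toRingHom
  let P := projectiveResolution Y'
  ((Tor (ModuleCat.{u} A) n).obj X).map g ≫
    ((F.mapProjectiveResolution P).isoLeftDerivedObj ((tensoringLeft _).obj X) n).hom ≫
    (HomologicalComplex.homologyFunctor _ _ n).map
      ((NatTrans.mapHomologicalComplex (tensorChange e f) (ComplexShape.down ℕ)).app P.complex) ≫
    (((((tensoringLeft _).obj X').mapHomologicalComplex _).obj P.complex).sc n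
      |>.mapHomologyIso F).hom ≫
    F.map (P.isoLeftDerivedObj ((tensoringLeft _).obj X') n).inv

end Tor

section Twist

variable (k : Type u) [Field k] (d : ℕ)

/-- `R` as an `S`-module through the completed multiplication map `S → R`. -/
noncomputable def diagModule : ModuleCat.{u} (PSS k d) :=
  (ModuleCat.restrictScalars (mulMap k d)).obj (ModuleCat.of (PSR k d) (PSR k d))

/-- `L = Tor^S_d(R, R)`, as an `R`-module. The ring `S` acts on `Tor^S(R, R)` through `S → R`
(by multiplication on either argument), so the `R`-action given by multiplication on an argument
is the restriction of the `S`-action along the section `xᵢ ↦ xᵢ` of `S → R`. -/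
noncomputable def twistModule : ModuleCat.{u} (PSR k d) :=
  (ModuleCat.restrictScalars (inclX k d)).obj
    (((Tor (ModuleCat.{u} (PSS k d)) d).obj (diagModule k d)).obj (diagModule k d))

variable {k d}

/-- `σ : R → R`, as a map of `S`-modules semilinear along the automorphism of `S` induced by
`σ ⊗ σ`. -/
noncomputable def diagModuleMap (s : PSAut k d) :
    diagModule k d ⟶ (ModuleCat.restrictScalars s.double.toRingHom).obj (diagModule k d) :=
  let φ : diagModule k d →ₗ[PSS k d]
      (ModuleCat.restrictScalars s.double.toRingHom).obj (diagModule k d) :=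
    { toFun := s.ringEquiv
      map_add' := map_add s.ringEquiv
      map_smul' := fun (a : PSS k d) r => by
        change s.ringEquiv (mulMap k d a * (show PSR k d from r)) =
          mulMap k d (s.double a) * s.ringEquiv (show PSR k d from r)
        rw [map_mul, s.mulMap_double] }
  ModuleCat.ofHom (X := ↑(diagModule k d))
    (Y := ↑((ModuleCat.restrictScalars s.double.toRingHom).obj (diagModule k d))) φ

/-- The action of `σ` on `L = Tor^S_d(R, R)`. -/
noncomputable def twistMap (s : PSAut k d) :
    twistModule k d →ₛₗ[(s.ringEquiv : PSR k d →+* PSR k d)] twistModule k d where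
  toFun := (torChange s.double d (diagModuleMap s) (diagModuleMap s)).hom
  map_add' := map_add (torChange s.double d (diagModuleMap s) (diagModuleMap s)).hom
  map_smul' r x := by
    let T := ((Tor (ModuleCat.{u} (PSS k d)) d).obj (diagModule k d)).obj (diagModule k d)
    let φ : T →ₗ[PSS k d] (ModuleCat.restrictScalars s.double.toRingHom).obj T :=
      (torChange s.double d (diagModuleMap s) (diagModuleMap s)).hom
    let ψ : T → T := fun y => φ y
    have h : ∀ y : T, ψ (inclX k d r • y) = s.double (inclX k d r) • ψ y :=
      fun y => map_smul φ (inclX k d r) y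
    have h' : s.double (inclX k d r) = inclX k d (s.ringEquiv r) := s.doubleHom_inclX r
    rw [h'] at h
    exact h x

end Twist

section SkewModules

variable {k : Type u} [Field k] {d : ℕ}

/-- A skew homomorphism `M → M'`: an automorphism `σ` of `R` and an additive map `τ : M → M'` with
`τ(r m) = σ(r) τ(m)`. -/
structure SkewHom (M M' : ModuleCat.{u} (PSR k d)) where
  /-- the automorphism `σ` -/
  aut : PSAut k d
  /-- the semilinear map `τ` -/
  map : M →ₛₗ[(aut.ringEquiv : PSR k d →+* PSR k d)] M'

/-- A finite length `R`-module: finitely generated, and every element is annihilated by a power of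
the maximal ideal `𝔪`, the kernel of `R → k`. -/
def IsFinLength (M : ModuleCat.{u} (PSR k d)) : Prop :=
  Module.Finite (PSR k d) M ∧ ∀ m : M, ∃ N : ℕ,
    ∀ r ∈ RingHom.ker (MvPowerSeries.constantCoeff (σ := Fin d) (R := k)) ^ N, r • m = 0

open scoped ModuleCat in
/-- `Hom_k(M, k)`, where `k` acts on `M` through `k ⊆ R`. -/
abbrev KDual (M : ModuleCat.{u} (PSR k d)) : Type u := Module.Dual k M

variable (d) in
/-- `Ext^d_R(M, R)`. -/
noncomputable abbrev ExtR (M : ModuleCat.{u} (PSR k d)) : Type u :=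
  Abelian.Ext M (ModuleCat.of (PSR k d) (PSR k d)) d

/-- `τ`, as an `R`-linear map from `M` to `M'` with `R`-action restricted along `σ`. -/
noncomputable def SkewHom.toRestrict {M M' : ModuleCat.{u} (PSR k d)} (t : SkewHom M M') :
    M ⟶ (ModuleCat.restrictScalars t.aut.ringEquiv.toRingHom).obj M' :=
  ModuleCat.ofHom (Y := (ModuleCat.restrictScalars t.aut.ringEquiv.toRingHom).obj M')
    { toFun := t.map
      map_add' := map_add t.map
      map_smul' := fun r m => t.map.map_smulₛₗ r m }

/-- The map `Ext^d_R(M', R) → Ext^d_R(M, R)` induced by a skew homomorphism `(σ, τ) : M → M'`: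
restrict scalars along `σ`, precompose with `τ` and postcompose with `σ⁻¹ : R → R`. -/
noncomputable def extMap {M M' : ModuleCat.{u} (PSR k d)} (t : SkewHom M M') :
    ExtR d M' →ₛₗ[(t.aut.symm.ringEquiv : PSR k d →+* PSR k d)] ExtR d M where
  toFun e :=
    ((Abelian.Ext.mk₀ t.toRestrict).comp
      (e.mapExactFunctor (ModuleCat.restrictScalars t.aut.ringEquiv.toRingHom)) (zero_add d)).comp
      (Abelian.Ext.mk₀ (ModuleCat.restrictScalarsIsoOfEquiv t.aut.ringEquiv).hom) (add_zero d)
  map_add' e e' := by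
    rw [Abelian.Ext.mapExactFunctor_add, Abelian.Ext.comp_add, Abelian.Ext.add_comp]
  map_smul' r e := by
    rw [Abelian.Ext.smul_eq_comp_mk₀, Abelian.Ext.smul_eq_comp_mk₀,
      Abelian.Ext.mapExactFunctor_comp, Abelian.Ext.mapExactFunctor_mk₀]
    simp only [Abelian.Ext.comp_assoc_of_third_deg_zero, Abelian.Ext.mk₀_comp_mk₀]
    congr 3
    refine ModuleCat.hom_ext (LinearMap.ext fun x => ?_)
    exact map_mul t.aut.ringEquiv.symm r x

end SkewModules
end SkewDuality

open SkewDuality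
open scoped TensorProduct

-- Put d = n - 1, let I be the ideal of S generated by the xᵢ - yᵢ, and μ : S → R the completed
-- multiplication. The Koszul complex K on the xᵢ - yᵢ resolves R over S. Its differentials have
-- image in I K, so they vanish after tensoring with R, and L = R ⊗_S K_d is free on the class of a
-- generator q of K_d.
--
-- For M of finite length let B = S ⊗_R M, formed along the variables x. Since powers of 𝔪 kill the
-- elements of M, B is generated by M over the power series in y, and a k-basis of M exhibits it as
-- projective over them. On B each xᵢ - yᵢ acts injectively modulo the later ones, and B/IB = M.
-- Hence B ⊗_S K, with R acting through y, is a projective resolution of M of length d. After the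
-- choice of q, Ext^d(M, R) is the quotient of the y-linear functions B → R by the action of I. Each
-- such function is a sum of r f̂, where f̂ extends f ∈ Hom_k(M, k) coefficientwise, and r f̂ ↦ r f
-- (`trace`) identifies the quotient with Hom_k(M, k): it equates the actions of xᵢ and yᵢ, and a
-- function of trace zero has the form ∑ (rᵢ(y) - rᵢ(x)) f̂ᵢ. This gives `extDual`.
--
-- Only the choice of q is not canonical, and L compensates for it. An automorphism σ lifts to a
-- semilinear endomorphism of K that sends q to c_σ q. It acts on L by r q ↦ σ(r) μ(c_σ) q
-- (`twistMap_twistGen`), while (σ, τ)^* becomes f ↦ (σ, τ)^∨(μ(c_σ) f) (`extDual_extMap`).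
-- Naturality is then the identity μ(c_σ) σ(μ(c_{σ⁻¹})) = 1 (`mulMap_liftFactor`): the composite of
-- the lifts of σ⁻¹ and σ is homotopic to the identity, and a homotopy changes q only by elements of
-- I K_d.
--
-- The abstract maps on Ext and Tor are brought to these resolutions by
-- `mk₀_comp_mapExactFunctor_extMk` and `torClass_torChange`.

universe w w' v v' u'

set_option linter.unusedSectionVars false

/-! ### Images of Ext classes under an exact functor -/

namespace CategoryTheory.ProjectiveResolution
open Limits Abelian CochainComplex HomComplex

variable {C : Type u} [Category.{v} C] [Abelian C] {D : Type u'} [Category.{v'} D] [Abelian D]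

/-- The augmentation of a projective resolution. -/
noncomputable def aug {X : C} (P : ProjectiveResolution X) : P.complex.X 0 ⟶ X := P.π.f 0

/-- The object in degree zero of the single complex in degree zero. -/
noncomputable def singleXIso (X : C) : ((singleFunctor C 0).obj X).X 0 ≅ X :=
  HomologicalComplex.singleObjXSelf (.up ℤ) 0 X

lemma π'_f_zero_eq {X : C} (P : ProjectiveResolution X) :
    P.π'.f 0 = (P.cochainComplexXIso 0 0 rfl).hom ≫ P.aug ≫ (singleXIso X).inv :=
  π'_f_zero P

variable (F : C ⥤ D) [F.Additive] [PreservesFiniteLimits F] [PreservesFiniteColimits F]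

lemma mapCochainComplexSingleFunctor_hom_f_zero (X : C) :
    ((F.mapCochainComplexSingleFunctor 0).hom.app X).f 0 =
      F.map (singleXIso X).hom ≫ (singleXIso (F.obj X)).inv :=
  HomologicalComplex.singleMapHomologicalComplex_hom_app_self F _ 0 X

section
variable {X : C} {X' : D} (P : ProjectiveResolution X) (P' : ProjectiveResolution X')
  (e : ∀ i, P'.complex.X i ⟶ F.obj (P.complex.X i))

/-- The components of `extendHom`. -/
noncomputable def extendHomApp (n : ℤ) : P'.cochainComplex.X n ⟶ F.obj (P.cochainComplex.X n) :=
  if h : n ≤ 0 then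
    (P'.cochainComplexXIso n n.natAbs (by lia)).hom ≫ e n.natAbs ≫
      F.map (P.cochainComplexXIso n n.natAbs (by lia)).inv
  else 0

lemma extendHomApp_eq (n : ℤ) (k : ℕ) (h : -k = n) :
    extendHomApp F P P' e n = (P'.cochainComplexXIso n k h).hom ≫ e k ≫
      F.map (P.cochainComplexXIso n k h).inv := by
  obtain rfl : n.natAbs = k := by lia
  exact dif_pos (by lia)

variable {e} (he : ∀ i j, e i ≫ F.map (P.complex.d i j) = P'.complex.d i j ≫ e j)

include he in
lemma extendHomApp_comm (i j : ℤ) (hij : i + 1 = j) :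
    extendHomApp F P P' e i ≫ F.map (P.cochainComplex.d i j) =
      P'.cochainComplex.d i j ≫ extendHomApp F P P' e j := by
  by_cases h : j ≤ 0
  · rw [extendHomApp_eq F P P' e i i.natAbs (by lia),
      extendHomApp_eq F P P' e j j.natAbs (by lia),
      cochainComplex_d _ _ _ i.natAbs j.natAbs (by lia) (by lia),
      cochainComplex_d _ _ _ i.natAbs j.natAbs (by lia) (by lia)]
    simp only [Category.assoc, Iso.inv_hom_id_assoc, Functor.map_comp]
    rw [← F.map_comp_assoc (Iso.inv _) (Iso.hom _), Iso.inv_hom_id, F.map_id, Category.id_comp,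
      reassoc_of% he]
  -- The resolution lives in degrees at most zero, so for `j > 0` the target vanishes.
  · exact IsZero.eq_of_tgt
      (F.map_isZero (CochainComplex.isZero_of_isStrictlyLE _ 0 _ (by lia))) _ _

/-- A chain map from a resolution to the image of a resolution, extended by zero. -/
noncomputable def extendHom :
    P'.cochainComplex ⟶ (F.mapHomologicalComplex (ComplexShape.up ℤ)).obj P.cochainComplex where
  f n := extendHomApp F P P' e n
  comm' i j hij := extendHomApp_comm F P P' he i j hij

variable (g : X' ⟶ F.obj X) (hg : e 0 ≫ F.map P.aug = P'.aug ≫ g)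

include hg in
lemma extendHomApp_π' :
    extendHomApp F P P' e 0 ≫ F.map (P.π'.f 0) ≫
      F.map (singleXIso X).hom ≫ (singleXIso (F.obj X)).inv =
        P'.π'.f 0 ≫ (singleXIso X').hom ≫ g ≫ (singleXIso (F.obj X)).inv := by
  rw [π'_f_zero_eq, π'_f_zero_eq, extendHomApp_eq F P P' e 0 0 rfl]
  simp only [Category.assoc, Functor.map_comp, Iso.inv_hom_id_assoc]
  rw [← F.map_comp_assoc (Iso.inv _) (Iso.hom _), Iso.inv_hom_id, F.map_id, Category.id_comp,
    ← F.map_comp_assoc (Iso.inv _) (Iso.hom _), Iso.inv_hom_id, F.map_id, Category.id_comp,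
    reassoc_of% hg]

lemma singleFunctor_map_f_zero : ((singleFunctor D 0).map g).f 0 =
    (singleXIso X').hom ≫ g ≫ (singleXIso (F.obj X)).inv :=
  HomologicalComplex.single_map_f_self (.up ℤ) 0 g

include hg in
-- Maps into a complex concentrated in degree zero are determined there, and in degree zero this is
-- `hg` up to the identifications of the terms.
lemma extendHom_π' :
    extendHom F P P' he ≫ (F.mapHomologicalComplex (ComplexShape.up ℤ)).map P.π' ≫
      (F.mapCochainComplexSingleFunctor 0).hom.app X = P'.π' ≫ (singleFunctor D 0).map g := by
  refine HomologicalComplex.to_single_hom_ext ?_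
  have h1 := extendHomApp_π' F P P' g hg
  rw [← mapCochainComplexSingleFunctor_hom_f_zero, ← singleFunctor_map_f_zero] at h1
  exact h1

lemma equivHomShift_v {K L : CochainComplex C ℤ} {n : ℤ} (ψ : K ⟶ L⟦n⟧) (p : ℤ) :
    (Cocycle.equivHomShift ψ).1.v p (p + n) rfl = ψ.f p := by
  simp only [Cocycle.equivHomShift_apply, Cocycle.rightUnshift_coe,
    Cochain.rightUnshift_v _ _ _ _ _ _ _ (add_zero p), Cocycle.ofHom_coe, Cochain.ofHom_v]
  exact Category.comp_id _

lemma equivHomShift_map_v {K L : CochainComplex C ℤ} {n : ℤ} (ψ : K ⟶ L⟦n⟧) (p q : ℤ)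
    (h : p + n = q) :
    (Cocycle.equivHomShift
      (ShiftedHom.map ψ (F.mapHomologicalComplex (ComplexShape.up ℤ)))).1.v p q h =
      F.map ((Cocycle.equivHomShift ψ).1.v p q h) := by
  subst h
  rw [equivHomShift_v]
  refine Eq.trans ?_ (congrArg F.map (equivHomShift_v _ _).symm)
  exact Category.comp_id (F.map (ψ.f p))

/-- A cocycle with values in a single complex has one relevant component, here in degree `-n`, where
the identifications of the terms cancel. -/
lemma extendHom_toSingleMk {Y : C} {n : ℕ} (f : P.complex.X n ⟶ Y) (m : ℕ) (h1 h2 h3 h4) :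
    Cocycle.equivHomShift.symm (Cocycle.toSingleMk (p := -n) (q := 0) (n := n)
        ((P'.cochainComplexXIso (-n) n rfl).hom ≫ e n ≫ F.map f) h1 (-m) h2 h3) =
      extendHom F P P' he ≫ ShiftedHom.map (Cocycle.equivHomShift.symm
        (Cocycle.toSingleMk (q := 0) ((P.cochainComplexXIso (-n) n rfl).hom ≫ f) h1 (-m) h2 h4))
          (F.mapHomologicalComplex (ComplexShape.up ℤ)) ≫
          ((F.mapCochainComplexSingleFunctor 0).hom.app Y)⟦(n : ℤ)⟧' := by
  apply Cocycle.equivHomShift.injective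
  rw [AddEquiv.apply_symm_apply]
  erw [Cocycle.equivHomShift_comp]
  rw [Cocycle.equivHomShift_comp_shift]
  ext : 1
  apply (Cochain.toSingleEquiv h1).injective
  simp only [Cochain.toSingleEquiv, AddEquiv.coe_mk, Equiv.coe_fn_mk, Cocycle.toSingleMk_coe,
    Cocycle.precomp_coe, Cocycle.postcomp_coe, Cochain.zero_cochain_comp_v, Cochain.ofHom_v,
    Cochain.comp_zero_cochain_v]
  congr 1
  rw [equivHomShift_map_v, AddEquiv.apply_symm_apply, Cocycle.toSingleMk_coe, Cochain.toSingleMk_v,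
    Cochain.toSingleMk_v, mapCochainComplexSingleFunctor_hom_f_zero]
  have : (extendHom F P P' he).f (-↑n) = (P'.cochainComplexXIso (-n) n rfl).hom ≫ e n ≫
      F.map (P.cochainComplexXIso (-n) n rfl).inv := extendHomApp_eq F P P' e _ _ _
  rw [this]
  change ((P'.cochainComplexXIso (-n) n rfl).hom ≫ e n ≫ F.map f) ≫ (singleXIso (F.obj Y)).inv =
    ((P'.cochainComplexXIso (-n) n rfl).hom ≫ e n ≫ F.map (P.cochainComplexXIso (-n) n rfl).inv) ≫
      F.map (((P.cochainComplexXIso (-n) n rfl).hom ≫ f) ≫ (singleXIso Y).inv) ≫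
      F.map (singleXIso Y).hom ≫ (singleXIso (F.obj Y)).inv
  simp only [Category.assoc, Functor.map_comp]
  rw [← F.map_comp_assoc (Iso.inv _) (Iso.hom _), Iso.inv_hom_id, F.map_id, Category.id_comp,
    ← F.map_comp_assoc (Iso.inv _) (Iso.hom _), Iso.inv_hom_id, F.map_id, Category.id_comp]

variable {Y : C} {n : ℕ} [HasExt.{w} C] [HasExt.{w'} D]

lemma map_comp_shift {C' D' : Type*} [Category* C'] [Category* D'] [HasShift C' ℤ] [HasShift D' ℤ]
    (Q : C' ⥤ D') [Q.CommShift ℤ] {K L M N : C'} {n : ℤ} (u : K ⟶ L) (c : ShiftedHom L M n)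
    (s : M ⟶ N) : ShiftedHom.map (u ≫ c ≫ s⟦n⟧') Q = Q.map u ≫ c.map Q ≫ (Q.map s)⟦n⟧' := by
  rw [← ShiftedHom.comp_mk₀ c 0 rfl s, ← ShiftedHom.mk₀_comp 0 rfl u, ShiftedHom.map_comp,
    ShiftedHom.map_comp, ShiftedHom.map_mk₀, ShiftedHom.map_mk₀, ShiftedHom.mk₀_comp,
    ShiftedHom.comp_mk₀]

section
variable [HasDerivedCategory C] [HasDerivedCategory D]

/-- `DerivedCategory.singleFunctorIsoCompQ`, on objects. -/
noncomputable def singleQIso (X : C) :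
    (DerivedCategory.singleFunctor C 0).obj X ≅ DerivedCategory.Q.obj ((singleFunctor C 0).obj X) :=
  (DerivedCategory.singleFunctorIsoCompQ C 0).app X

/-- `Functor.mapDerivedCategoryFactors`, on objects. -/
noncomputable def factorsIso (K : CochainComplex C ℤ) :
    F.mapDerivedCategory.obj (DerivedCategory.Q.obj K) ≅
      DerivedCategory.Q.obj ((F.mapHomologicalComplex (.up ℤ)).obj K) :=
  F.mapDerivedCategoryFactors.app K

/-- `Functor.mapCochainComplexSingleFunctor`, on objects. -/
noncomputable def mapSingleIso (X : C) :
    (F.mapHomologicalComplex (.up ℤ)).obj ((singleFunctor C 0).obj X) ≅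
      (singleFunctor D 0).obj (F.obj X) :=
  (F.mapCochainComplexSingleFunctor 0).app X

/-- `Functor.mapDerivedCategorySingleFunctor`, on objects. -/
noncomputable def mapDerivedSingleIso (X : C) :
    F.mapDerivedCategory.obj ((DerivedCategory.singleFunctor C 0).obj X) ≅
      (DerivedCategory.singleFunctor D 0).obj (F.obj X) :=
  (F.mapDerivedCategorySingleFunctor 0).app X

lemma mapDerivedSingleIso_eq (X : C) : mapDerivedSingleIso F X =
    F.mapDerivedCategory.mapIso (singleQIso X) ≪≫ factorsIso F _ ≪≫
      DerivedCategory.Q.mapIso (mapSingleIso F X) ≪≫ (singleQIso (F.obj X)).symm := by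
  -- The identity factors come from the composite that defines the isomorphism; they are removed
  -- afterwards.
  have : mapDerivedSingleIso F X = F.mapDerivedCategory.mapIso (singleQIso X) ≪≫ Iso.refl _ ≪≫
      factorsIso F _ ≪≫ Iso.refl _ ≪≫ DerivedCategory.Q.mapIso (mapSingleIso F X) ≪≫ Iso.refl _ ≪≫
      (singleQIso (F.obj X)).symm := rfl
  simp only [this, Iso.refl_trans]

lemma mapDerivedSingleIso_hom_tail (Y : C) :
    (factorsIso F _).inv ≫ F.mapDerivedCategory.map (singleQIso Y).inv ≫
      (mapDerivedSingleIso F Y).hom =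
    DerivedCategory.Q.map (mapSingleIso F Y).hom ≫ (singleQIso (F.obj Y)).inv := by
  rw [mapDerivedSingleIso_eq]
  simp [← Functor.map_comp_assoc]

include hg in
-- Since `extendHom` lies over `g`, the inverse in the derived category of the augmentation of `P`,
-- after applying `F`, can be traded for that of `P'`.
lemma mapDerivedSingleIso_inv_head :
    (DerivedCategory.singleFunctor D 0).map g ≫ (mapDerivedSingleIso F X).inv ≫
      F.mapDerivedCategory.map ((singleQIso X).hom ≫ inv (DerivedCategory.Q.map P.π')) ≫
        (factorsIso F P.cochainComplex).hom =
    ((singleQIso X').hom ≫ inv (DerivedCategory.Q.map P'.π')) ≫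
      DerivedCategory.Q.map (extendHom F P P' he) := by
  have h1 : (DerivedCategory.singleFunctor D 0).map g ≫ (singleQIso (F.obj X)).hom =
      (singleQIso X').hom ≫ DerivedCategory.Q.map ((singleFunctor D 0).map g) :=
    (DerivedCategory.singleFunctorIsoCompQ D 0).hom.naturality g
  have h2 : F.mapDerivedCategory.map (DerivedCategory.Q.map P.π') ≫ (factorsIso F _).hom =
      (factorsIso F _).hom ≫ DerivedCategory.Q.map ((F.mapHomologicalComplex (.up ℤ)).map P.π') :=
    F.mapDerivedCategoryFactors_hom_naturality P.π'
  have h2' : (factorsIso F P.cochainComplex).hom =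
      F.mapDerivedCategory.map (DerivedCategory.Q.map P.π') ≫ (factorsIso F _).hom ≫
          inv (DerivedCategory.Q.map ((F.mapHomologicalComplex (.up ℤ)).map P.π')) := by
    rw [reassoc_of% h2, IsIso.hom_inv_id, Category.comp_id]
  have h0 : extendHom F P P' he ≫ (F.mapHomologicalComplex (ComplexShape.up ℤ)).map P.π' ≫
      (mapSingleIso F X).hom = P'.π' ≫ (singleFunctor D 0).map g := extendHom_π' F P P' he g hg
  have h3 : DerivedCategory.Q.map ((singleFunctor D 0).map g) ≫
      DerivedCategory.Q.map (mapSingleIso F X).inv ≫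
        inv (DerivedCategory.Q.map ((F.mapHomologicalComplex (.up ℤ)).map P.π')) =
      inv (DerivedCategory.Q.map P'.π') ≫ DerivedCategory.Q.map (extendHom F P P' he) := by
    rw [IsIso.eq_inv_comp, ← Category.assoc, ← Category.assoc, IsIso.comp_inv_eq,
      ← Functor.map_comp, ← Functor.map_comp, ← Functor.map_comp, ← h0, Category.assoc,
      Category.assoc, Iso.hom_inv_id, Category.comp_id]
  rw [h2', Category.assoc, ← h3, ← reassoc_of% h1, mapDerivedSingleIso_eq]
  simp [← Functor.map_comp_assoc]

end

/-- In the derived category the class of a cocycle is the inverse of the augmentation followed by a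
map of complexes. The chain map `e` over `g` replaces the first factor for `P` by the one for `P'`,
and the identification of `F` of a single complex with a single complex takes care of the target. -/
theorem mk₀_comp_mapExactFunctor_extMk
    (he : ∀ i j, e i ≫ F.map (P.complex.d i j) = P'.complex.d i j ≫ e j)
    (hg : e 0 ≫ F.map P.aug = P'.aug ≫ g)
    (f : P.complex.X n ⟶ Y) (m : ℕ) (hm : n + 1 = m)
    (hf : P.complex.d m n ≫ f = 0) (hf') :
    (Ext.mk₀ g).comp ((P.extMk f m hm hf).mapExactFunctor F) (zero_add n) =
      P'.extMk (e n ≫ F.map f) m hm hf' := by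
  have := HasDerivedCategory.standard C
  have := HasDerivedCategory.standard D
  ext
  rw [Ext.comp_hom, Ext.mapExactFunctor_hom, extMk_hom, extMk_hom,
    extendHom_toSingleMk F P P' he f m _ _ _ (by simpa [cochainComplex_d _ _ _ m n rfl rfl]),
    ShiftedHom.map_comp, ShiftedHom.map_comp, ← ShiftedHom.comp_map, ShiftedHom.map_mk₀,
    ShiftedHom.map_mk₀, Ext.mk₀_hom, ← ShiftedHom.map_naturality_2 _ F.mapDerivedCategoryFactors,
    ShiftedHom.comp_map, map_comp_shift]
  have head := mapDerivedSingleIso_inv_head F P P' he g hg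
  have tail := mapDerivedSingleIso_hom_tail F Y
  simp only [ShiftedHom.mk₀_comp, ShiftedHom.comp_mk₀, Category.assoc] at head tail ⊢
  -- The middle factor is an arbitrary map of complexes `c`, framed by the identities at the source
  -- and at the target.
  have key := fun c : P.cochainComplex ⟶ ((singleFunctor C 0).obj Y)⟦(n : ℤ)⟧ =>
    congr($head ≫ ShiftedHom.map (ShiftedHom.map c (F.mapHomologicalComplex (.up ℤ)))
      DerivedCategory.Q ≫ $tail⟦(n : ℤ)⟧')
  simp only [(shiftFunctor (DerivedCategory D) (n : ℤ)).map_comp, Category.assoc] at key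
  exact key _
end
end CategoryTheory.ProjectiveResolution

/-! ### Projective resolutions from exact sequences of modules -/

namespace CategoryTheory.ProjectiveResolution

variable {A : Type u} [CommRing A]

lemma chainComplexOf_d {X : ℕ → ModuleCat.{u} A} {d : ∀ n, X (n + 1) ⟶ X n}
    (hd : ∀ n, d (n + 1) ≫ d n = 0) (n : ℕ) : (ChainComplex.of X d hd).d (n + 1) n = d n :=
  ChainComplex.of_d X d n

/-- A projective resolution of a module, from an exact sequence of projective modules. -/
noncomputable def ofExact {M : ModuleCat.{u} A} (X : ℕ → ModuleCat.{u} A)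
    (d : ∀ n, X (n + 1) ⟶ X n) (hd : ∀ n, d (n + 1) ≫ d n = 0) (ε : X 0 ⟶ M)
    (hX : ∀ n, Projective (X n)) (hε : d 0 ≫ ε = 0) (hsurj : Function.Surjective ε)
    (h₀ : ∀ x : X 0, ε x = 0 → ∃ y, d 0 y = x)
    (h₁ : ∀ n (x : X (n + 1)), d n x = 0 → ∃ y, d (n + 1) y = x) : ProjectiveResolution M where
  complex := ChainComplex.of X d hd
  projective := hX
  π := (ChainComplex.toSingle₀Equiv _ _).symm
    ⟨ε, (congrArg (· ≫ ε) (chainComplexOf_d hd 0)).trans hε⟩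
  quasiIso := ⟨fun n => by
    cases n with
    | zero =>
      rw [ChainComplex.quasiIsoAt₀_iff, ShortComplex.quasiIso_iff_of_zeros']
      · constructor
        · rw [ShortComplex.moduleCat_exact_iff]
          intro x hx
          obtain ⟨y, hy⟩ := h₀ x hx
          exact ⟨y, (congrArg (fun g : X 1 ⟶ X 0 => g y) (chainComplexOf_d hd 0)).trans hy⟩
        · rw [ModuleCat.epi_iff_surjective]
          exact hsurj
      · exact (ChainComplex.of X d hd).shape _ _ (by simp)
      all_goals rfl
    | succ n =>
      rw [quasiIsoAt_iff_exactAt', HomologicalComplex.exactAt_iff' _ (n + 2) (n + 1) n (by simp) (by simp),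
         ShortComplex.moduleCat_exact_iff]
      · intro x hx
        obtain ⟨y, hy⟩ := h₁ n x
          ((congrArg (fun g : X (n + 1) ⟶ X n => g x) (chainComplexOf_d hd n)).symm.trans hx)
        exact ⟨y, (congrArg (fun g : X (n + 2) ⟶ X (n + 1) => g y)
          (chainComplexOf_d hd (n + 1))).trans hy⟩
      · exact HomologicalComplex.exactAt_single_obj _ _ _ _ (by simp)⟩

section
variable {M : ModuleCat.{u} A} {X : ℕ → ModuleCat.{u} A}
    {d : ∀ n, X (n + 1) ⟶ X n} {hd : ∀ n, d (n + 1) ≫ d n = 0} {ε : X 0 ⟶ M}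
    {hX : ∀ n, Projective (X n)} {hε : d 0 ≫ ε = 0} {hsurj : Function.Surjective ε}
    {h₀ : ∀ x : X 0, ε x = 0 → ∃ y, d 0 y = x}
    {h₁ : ∀ n (x : X (n + 1)), d n x = 0 → ∃ y, d (n + 1) y = x}

lemma ofExact_d (n : ℕ) :
    (ofExact X d hd ε hX hε hsurj h₀ h₁).complex.d (n + 1) n = d n :=
  chainComplexOf_d hd n
end

end CategoryTheory.ProjectiveResolution

/-! ### Homology where the outgoing differential vanishes -/

namespace CategoryTheory.ShortComplex

variable {C D : Type*} [Category* C] [Category* D] [Abelian C] [Abelian D]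

/-- The projection onto the homology of a short complex whose second map vanishes. -/
noncomputable def toHomology (S : ShortComplex C) (h : S.g = 0) : S.X₂ ⟶ S.homology :=
  S.liftCycles (𝟙 _) (by rw [h, Limits.comp_zero]) ≫ S.homologyπ

lemma toHomology_naturality {S₁ S₂ : ShortComplex C} (φ : S₁ ⟶ S₂) (h₁ : S₁.g = 0)
    (h₂ : S₂.g = 0) : S₁.toHomology h₁ ≫ homologyMap φ = φ.τ₂ ≫ S₂.toHomology h₂ := by
  simp only [toHomology, Category.assoc, homologyπ_naturality]
  rw [← Category.assoc, ← Category.assoc]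
  congr 1
  simp [← cancel_mono S₂.iCycles]

lemma isIso_toHomology (S : ShortComplex C) (h : S.g = 0) (h' : S.f = 0) :
    IsIso (S.toHomology h) := by
  have h1 : IsIso S.iCycles := S.isIso_iCycles h
  have h2 : IsIso S.homologyπ := S.isIso_homologyπ h'
  have h3 : IsIso (S.liftCycles (𝟙 _) (by rw [h, Limits.comp_zero])) := by
    have : S.liftCycles (𝟙 _) (by rw [h, Limits.comp_zero]) = inv S.iCycles := by
      rw [← cancel_mono S.iCycles]; simp
    rw [this]; infer_instance
  unfold toHomology
  infer_instance

lemma toHomology_homologyIso_hom (T : ShortComplex C) (hT : T.g = 0) (hl : T.LeftHomologyData) :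
    T.toHomology hT ≫ hl.homologyIso.hom = hl.liftK (𝟙 _) (by rw [hT, Limits.comp_zero]) ≫ hl.π := by
  rw [toHomology, Category.assoc, hl.homologyπ_comp_homologyIso_hom,
    hl.liftCycles_comp_cyclesIso_hom_assoc]

lemma toHomology_homologyIso_hom_assoc (T : ShortComplex C) (hT : T.g = 0)
    (hl : T.LeftHomologyData) {Z : C} (f : hl.H ⟶ Z) :
    T.toHomology hT ≫ hl.homologyIso.hom ≫ f =
      hl.liftK (𝟙 _) (by rw [hT, Limits.comp_zero]) ≫ hl.π ≫ f := by
  rw [← Category.assoc, toHomology_homologyIso_hom, Category.assoc]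

/-- The image under `F` of left homology data of `S` is left homology data of `S.map F`; for these
data both sides are the lift of the identity followed by the projection. -/
lemma toHomology_map (S : ShortComplex C) (h : S.g = 0) (F : C ⥤ D) [F.Additive]
    [F.PreservesHomology] (h' : (S.map F).g = 0) :
    (S.map F).toHomology h' ≫ (S.mapHomologyIso F).hom = F.map (S.toHomology h) := by
  let hl := S.leftHomologyData
  have h0 : (S.mapHomologyIso F).hom = (hl.map F).homologyIso.hom ≫ F.map hl.homologyIso.inv :=
    congrArg Iso.hom (hl.mapHomologyIso_eq F)
  have h1 : (hl.map F).liftK (𝟙 _) (by rw [h', Limits.comp_zero]) =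
      F.map (hl.liftK (𝟙 _) (by rw [h, Limits.comp_zero])) := by
    refine (cancel_mono (hl.map F).i).mp ((LeftHomologyData.liftK_i _ _ _).trans ?_)
    refine ((F.map_comp _ hl.i).symm.trans ?_).symm
    rw [hl.liftK_i, F.map_id]
    rfl
  have h2 := (cancel_mono hl.homologyIso.inv).mpr (toHomology_homologyIso_hom S h hl)
  rw [Category.assoc, Iso.hom_inv_id, Category.comp_id] at h2
  refine (congrArg ((S.map F).toHomology h' ≫ ·) h0).trans
    ((toHomology_homologyIso_hom_assoc _ h' (hl.map F) _).trans ?_)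
  refine (congrArg (· ≫ (hl.map F).π ≫ F.map hl.homologyIso.inv) h1).trans ?_
  rw [h2, F.map_comp, F.map_comp, Category.assoc]
  rfl

lemma toHomology_comp_homologyMap_mapHomologyIso (F : C ⥤ D) [F.Additive] [F.PreservesHomology]
    {S : ShortComplex D} {S₁ S₂ : ShortComplex C} (a : S ⟶ S₁.map F) (b : S₁ ⟶ S₂) (h : S.g = 0)
    (h₁ : S₁.g = 0) :
    S.toHomology h ≫ homologyMap (S₂ := S₂.map F) (a ≫ F.mapShortComplex.map b) ≫
      (S₂.mapHomologyIso F).hom =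
      a.τ₂ ≫ F.map (S₁.toHomology h₁) ≫ F.map (homologyMap b) := by
  have h₁' : (S₁.map F).g = 0 := by
    change F.map S₁.g = 0
    rw [h₁, F.map_zero]
  have e1 : homologyMap (S₂ := S₂.map F) (a ≫ F.mapShortComplex.map b) ≫
      (S₂.mapHomologyIso F).hom =
      homologyMap a ≫ (S₁.mapHomologyIso F).hom ≫ F.map (homologyMap b) := by
    refine (congrArg (· ≫ (S₂.mapHomologyIso F).hom)
      (homologyMap_comp (S₃ := S₂.map F) a (F.mapShortComplex.map b))).trans ?_
    rw [Category.assoc]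
    exact congrArg (homologyMap a ≫ ·) (mapHomologyIso_hom_naturality b F)
  refine (congrArg (S.toHomology h ≫ ·) e1).trans ?_
  rw [← Category.assoc, toHomology_naturality a h h₁', Category.assoc]
  refine congrArg (a.τ₂ ≫ ·) ?_
  refine (Category.assoc _ _ _).symm.trans (congrArg (· ≫ F.map (homologyMap b)) ?_)
  exact toHomology_map S₁ h₁ F h₁'

end CategoryTheory.ShortComplex

/-! ### The semilinear map on Tor, computed by arbitrary resolutions -/

namespace SkewDuality
open CategoryTheory

variable {A B : Type u} [CommRing A] [CommRing B]

/-- The short complex in degree `n` of `X ⊗ Q`. -/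
noncomputable abbrev tensorSc (X : ModuleCat.{u} A) (Q : ChainComplex (ModuleCat.{u} A) ℕ) (n : ℕ) :
    ShortComplex (ModuleCat.{u} A) :=
  ((((tensoringLeft (ModuleCat.{u} A)).obj X).mapHomologicalComplex (ComplexShape.down ℕ)).obj Q).sc n

/-- If the differential of `X ⊗ Q` leaving degree `n` vanishes, the projection onto `Tor_n`. -/
noncomputable def torClass (X : ModuleCat.{u} A) {Y : ModuleCat.{u} A} (Q : ProjectiveResolution Y)
    (n : ℕ) (h : (tensorSc X Q.complex n).g = 0) :
    X ⊗ Q.complex.X n ⟶ ((Tor (ModuleCat.{u} A) n).obj X).obj Y :=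
  (tensorSc X Q.complex n).toHomology h ≫ (Q.isoLeftDerivedObj ((tensoringLeft _).obj X) n).inv

lemma isIso_torClass (X : ModuleCat.{u} A) {Y : ModuleCat.{u} A} (Q : ProjectiveResolution Y)
    (n : ℕ) (h : (tensorSc X Q.complex n).g = 0) (h' : (tensorSc X Q.complex n).f = 0) :
    IsIso (torClass X Q n h) :=
  @IsIso.comp_isIso _ _ _ _ _ _ _ ((tensorSc X Q.complex n).isIso_toHomology h h')
    (Iso.isIso_inv _)

section
variable {C : Type*} [Category* C]

lemma comp_iso_cancel {A₁ A₂ A₃ A₄ A₅ A₆ A₇ A₈ : C} (a : A₁ ⟶ A₂) (q : A₂ ⟶ A₃) (g : A₃ ⟶ A₄)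
    (j : A₄ ≅ A₅) (b : A₂ ⟶ A₅) (α : A₅ ⟶ A₆) (m : A₆ ⟶ A₇) (w : A₇ ⟶ A₈)
    (h : q ≫ g = b ≫ j.inv) :
    (a ≫ q) ≫ g ≫ j.hom ≫ α ≫ m ≫ w = a ≫ (b ≫ α) ≫ m ≫ w := by
  rw [Category.assoc, ← Category.assoc q, h]
  simp

lemma comp_four_assoc {A₁ A₂ A₃ A₄ A₅ : C} (a : A₁ ⟶ A₂) (b : A₂ ⟶ A₃) (c : A₃ ⟶ A₄)
    (d : A₄ ⟶ A₅) : a ≫ b ≫ c ≫ d = (a ≫ b ≫ c) ≫ d := by simp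

lemma comp_four_assoc' {A₁ A₂ A₃ A₄ A₅ : C} (a : A₁ ⟶ A₂) (b : A₂ ⟶ A₃) (c : A₃ ⟶ A₄)
    (d : A₄ ⟶ A₅) : (a ≫ b ≫ c) ≫ d = a ≫ b ≫ c ≫ d := by simp

end

/-- `torChange` is defined with a chosen resolution of `Y'`. Comparing `Q'` with it, and using that
`tensorChange` is natural in the second argument, shows that any chain map over `g` between any
resolutions computes the same map. -/
lemma torClass_torChange (e : A ≃+* B) (n : ℕ) {X Y : ModuleCat.{u} A} {X' Y' : ModuleCat.{u} B}
    (f : X ⟶ (ModuleCat.restrictScalars e.toRingHom).obj X')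
    (g : Y ⟶ (ModuleCat.restrictScalars e.toRingHom).obj Y')
    (Q : ProjectiveResolution Y) (Q' : ProjectiveResolution Y')
    (σ : Q.complex ⟶
      ((ModuleCat.restrictScalars.{u} e.toRingHom).mapProjectiveResolution Q').complex)
    (hσ : σ.f 0 ≫ ((ModuleCat.restrictScalars.{u} e.toRingHom).mapProjectiveResolution Q').π.f 0 =
      Q.π.f 0 ≫ g)
    (h : (tensorSc X Q.complex n).g = 0) (h' : (tensorSc X' Q'.complex n).g = 0) :
    torClass X Q n h ≫ torChange e n f g = X ◁ σ.f n ≫ (tensorChange e f).app (Q'.complex.X n) ≫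
      (ModuleCat.restrictScalars.{u} e.toRingHom).map (torClass X' Q' n h') := by
  let F := ModuleCat.restrictScalars.{u} e.toRingHom
  let P := projectiveResolution Y'
  let T := (tensoringLeft (ModuleCat.{u} A)).obj X
  let T' := (tensoringLeft (ModuleCat.{u} B)).obj X'
  let c := ComplexShape.down ℕ
  -- The comparison of the given resolution of `Y'` with the chosen one.
  let p : Q'.complex ⟶ P.complex := ProjectiveResolution.lift (𝟙 Y') Q' P
  have hp : p.f 0 ≫ P.π.f 0 = Q'.π.f 0 ≫ 𝟙 Y' := ProjectiveResolution.lift_commutes_zero _ _ _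
  have hp' : (F.map (p.f 0)) ≫ (F.mapProjectiveResolution P).π.f 0 =
      (F.mapProjectiveResolution Q').π.f 0 := by
    refine (Category.assoc _ _ _).symm.trans (congrArg
      (· ≫ ((HomologicalComplex.singleMapHomologicalComplex F c 0).hom.app Y').f 0) ?_)
    exact (F.map_comp _ _).symm.trans (congrArg F.map (hp.trans (Category.comp_id _)))
  have hσ' : (σ ≫ (F.mapHomologicalComplex _).map p).f 0 ≫ (F.mapProjectiveResolution P).π.f 0 =
      Q.π.f 0 ≫ g := by
    refine (Category.assoc _ _ _).trans ?_
    refine Eq.trans ?_ hσ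
    exact congrArg (σ.f 0 ≫ ·) hp'
  have h1 := ProjectiveResolution.isoLeftDerivedObj_inv_naturality g Q (F.mapProjectiveResolution P)
    (σ ≫ (F.mapHomologicalComplex _).map p) hσ' T n
  have h2 := ProjectiveResolution.isoLeftDerivedObj_inv_naturality (𝟙 Y') Q' P p hp T' n
  have h2' : (Q'.isoLeftDerivedObj T' n).inv = 
      (T'.mapHomologicalComplex c ⋙ HomologicalComplex.homologyFunctor _ _ n).map p ≫
          (P.isoLeftDerivedObj T' n).inv := by
    rw [← h2, CategoryTheory.Functor.map_id, Category.comp_id]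
  let α := (T.mapHomologicalComplex c).map σ ≫ (NatTrans.mapHomologicalComplex (tensorChange e f) c).app Q'.complex
  let α' := (NatTrans.mapHomologicalComplex (tensorChange e f) c).app P.complex
  -- The comparison `p` moves past the change of rings, so that it acts over `B` and is absorbed in
  -- `torClass X' Q'`.
  have h3 : (T.mapHomologicalComplex c).map (σ ≫ (F.mapHomologicalComplex _).map p) ≫ α' =
     α ≫ (F.mapHomologicalComplex c).map ((T'.mapHomologicalComplex c).map p) := by
    refine HomologicalComplex.hom_ext _ _ fun i => ?_
    change T.map (σ.f i ≫ F.map (p.f i)) ≫ (tensorChange e f).app _ =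
      (T.map (σ.f i) ≫ (tensorChange e f).app _) ≫ F.map (T'.map (p.f i))
    refine (congrArg (· ≫ (tensorChange e f).app (P.complex.X i))
      (T.map_comp (σ.f i) (F.map (p.f i)))).trans ?_
    refine (Category.assoc _ _ _).trans ((congrArg (T.map (σ.f i) ≫ ·) ?_).trans
      (Category.assoc _ _ _).symm)
    exact (tensorChange e f).naturality (p.f i)
  let a : tensorSc X Q.complex n ⟶ (tensorSc X' Q'.complex n).map F :=
    (HomologicalComplex.shortComplexFunctor _ c n).map α
  let b : tensorSc X' Q'.complex n ⟶ tensorSc X' P.complex n := 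
    (HomologicalComplex.shortComplexFunctor _ c n).map ((T'.mapHomologicalComplex c).map p)
  have h4 := ShortComplex.toHomology_comp_homologyMap_mapHomologyIso F a b h h'
  have h6 : (HomologicalComplex.shortComplexFunctor _ c n).map (α ≫
      (F.mapHomologicalComplex c).map ((T'.mapHomologicalComplex c).map p)) =
      a ≫ F.mapShortComplex.map b :=
    (HomologicalComplex.shortComplexFunctor _ c n).map_comp α
      ((F.mapHomologicalComplex c).map ((T'.mapHomologicalComplex c).map p))
  have h7 : (HomologicalComplex.homologyFunctor _ c n).map (α ≫
      (F.mapHomologicalComplex c).map ((T'.mapHomologicalComplex c).map p)) =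
      ShortComplex.homologyMap ((HomologicalComplex.shortComplexFunctor _ c n).map (α ≫
      (F.mapHomologicalComplex c).map ((T'.mapHomologicalComplex c).map p))) := rfl
  have h5 : (HomologicalComplex.homologyFunctor _ c n).map ((T.mapHomologicalComplex c).map
      (σ ≫ (F.mapHomologicalComplex _).map p)) ≫ (HomologicalComplex.homologyFunctor _ c n).map α' =
      ShortComplex.homologyMap (S₂ := (tensorSc X' P.complex n).map F)
        (a ≫ F.mapShortComplex.map b) :=
    ((HomologicalComplex.homologyFunctor _ c n).map_comp _ _).symm.trans
      ((congrArg (HomologicalComplex.homologyFunctor _ c n).map h3).trans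
        (h7.trans (congrArg (fun q : tensorSc X Q.complex n ⟶ (tensorSc X' P.complex n).map F =>
          ShortComplex.homologyMap q) h6)))
  refine (comp_iso_cancel _ _ _ ((F.mapProjectiveResolution P).isoLeftDerivedObj T n) _ _ _ _ h1).trans
    ?_
  refine (congrArg (fun q => (tensorSc X Q.complex n).toHomology h ≫ q ≫
    ((tensorSc X' P.complex n).mapHomologyIso F).hom ≫
    F.map (P.isoLeftDerivedObj T' n).inv) h5).trans ?_
  refine (comp_four_assoc _ _ _ _).trans ((congrArg (· ≫ F.map (P.isoLeftDerivedObj T' n).inv)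
    h4).trans ?_)
  refine (comp_four_assoc' _ _ _ _).trans ?_
  refine Eq.trans ?_ (Category.assoc (X ◁ σ.f n) _ _)
  refine congrArg ((X ◁ σ.f n ≫ (tensorChange e f).app (Q'.complex.X n)) ≫ ·) ?_
  refine (congrArg (F.map ((tensorSc X' Q'.complex n).toHomology h') ≫ ·)
    (F.map_comp _ _).symm).trans ((F.map_comp _ _).symm.trans (congrArg F.map ?_))
  exact congrArg ((tensorSc X' Q'.complex n).toHomology h' ≫ ·) h2'.symm

end SkewDuality

/-! ### Koszul complexes as iterated cones -/

namespace SkewDuality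
namespace Koszul

open TensorProduct

variable {A : Type u} [CommRing A]

variable (A) in
/-- A complex of modules `⋯ → X₂ → X₁ → X₀`. -/
structure Cx where
  /-- the modules -/
  X : ℕ → ModuleCat.{u} A
  /-- the differentials -/
  d : ∀ n, X (n + 1) →ₗ[A] X n
  d_d : ∀ n x, d n (d (n + 1) x) = 0

/-- The modules of the cone of multiplication by an element. -/
def coneX (P : Cx A) : ℕ → ModuleCat.{u} A
  | 0 => P.X 0
  | n + 1 => ModuleCat.of A (P.X (n + 1) × P.X n)

/-- The differentials of the cone of multiplication by an element. -/
def coneD (P : Cx A) (a : A) : ∀ n, coneX P (n + 1) →ₗ[A] coneX P n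
  | 0 => (P.d 0).coprod (a • LinearMap.id)
  | n + 1 => ((P.d (n + 1)).coprod (a • LinearMap.id)).prod
      (-((P.d n).comp (LinearMap.snd A (P.X (n + 2)) (P.X (n + 1)))))

lemma coneD_zero (P : Cx A) (a : A) (p : P.X 1) (q : P.X 0) :
    coneD P a 0 (p, q) = (P.d 0 p + a • q : P.X 0) := rfl

lemma coneD_succ (P : Cx A) (a : A) (n : ℕ) (p : P.X (n + 2)) (q : P.X (n + 1)) :
    coneD P a (n + 1) (p, q) = ((P.d (n + 1) p + a • q, - P.d n q) : P.X (n + 1) × P.X n) := rfl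

/-- The cone of multiplication by `a` on a complex. -/
def cone (P : Cx A) (a : A) : Cx A where
  X := coneX P
  d := coneD P a
  d_d n x := by
    obtain ⟨p, q⟩ := x
    rw [coneD_succ]
    cases n with
    | zero =>
      rw [coneD_zero]
      simp only [map_add, P.d_d, map_smul, zero_add, smul_neg, add_neg_cancel]
      rfl
    | succ n =>
      rw [coneD_succ]
      simp [P.d_d]
      rfl

/-- The Koszul complex of a list of elements. -/
def kos : List A → Cx A
  | [] => 
    { X := fun n => match n with
        | 0 => ModuleCat.of A A
        | _ + 1 => ModuleCat.of A PUnit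
      d := fun _ => 0
      d_d := fun _ _ => rfl }
  | a :: l => cone (kos l) a

lemma free_kos (l : List A) (n : ℕ) : Module.Free A ((kos l).X n) := by
  induction l generalizing n with
  | nil =>
    cases n with
    | zero => exact inferInstanceAs (Module.Free A A)
    | succ n => exact inferInstanceAs (Module.Free A PUnit.{u + 1})
  | cons a l ih =>
    cases n with
    | zero => exact ih 0
    | succ n =>
      have := ih n
      have := ih (n + 1)
      exact inferInstanceAs (Module.Free A ((kos l).X (n + 1) × (kos l).X n))

lemma subsingleton_kos (l : List A) (n : ℕ) (h : l.length < n) :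
    Subsingleton ((kos l).X n) := by
  induction l generalizing n with
  | nil =>
    cases n with
    | zero => simp at h
    | succ n => exact inferInstanceAs (Subsingleton PUnit.{u + 1})
  | cons a l ih =>
    cases n with
    | zero => simp at h
    | succ n =>
      rw [List.length_cons] at h
      have := ih n (by omega)
      have := ih (n + 1) (by omega)
      exact inferInstanceAs (Subsingleton ((kos l).X (n + 1) × (kos l).X n))

lemma projective_of_decomposition {C : Type*} [Category* C] [Preadditive C] {P Q Z : C}
    (i₁ : P ⟶ Z) (i₂ : Q ⟶ Z) (p₁ : Z ⟶ P) (p₂ : Z ⟶ Q) (h : p₁ ≫ i₁ + p₂ ≫ i₂ = 𝟙 Z)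
    [Projective P] [Projective Q] : Projective Z where
  factors f e _ := ⟨p₁ ≫ Projective.factorThru (i₁ ≫ f) e + p₂ ≫ Projective.factorThru (i₂ ≫ f) e,
    by rw [Preadditive.add_comp, Category.assoc, Category.assoc, Projective.factorThru_comp,
      Projective.factorThru_comp, ← Category.assoc, ← Category.assoc, ← Preadditive.add_comp, h,
      Category.id_comp]⟩

/-- The terms are finite sums of copies of `A`, and an additive functor preserves the splittings.
This is needed for `S ⊗_R M ⊗_S -` followed by restriction along `y`, whose values are modules over
another ring. -/
lemma projective_map_kos {B : Type u} [CommRing B] (G : ModuleCat.{u} A ⥤ ModuleCat.{u} B)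
    [G.Additive] (hG : Projective (G.obj (ModuleCat.of A A))) (l : List A) (n : ℕ) :
    Projective (G.obj ((kos l).X n)) := by
  induction l generalizing n with
  | nil =>
    cases n with
    | zero => exact hG
    | succ n =>
      have hz : Limits.IsZero (ModuleCat.of A PUnit.{u + 1}) := ModuleCat.isZero_of_subsingleton _
      exact (Functor.map_isZero G hz).projective
  | cons a l ih =>
    cases n with
    | zero => exact ih 0
    | succ n =>
      have := ih n
      have := ih (n + 1)
      let M := (kos l).X (n + 1)
      let N := (kos l).X n
      refine projective_of_decomposition (Z := G.obj (ModuleCat.of A (M × N)))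
        (G.map (ModuleCat.ofHom (LinearMap.inl A M N)))
        (G.map (ModuleCat.ofHom (LinearMap.inr A M N)))
        (G.map (ModuleCat.ofHom (LinearMap.fst A M N)))
        (G.map (ModuleCat.ofHom (LinearMap.snd A M N))) ?_
      rw [← G.map_comp, ← G.map_comp, ← G.map_add, ← G.map_id]
      refine congrArg G.map (ModuleCat.hom_ext (LinearMap.ext fun x => ?_))
      exact Prod.ext (add_zero x.1) (zero_add x.2)

/-- The Koszul complex in degree zero. -/
def kosBot : ∀ l : List A, (kos l).X 0 ≃ₗ[A] A
  | [] => LinearEquiv.refl A A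
  | _ :: l => kosBot l

/-- The inclusion of the second factor of the top term of a cone. -/
noncomputable def kosTopInr (a : A) (l : List A) (n : ℕ) (h : l.length = n) :
    (kos l).X n ≃ₗ[A] (kos (a :: l)).X (n + 1) :=
  LinearEquiv.ofBijective (LinearMap.inr A ((kos l).X (n + 1)) ((kos l).X n))
    ⟨LinearMap.inr_injective, fun x => ⟨x.2, by
      have := subsingleton_kos l (n + 1) (by omega)
      exact Prod.ext (Subsingleton.elim _ _) rfl⟩⟩

/-- The Koszul complex in its top degree. -/
noncomputable def kosTop : ∀ (l : List A) (n : ℕ), l.length = n → (A ≃ₗ[A] (kos l).X n)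
  | [], 0, _ => LinearEquiv.refl A A
  | [], _ + 1, h => absurd h (by simp)
  | _ :: _, 0, h => absurd h (by simp)
  | a :: l, n + 1, h => (kosTop l n (by simpa using h)).trans (kosTopInr a l n (by simpa using h))

/-- The matrix entries of the differential are zero or, up to sign, members of the list. This makes
the differentials vanish modulo the ideal. -/
lemma kos_d_mem (l : List A) (n : ℕ) (x : (kos l).X (n + 1)) :
    (kos l).d n x ∈ Ideal.ofList l • (⊤ : Submodule A ((kos l).X n)) := by
  induction l generalizing n with
  | nil => exact Submodule.zero_mem _
  | cons a l ih =>
    have hle : Ideal.ofList l ≤ Ideal.ofList (a :: l) := by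
      rw [Ideal.ofList_cons]; exact le_sup_right
    have ha : a ∈ Ideal.ofList (a :: l) := by
      rw [Ideal.ofList_cons]; exact Ideal.mem_sup_left (Ideal.mem_span_singleton_self a)
    obtain ⟨p, q⟩ := x
    cases n with
    | zero =>
      exact Submodule.add_mem _ (Submodule.smul_mono_left hle (ih 0 p))
        (Submodule.smul_mem_smul ha Submodule.mem_top)
    | succ n =>
      have key1 : ∀ y ∈ Ideal.ofList (a :: l) • (⊤ : Submodule A ((kos l).X (n + 1))),
          LinearMap.inl A ((kos l).X (n + 1)) ((kos l).X n) y ∈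
            Ideal.ofList (a :: l) • (⊤ : Submodule A ((kos l).X (n + 1) × (kos l).X n)) :=
        fun y hy => Submodule.smul_mono le_rfl le_top
          (Submodule.map_smul'' _ _ (LinearMap.inl A ((kos l).X (n + 1)) ((kos l).X n)) ▸ Submodule.mem_map_of_mem hy)
      have key2 : ∀ y ∈ Ideal.ofList (a :: l) • (⊤ : Submodule A ((kos l).X n)),
          LinearMap.inr A ((kos l).X (n + 1)) ((kos l).X n) y ∈
            Ideal.ofList (a :: l) • (⊤ : Submodule A ((kos l).X (n + 1) × (kos l).X n)) :=
        fun y hy => Submodule.smul_mono le_rfl le_top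
          (Submodule.map_smul'' _ _ (LinearMap.inr A ((kos l).X (n + 1)) ((kos l).X n)) ▸ Submodule.mem_map_of_mem hy)
      have h1 := key1 _ (Submodule.add_mem _ (Submodule.smul_mono_left hle (ih (n + 1) p))
        (Submodule.smul_mem_smul ha (Submodule.mem_top (x := q))))
      have h2 := key2 _ (Submodule.neg_mem _ (Submodule.smul_mono_left hle (ih n q)))
      have h3 := Submodule.add_mem _ h1 h2
      have e : LinearMap.inl A ((kos l).X (n + 1)) ((kos l).X n) ((kos l).d (n + 1) p + a • q) +
        LinearMap.inr A ((kos l).X (n + 1)) ((kos l).X n) (-(kos l).d n q) =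
          ((kos l).d (n + 1) p + a • q, -(kos l).d n q) := by simp
      rw [e] at h3
      exact h3

/-- Wedging with the basis vector of `b` is a homotopy from multiplication by `b` to zero; in the
top degree one of its two terms is missing and the identity becomes `g ∘ d = b`. -/
lemma exists_comp_d_of_mem (l : List A) (m : ℕ) (h : l.length = m + 1) (b : A) (hb : b ∈ l) :
    ∃ g : (kos l).X m →ₗ[A] (kos l).X (m + 1), ∀ p, g ((kos l).d m p) = b • p := by
  induction l generalizing m with
  | nil => simp at hb
  | cons a l ih =>
    have hl : l.length = m := by simpa using h
    -- The complex of the tail vanishes above its length, so first components in the top degree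
    -- carry no information.
    have hs : ∀ x y : (kos l).X (m + 1), x = y := by
      have := subsingleton_kos l (m + 1) (by omega)
      exact Subsingleton.elim
    rcases List.mem_cons.mp hb with rfl | hb
    · cases m with
      | zero =>
        refine ⟨LinearMap.inr A ((kos l).X 1) ((kos l).X 0), ?_⟩
        rintro ⟨p, q⟩
        refine Prod.ext (hs _ _) ?_
        change (kos l).d 0 p + b • q = b • q
        rw [hs p 0, map_zero, zero_add]
      | succ m =>
        refine ⟨(LinearMap.inr A ((kos l).X (m + 2)) ((kos l).X (m + 1))).comp
          (LinearMap.fst A ((kos l).X (m + 1)) ((kos l).X m)), ?_⟩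
        rintro ⟨p, q⟩
        refine Prod.ext (hs _ _) ?_
        change (kos l).d (m + 1) p + b • q = b • q
        rw [hs p 0, map_zero, zero_add]
    · cases m with
      | zero => rw [List.length_eq_zero_iff.mp hl] at hb; simp at hb
      | succ m =>
        obtain ⟨g, hg⟩ := ih m hl hb
        -- The sign cancels the sign of the second component of the cone differential.
        refine ⟨-((LinearMap.inr A ((kos l).X (m + 2)) ((kos l).X (m + 1))).comp
          (g.comp (LinearMap.snd A ((kos l).X (m + 1)) ((kos l).X m)))), ?_⟩
        rintro ⟨p, q⟩
        refine Prod.ext (hs _ _) ?_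
        change -(g (-(kos l).d m q)) = b • q
        rw [map_neg, neg_neg, hg]

/-- Elements of the ideal act on the top degree of the Koszul complex by maps that factor through
the differential. -/
lemma exists_comp_d_eq_smul (l : List A) (m : ℕ) (h : l.length = m + 1) (a : A)
    (ha : a ∈ Ideal.ofList l) :
    ∃ g : (kos l).X m →ₗ[A] (kos l).X (m + 1), ∀ p, g ((kos l).d m p) = a • p := by
  -- The elements with this property form an ideal, so it suffices to treat the members of the list.
  let J : Ideal A :=
    { carrier := {a | ∃ g : (kos l).X m →ₗ[A] (kos l).X (m + 1), ∀ p, g ((kos l).d m p) = a • p}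
      add_mem' := by
        rintro a b ⟨g, hg⟩ ⟨g', hg'⟩
        exact ⟨g + g', fun p => by rw [LinearMap.add_apply, hg, hg', add_smul]⟩
      zero_mem' := ⟨0, fun p => by simp⟩
      smul_mem' := by
        rintro c a ⟨g, hg⟩
        exact ⟨c • g, fun p => by rw [LinearMap.smul_apply, hg, smul_smul]; rfl⟩ }
  exact (Ideal.span_le.mpr (exists_comp_d_of_mem l m h) : Ideal.ofList l ≤ J) ha

/-! ### Exactness of Koszul complexes with coefficients -/

section Tensor

variable (X : Type*) [AddCommGroup X] [Module A X]

/-- Exactness of `X ⊗ P` in positive degrees. -/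
def ExactTensor (P : Cx A) : Prop :=
  ∀ n (z : X ⊗[A] P.X (n + 1)), (P.d n).lTensor X z = 0 → ∃ w, (P.d (n + 1)).lTensor X w = z

/-- The decomposition of the tensor product with a positive degree term of a cone. -/
noncomputable def coneSplit (P : Cx A) (n : ℕ) :
    X ⊗[A] (coneX P (n + 1) : Type u) ≃ₗ[A] (X ⊗[A] P.X (n + 1)) × (X ⊗[A] P.X n) :=
  TensorProduct.prodRight A A X (P.X (n + 1)) (P.X n)

lemma lTensor_coprod_smul {M N : Type*} [AddCommGroup M] [AddCommGroup N] [Module A M] [Module A N]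
    (f : M →ₗ[A] N) (a : A) (z : X ⊗[A] (M × N)) :
    (f.coprod (a • LinearMap.id)).lTensor X z =
      f.lTensor X (TensorProduct.prodRight A A X M N z).1 +
        a • (TensorProduct.prodRight A A X M N z).2 := by
  induction z with
  | zero => simp
  | tmul x y => simp [tmul_add]
  | add y z hy hz =>
    rw [map_add, hy, hz, map_add, Prod.fst_add, Prod.snd_add, map_add, smul_add]
    abel

lemma prodRight_lTensor_prod {M N N' : Type*} [AddCommGroup M] [AddCommGroup N] [Module A M]
    [Module A N] [AddCommGroup N'] [Module A N'] (f : M →ₗ[A] N) (g : M →ₗ[A] N')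
    (z : X ⊗[A] M) :
    TensorProduct.prodRight A A X N N' ((f.prod g).lTensor X z) =
      (f.lTensor X z, g.lTensor X z) := by
  induction z with
  | zero => simp; rfl
  | tmul x y => simp
  | add y z hy hz => simp [map_add, hy, hz]

lemma lTensor_neg_comp_snd {M N N' : Type*} [AddCommGroup M] [AddCommGroup N] [Module A M]
    [Module A N] [AddCommGroup N'] [Module A N'] (g : N →ₗ[A] N') (z : X ⊗[A] (M × N)) :
    (-(g.comp (LinearMap.snd A M N))).lTensor X z =
      - g.lTensor X (TensorProduct.prodRight A A X M N z).2 := by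
  induction z with
  | zero => simp
  | tmul x y => simp
  | add y z hy hz =>
    rw [map_add, hy, hz, map_add, Prod.snd_add, map_add, neg_add]

lemma coneD_zero_lTensor (P : Cx A) (a : A) (z : X ⊗[A] (coneX P 1 : Type u)) :
    (coneD P a 0).lTensor X z =
      (P.d 0).lTensor X (coneSplit X P 0 z).1 + a • (coneSplit X P 0 z).2 :=
  lTensor_coprod_smul X (P.d 0) a z

lemma coneD_succ_lTensor (P : Cx A) (a : A) (n : ℕ) (z : X ⊗[A] (coneX P (n + 2) : Type u)) :
    coneSplit X P n ((coneD P a (n + 1)).lTensor X z) =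
      ((P.d (n + 1)).lTensor X (coneSplit X P (n + 1) z).1 + a • (coneSplit X P (n + 1) z).2,
        - (P.d n).lTensor X (coneSplit X P (n + 1) z).2) := by
  let z' : X ⊗[A] (P.X (n + 2) × P.X (n + 1)) := z
  have h := prodRight_lTensor_prod X ((P.d (n + 1)).coprod (a • LinearMap.id))
    (-((P.d n).comp (LinearMap.snd A (P.X (n + 2)) (P.X (n + 1))))) z'
  rw [lTensor_coprod_smul X (P.d (n + 1)) a z', lTensor_neg_comp_snd X (P.d n) z'] at h
  exact h

variable {X}

/-- The homology of a cone in degree `n + 1` is built from that of `X ⊗ P` in degree `n + 1` and the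
kernel of `a` on that in degree `n`. The first vanishes by `hP`, the second by `hP` or, for `n = 0`,
by injectivity of `a` on the degree zero homology. -/
lemma ExactTensor.cone {P : Cx A} {a : A} (hP : ExactTensor X P)
    (ha : ∀ z : X ⊗[A] P.X 0, (∃ w, (P.d 0).lTensor X w = a • z) →
      ∃ w, (P.d 0).lTensor X w = z) : ExactTensor X (cone P a) := by
  have main : ∀ n (p : X ⊗[A] P.X (n + 1)) (q : X ⊗[A] P.X n),
      (P.d n).lTensor X p + a • q = 0 → (∃ w, (P.d n).lTensor X w = q) →
      ∃ w, coneSplit X P n ((coneD P a (n + 1)).lTensor X w) = (p, q) := by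
    rintro n p q h ⟨w, hw⟩
    -- With `q = dw`, the cycle condition says that `p + a w` is a cycle. If it equals `dp'`, then
    -- `(p', -w)` is a preimage of `(p, q)`.
    obtain ⟨p', hp'⟩ := hP n (p + a • w) (by rw [map_add, map_smul, hw, h])
    refine ⟨(coneSplit X P (n + 1)).symm (p', -w), ?_⟩
    rw [coneD_succ_lTensor, LinearEquiv.apply_symm_apply, hp', map_neg, neg_neg, hw]
    simp
  intro n z hz
  have hsuff : (P.d n).lTensor X (coneSplit X P n z).1 + a • (coneSplit X P n z).2 = 0 ∧
      ∃ w, (P.d n).lTensor X w = (coneSplit X P n z).2 := by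
    cases n with
    | zero =>
      have h1 := (coneD_zero_lTensor X P a z).symm.trans hz
      -- In the lowest degree `a q = -dp` is a boundary, hence so is `q`.
      refine ⟨h1, ha _ ⟨-(coneSplit X P 0 z).1, ?_⟩⟩
      rw [map_neg, neg_eq_iff_add_eq_zero]
      exact h1
    | succ n =>
      have h1 := (coneD_succ_lTensor X P a n z).symm.trans
        ((congrArg (coneSplit X P n) hz).trans (map_zero _))
      rw [Prod.mk_eq_zero, neg_eq_zero] at h1
      exact ⟨h1.1, hP n _ h1.2⟩
  obtain ⟨w, hw⟩ := main n _ _ hsuff.1 hsuff.2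
  exact ⟨w, (coneSplit X P n).injective hw⟩

/-- Multiplication by each member of the list is injective modulo the later ones. -/
def Reg (X : Type*) [AddCommGroup X] [Module A X] : List A → Prop
  | [] => True
  | a :: l => Reg X l ∧ ∀ x : X, a • x ∈ Ideal.ofList l • (⊤ : Submodule A X) →
      x ∈ Ideal.ofList l • (⊤ : Submodule A X)

/-- The Koszul complex of a module in degree zero. -/
noncomputable def kosTensorBot (l : List A) : X ⊗[A] (kos l).X 0 ≃ₗ[A] X :=
  (TensorProduct.congr (LinearEquiv.refl A X) (kosBot l)).trans (TensorProduct.rid A X)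

lemma kosTensorBot_tmul (l : List A) (x : X) (p : (kos l).X 0) :
    kosTensorBot l (x ⊗ₜ p) = kosBot l p • x := rfl

/-- Each cone enlarges the image of the last differential by `a X`, so the degree zero homology is
the quotient of `X` by the ideal of the list. -/
lemma exists_kos_d_zero (l : List A) (z : X ⊗[A] (kos l).X 0) :
    (∃ w, ((kos l).d 0).lTensor X w = z) ↔
      kosTensorBot l z ∈ Ideal.ofList l • (⊤ : Submodule A X) := by
  induction l with
  | nil =>
    have h0 : ∀ w, ((kos ([] : List A)).d 0).lTensor X w = 0 := fun w => by
      change (0 : _ →ₗ[A] _).lTensor X w = 0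
      rw [LinearMap.lTensor_zero, LinearMap.zero_apply]
    rw [Ideal.ofList_nil, Submodule.bot_smul, Submodule.mem_bot, LinearEquiv.map_eq_zero_iff]
    exact ⟨fun ⟨w, hw⟩ => hw.symm.trans (h0 w), fun h => ⟨0, (h0 0).trans h.symm⟩⟩
  | cons a l ih =>
    rw [Ideal.ofList_cons, Submodule.sup_smul, Submodule.mem_sup]
    constructor
    · rintro ⟨w, rfl⟩
      refine ⟨a • kosTensorBot l (coneSplit X (kos l) 0 w).2,
        Submodule.smul_mem_smul (Ideal.mem_span_singleton_self a) Submodule.mem_top,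
        kosTensorBot l (((kos l).d 0).lTensor X (coneSplit X (kos l) 0 w).1),
        (ih _).mp ⟨_, rfl⟩, ?_⟩
      refine Eq.trans ?_ (congrArg (kosTensorBot l) (coneD_zero_lTensor X (kos l) a w).symm)
      rw [map_add, map_smul, add_comm]
    · rintro ⟨y, hy, x, hx, h⟩
      rw [Submodule.ideal_span_singleton_smul, Submodule.mem_smul_pointwise_iff_exists] at hy
      obtain ⟨y, -, rfl⟩ := hy
      obtain ⟨x', rfl⟩ := (kosTensorBot l).surjective x
      obtain ⟨y', rfl⟩ := (kosTensorBot l).surjective y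
      obtain ⟨w, hw⟩ := (ih x').mpr hx
      refine ⟨(coneSplit X (kos l) 0).symm (w, y'), (coneD_zero_lTensor X (kos l) a _).trans ?_⟩
      rw [LinearEquiv.apply_symm_apply, hw]
      refine (kosTensorBot l).injective (Eq.trans ?_ h)
      rw [map_add, map_smul, add_comm]

lemma exactTensor_kos (l : List A) (h : Reg X l) : ExactTensor X (kos l) := by
  induction l with
  | nil =>
    intro n z _
    have : Subsingleton ((kos ([] : List A)).X (n + 1)) := subsingleton_kos _ _ (by simp)
    exact ⟨0, Subsingleton.elim _ _⟩
  | cons a l ih =>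
    refine (ih h.1).cone fun z hz => ?_
    rw [exists_kos_d_zero] at hz ⊢
    rw [map_smul] at hz
    exact h.2 _ hz

end Tensor

/-! ### Regularity from commuting retractions -/

section Operators

variable {X : Type*} [AddCommGroup X] [Module A X] {ι : Type*} (z : ι → A) (E : ι → X →+ X)

lemma map_eq_zero_of_mem_ofList_smul (F : X →+ X) (l : List A) (hF : ∀ a ∈ l, ∀ x : X, F (a • x) = 0)
    (x : X) (hx : x ∈ Ideal.ofList l • (⊤ : Submodule A X)) : F x = 0 := by
  induction l generalizing x with
  | nil =>
    rw [Ideal.ofList_nil, Submodule.bot_smul, Submodule.mem_bot] at hx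
    rw [hx, map_zero]
  | cons a l ih =>
    rw [Ideal.ofList_cons, Submodule.sup_smul, Submodule.mem_sup] at hx
    obtain ⟨y, hy, w, hw, rfl⟩ := hx
    rw [Submodule.ideal_span_singleton_smul, Submodule.mem_smul_pointwise_iff_exists] at hy
    obtain ⟨y, -, rfl⟩ := hy
    rw [map_add, hF a List.mem_cons_self, ih (fun b hb => hF b (List.mem_cons_of_mem _ hb)) _ hw,
      add_zero]

/-- The operator is the composite of the `E j`. Each factor changes an element by a multiple of `z
j`, kills the multiples of `z j` and commutes with the other `z i`. -/
lemma exists_operator (h1 : ∀ j x, ∃ y, x - E j x = z j • y) (h2 : ∀ j x, E j (z j • x) = 0)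
    (h3 : ∀ i j, i ≠ j → ∀ x, E j (z i • x) = z i • E j x) (js : List ι) (hjs : js.Nodup) :
    ∃ F : X →+ X, (∀ x, x - F x ∈ Ideal.ofList (js.map z) • (⊤ : Submodule A X)) ∧
      (∀ j ∈ js, ∀ x, F (z j • x) = 0) ∧ ∀ i, i ∉ js → ∀ x, F (z i • x) = z i • F x := by
  induction js with
  | nil => exact ⟨AddMonoidHom.id X, fun x => by simp, by simp, fun i _ x => rfl⟩
  | cons j js ih =>
    rw [List.nodup_cons] at hjs
    obtain ⟨F, hF1, hF2, hF3⟩ := ih hjs.2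
    refine ⟨F.comp (E j), fun x => ?_, fun i hi x => ?_, fun i hi x => ?_⟩
    · obtain ⟨y, hy⟩ := h1 j x
      have : x - F.comp (E j) x = z j • y + (E j x - F (E j x)) := by
        rw [← hy, AddMonoidHom.comp_apply]; abel
      rw [this, List.map_cons, Ideal.ofList_cons, Submodule.sup_smul]
      exact Submodule.add_mem_sup (Submodule.smul_mem_smul (Ideal.mem_span_singleton_self _)
        Submodule.mem_top) (hF1 _)
    · rw [AddMonoidHom.comp_apply]
      rcases List.mem_cons.mp hi with rfl | hi
      · rw [h2, map_zero]
      · rw [h3 i j (fun h => hjs.1 (h ▸ hi)), hF2 i hi]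
    · rw [List.mem_cons, not_or] at hi
      rw [AddMonoidHom.comp_apply, h3 i j hi.1, hF3 i hi.2]
      rfl

/-- Let `F` be the operator of the later indices. If `z j x` lies in their ideal times `X`, then `z
j (F x) = F (z j x) = 0`, so `F x = 0`, and `x = x - F x` lies there as well. -/
lemma reg_of_operators (h0 : ∀ j (x : X), z j • x = 0 → x = 0)
    (h1 : ∀ j x, ∃ y, x - E j x = z j • y) (h2 : ∀ j x, E j (z j • x) = 0)
    (h3 : ∀ i j, i ≠ j → ∀ x, E j (z i • x) = z i • E j x) (js : List ι) (hjs : js.Nodup) :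
    Reg X (js.map z) := by
  induction js with
  | nil => trivial
  | cons j js ih =>
    rw [List.nodup_cons] at hjs
    refine ⟨ih hjs.2, fun x hx => ?_⟩
    obtain ⟨F, hF1, hF2, hF3⟩ := exists_operator z E h1 h2 h3 js hjs.2
    have h4 := map_eq_zero_of_mem_ofList_smul F _ (by
      intro a ha y
      obtain ⟨i, hi, rfl⟩ := List.mem_map.mp ha
      exact hF2 i hi y) _ hx
    rw [hF3 j hjs.1] at h4
    have h5 := hF1 x
    rwa [h0 j _ h4, sub_zero] at h5

end Operators

end Koszul
end SkewDuality

/-! ### The ideal of the diagonal in the double power series ring -/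

namespace SkewDuality

section PowerSeries

open MvPowerSeries

variable {k : Type u} [Field k]

/-- A series splits into its part `t₁` free of the first variable and a multiple of that variable;
the remaining variables are treated by induction on `t₁`. -/
lemma mem_ofList_map_X {τ : Type*} (js : List τ) (t : MvPowerSeries τ k)
    (ht : ∀ m : τ →₀ ℕ, (∀ j ∈ js, m j = 0) → coeff m t = 0) :
    t ∈ Ideal.ofList (js.map (X : τ → MvPowerSeries τ k)) := by
  classical
  induction js generalizing t with
  | nil =>
    have : t = 0 := MvPowerSeries.ext fun m => ht m (by simp)
    rw [this]
    exact Ideal.zero_mem _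
  | cons j js ih =>
    let t₁ : MvPowerSeries τ k := fun m => if m j = 0 then coeff m t else 0
    have ht₁ : ∀ m, coeff m t₁ = if m j = 0 then coeff m t else 0 := fun m => rfl
    rw [List.map_cons, Ideal.ofList_cons, ← sub_add_cancel t t₁]
    refine Ideal.add_mem _ (Ideal.mem_sup_left (Ideal.mem_span_singleton.mpr
      (X_dvd_iff.mpr fun m hm => ?_))) (Ideal.mem_sup_right (ih _ fun m hm => ?_))
    · rw [map_sub, ht₁, if_pos hm, sub_self]
    · rw [ht₁]
      split_ifs with h
      · exact ht m (by simpa using ⟨h, hm⟩)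
      · rfl

/-- The difference consists of the monomials that involve a variable outside the range of `e`, hence
one from the list. -/
lemma sub_rename_killCompl_mem {σ τ : Type*} (e : σ ↪ τ) (js : List τ)
    (hjs : ∀ j, j ∉ js → j ∈ Set.range e) (t : MvPowerSeries τ k) :
    t - rename e (killCompl e t) ∈ Ideal.ofList (js.map (X : τ → MvPowerSeries τ k)) := by
  refine mem_ofList_map_X js _ fun m hm => ?_
  have h : m ∈ Set.range (Finsupp.embDomain e) := by
    rw [Finsupp.mem_range_embDomain_iff]
    intro j hj
    by_contra h
    have := not_imp_not.mpr (hjs j) h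
    rw [not_not] at this
    exact (Finsupp.mem_support_iff.mp hj) (hm j this)
  obtain ⟨m, rfl⟩ := h
  rw [map_sub, coeff_embDomain_rename, coeff_killCompl, sub_self]

variable {d : ℕ}

lemma inclX_X (i : Fin d) : inclX k d (X i) = X (Sum.inl i) := rename_X _ i
lemma inclX_C (a : k) : inclX k d (C a) = C a := rename_C _ a
lemma inclY_X (i : Fin d) : inclY k d (X i) = X (Sum.inr i) := rename_X _ i
lemma inclY_C (a : k) : inclY k d (C a) = C a := rename_C _ a
lemma mulMap_X_inl (i : Fin d) : mulMap k d (X (Sum.inl i)) = X i := rename_X _ _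
lemma mulMap_X_inr (i : Fin d) : mulMap k d (X (Sum.inr i)) = X i := rename_X _ _
lemma mulMap_C (a : k) : mulMap k d (C a) = C a := rename_C _ a

lemma mulMap_inclY (f : PSR k d) : mulMap k d (inclY k d f) = f := by
  change rename (Sum.elim id id) (rename Sum.inr f) = f
  rw [rename_rename]
  exact rename_id_apply f

/-- The images of the variables under the shear `xᵢ ↦ xᵢ`, `yᵢ ↦ xᵢ - yᵢ`. -/
noncomputable def shearVar (k : Type u) [Field k] (d : ℕ) : Fin d ⊕ Fin d → PSS k d :=
  Sum.elim (fun i => X (Sum.inl i)) (fun i => X (Sum.inl i) - X (Sum.inr i))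

lemma constantCoeff_shearVar (j : Fin d ⊕ Fin d) : constantCoeff (shearVar k d j) = 0 := by
  rcases j with i | i <;> simp [shearVar]

/-- The involution of `S` with `xᵢ ↦ xᵢ` and `yᵢ ↦ xᵢ - yᵢ`. -/
noncomputable def shear (k : Type u) [Field k] (d : ℕ) : PSS k d →+* PSS k d :=
  (substAlgHom (R := k) (hasSubst_of_constantCoeff_zero
    (constantCoeff_shearVar (k := k) (d := d)))).toRingHom

lemma shear_C (a : k) : shear k d (C a) = C a :=
  (substAlgHom (R := k) (hasSubst_of_constantCoeff_zero
    (constantCoeff_shearVar (k := k) (d := d)))).commutes a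

lemma shear_X (j : Fin d ⊕ Fin d) : shear k d (X j) = shearVar k d j :=
  substAlgHom_X _ j

lemma shear_X_inl (i : Fin d) : shear k d (X (Sum.inl i)) = X (Sum.inl i) := shear_X _

lemma shear_X_inr (i : Fin d) : shear k d (X (Sum.inr i)) = X (Sum.inl i) - X (Sum.inr i) :=
  shear_X _

lemma shear_shear (s : PSS k d) : shear k d (shear k d s) = s := by
  have h : (shear k d).comp (shear k d) = RingHom.id _ := by
    refine ringHom_ext (fun a => ?_) (fun j => ?_) (fun j => ?_)
    · simp [shear_C]
    all_goals rcases j with i | i <;> simp [shear_X_inl, shear_X_inr]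
  exact DFunLike.congr_fun h s

lemma shear_inclX (r : PSR k d) : shear k d (inclX k d r) = inclX k d r := by
  have h : (shear k d).comp (inclX k d) = inclX k d := by
    refine ringHom_ext (fun a => ?_) (fun j => ?_) (fun j => ?_)
    · simp [shear_C, inclX_C]
    all_goals simp [shear_X_inl, inclX_X]
  exact DFunLike.congr_fun h r

/-- The generators `xᵢ - yᵢ` of the ideal of the diagonal. -/
noncomputable def diagGen (k : Type u) [Field k] (d : ℕ) (i : Fin d) : PSS k d :=
  X (Sum.inl i) - X (Sum.inr i)

lemma diagGen_eq_sub (i : Fin d) :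
    diagGen k d i = inclX k d (X i) - inclY k d (X i) := by
  rw [inclX_X, inclY_X, diagGen]

/-- The list of the generators `xᵢ - yᵢ` of the ideal of the diagonal. -/
noncomputable def diagList (k : Type u) [Field k] (d : ℕ) : List (PSS k d) :=
  (List.finRange d).map (diagGen k d)

/-- The ideal of the diagonal. -/
noncomputable def diagIdeal (k : Type u) [Field k] (d : ℕ) : Ideal (PSS k d) :=
  Ideal.ofList (diagList k d)

lemma length_diagList : (diagList k d).length = d := by simp [diagList]

/-- The shear carries `yᵢ` to `xᵢ - yᵢ`, so ideals of the diagonal generators reduce to ideals of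
variables. -/
lemma map_shear_mem {js : List (Fin d)} {t : PSS k d}
    (ht : t ∈ Ideal.ofList ((js.map Sum.inr).map (X : Fin d ⊕ Fin d → PSS k d))) :
    shear k d t ∈ Ideal.ofList (js.map (diagGen k d)) := by
  have h := Ideal.mem_map_of_mem (shear k d) ht
  rw [Ideal.map_ofList] at h
  simp only [List.map_map, Function.comp_def, shear_X_inr] at h
  exact h

/-- Conjugated by the shear, setting all `yᵢ = 0` becomes setting `yᵢ = xᵢ`, that is, the
multiplication map followed by the inclusion of the variables `x`. -/
lemma sub_inclX_mulMap_mem (s : PSS k d) : s - inclX k d (mulMap k d s) ∈ diagIdeal k d := by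
  let e : Fin d ↪ Fin d ⊕ Fin d := Function.Embedding.inl
  have h1 := map_shear_mem (sub_rename_killCompl_mem e ((List.finRange d).map Sum.inr)
    (by rintro (i | i) hi
        · exact ⟨i, rfl⟩
        · simp at hi) (shear k d s))
  rw [map_sub, shear_shear] at h1
  have h2 : (inclX k d).comp ((killCompl e : PSS k d →ₐ[k] PSR k d).toRingHom.comp (shear k d)) =
      (inclX k d).comp (mulMap k d) := by
    have hl : ∀ i, killCompl (R := k) e (X (Sum.inl i)) = X i := fun i => killCompl_X (e := e) i
    have hr : ∀ i, killCompl (R := k) e (X (Sum.inr i)) = 0 := fun i =>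
      killCompl_X_eq_zero (by rintro ⟨j, hj⟩; cases hj)
    refine ringHom_ext (fun a => ?_) (fun j => ?_) (fun j => ?_)
    · simp [shear_C, mulMap_C, inclX_C]
    all_goals
      rcases j with i | i <;>
        simp [shear_X_inl, shear_X_inr, mulMap_X_inl, mulMap_X_inr, inclX_X, hl, hr]
  have h3 : shear k d (rename e (killCompl e (shear k d s))) = inclX k d (mulMap k d s) :=
    (shear_inclX _).trans (DFunLike.congr_fun h2 s)
  rwa [h3] at h1

lemma mem_diagIdeal_of_mulMap_eq_zero {s : PSS k d} (hs : mulMap k d s = 0) :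
    s ∈ diagIdeal k d := by
  simpa [hs] using sub_inclX_mulMap_mem s

lemma mulMap_eq_zero_of_mem {s : PSS k d} (hs : s ∈ diagIdeal k d) : mulMap k d s = 0 := by
  have h : diagIdeal k d ≤ RingHom.ker (mulMap k d) := by
    refine Ideal.span_le.mpr fun a ha => ?_
    obtain ⟨i, -, rfl⟩ := List.mem_map.mp (show a ∈ diagList k d from ha)
    exact (RingHom.mem_ker).mpr (by rw [diagGen, map_sub, mulMap_X_inl, mulMap_X_inr, sub_self])
  exact h hs

/-- The series `r` is the part of `s` free of `x`. In `S ⊗ M` the factors `xᵢ` of the rest can be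
moved onto `M`. -/
lemma exists_eq_inclY_add_sum (s : PSS k d) :
    ∃ (r : PSR k d) (g : Fin d → PSS k d),
      s = inclY k d r + ∑ i, inclX k d (X i) * g i := by
  let e : Fin d ↪ Fin d ⊕ Fin d := Function.Embedding.inr
  have h1 := sub_rename_killCompl_mem e ((List.finRange d).map Sum.inl)
    (by rintro (i | i) hi
        · simp at hi
        · exact ⟨i, rfl⟩) s
  have h2 : Ideal.ofList (((List.finRange d).map Sum.inl).map (X : Fin d ⊕ Fin d → PSS k d)) =
      Ideal.span (Set.range fun i => inclX k d (X i)) := by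
    refine congrArg Ideal.span (Set.ext fun a => ?_)
    simp [inclX_X]
  rw [h2, Ideal.mem_span_range_iff_exists_fun] at h1
  obtain ⟨g, hg⟩ := h1
  refine ⟨killCompl e s, g, ?_⟩
  simp only [mul_comm (inclX k d _)]
  rw [hg]
  exact (add_sub_cancel (rename e (killCompl e s)) s).symm

/-- The substitution `y_j ↦ x_j`. -/
noncomputable def diagRetract (k : Type u) [Field k] (d : ℕ) (j : Fin d) : PSS k d →+* PSS k d :=
  (rename (Sum.elim Sum.inl fun i => if i = j then Sum.inl i else Sum.inr i) :
    PSS k d →ₐ[k] PSS k d).toRingHom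

lemma diagRetract_C (j : Fin d) (a : k) : diagRetract k d j (C a) = C a := rename_C _ a

lemma diagRetract_X_inl (j i : Fin d) : diagRetract k d j (X (Sum.inl i)) = X (Sum.inl i) :=
  rename_X _ _

lemma diagRetract_X_inr (j i : Fin d) : diagRetract k d j (X (Sum.inr i)) =
    if i = j then X (Sum.inl i) else X (Sum.inr i) := by
  refine (rename_X _ _).trans ?_
  simp only [Sum.elim_inr]
  split_ifs <;> rfl

lemma diagRetract_inclX (j : Fin d) (r : PSR k d) :
    diagRetract k d j (inclX k d r) = inclX k d r := by
  have h : (diagRetract k d j).comp (inclX k d) = inclX k d := by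
    refine ringHom_ext (fun a => ?_) (fun j => ?_) (fun j => ?_)
    · simp [diagRetract_C, inclX_C]
    all_goals simp [diagRetract_X_inl, inclX_X]
  exact DFunLike.congr_fun h r

lemma diagRetract_diagGen_self (j : Fin d) : diagRetract k d j (diagGen k d j) = 0 := by
  simp [diagGen, diagRetract_X_inl, diagRetract_X_inr]

lemma diagRetract_diagGen_ne {i j : Fin d} (h : i ≠ j) :
    diagRetract k d j (diagGen k d i) = diagGen k d i := by
  simp [diagGen, diagRetract_X_inl, diagRetract_X_inr, h]

/-- Conjugated by the shear, the retraction `y_j ↦ x_j` kills the single variable `y_j`. -/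
lemma exists_sub_diagRetract (j : Fin d) (s : PSS k d) :
    ∃ t, s - diagRetract k d j s = diagGen k d j * t := by
  let e : {i : Fin d ⊕ Fin d // i ≠ Sum.inr j} ↪ Fin d ⊕ Fin d := Function.Embedding.subtype _
  have h1 := map_shear_mem (sub_rename_killCompl_mem e (([j] : List (Fin d)).map Sum.inr)
    (fun i hi => ⟨⟨i, by simpa using hi⟩, rfl⟩) (shear k d s))
  rw [map_sub, shear_shear] at h1
  have h2 : (shear k d).comp ((rename e : _ →ₐ[k] PSS k d).toRingHom.comp
      ((killCompl e : PSS k d →ₐ[k] _).toRingHom.comp (shear k d))) = diagRetract k d j := by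
    have h0 : ∀ i, i ≠ Sum.inr j → rename e (killCompl (R := k) e (X i)) = X i := fun i hi =>
      (congrArg (rename e) (killCompl_X (e := e) ⟨i, hi⟩)).trans (rename_X _ _)
    have h0' : rename e (killCompl (R := k) e (X (Sum.inr j))) = 0 := by
      rw [killCompl_X_eq_zero, map_zero]
      rintro ⟨⟨i, hi⟩, hij⟩
      exact hi hij
    refine ringHom_ext (fun a => ?_) (fun i => ?_) (fun i => ?_)
    · simp [shear_C, diagRetract_C]
    all_goals
      rcases i with i | i
      · simp [shear_X_inl, diagRetract_X_inl, h0]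
      · by_cases hij : i = j
        · subst hij
          simp [shear_X_inr, shear_X_inl, diagRetract_X_inr, h0, h0']
        · simp [shear_X_inr, shear_X_inl, diagRetract_X_inr, h0, hij]
  have h3 := DFunLike.congr_fun h2 s
  have h4 : shear k d (rename e (killCompl e (shear k d s))) = diagRetract k d j s := h3
  rw [h4, List.map_singleton, Ideal.ofList_singleton, Ideal.mem_span_singleton] at h1
  exact h1

lemma diagGen_ne_zero (j : Fin d) : diagGen k d j ≠ 0 := by
  classical
  intro h
  have := congrArg (coeff (Finsupp.single (Sum.inl j) 1)) h
  simp [diagGen, coeff_X, Finsupp.single_left_inj] at this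

/-- The coefficient of `y^β`, a power series in `x`. -/
noncomputable def coeffY (β : Fin d →₀ ℕ) (s : PSS k d) : PSR k d := fun α =>
  coeff (α.sumElim β) s

lemma coeff_coeffY (β : Fin d →₀ ℕ) (s : PSS k d) (α : Fin d →₀ ℕ) :
    coeff α (coeffY β s) = coeff (α.sumElim β) s := rfl

lemma coeffY_add (β : Fin d →₀ ℕ) (s t : PSS k d) :
    coeffY β (s + t) = coeffY β s + coeffY β t := by
  ext α
  simp [coeff_coeffY]

lemma coeffY_mul (β : Fin d →₀ ℕ) (s t : PSS k d) :
    coeffY β (s * t) = ∑ b ∈ Finset.HasAntidiagonal.antidiagonal β, coeffY b.1 s * coeffY b.2 t := by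
  classical
  ext α
  -- The decompositions of an exponent in the variables `x, y` are the pairs of decompositions of
  -- its two parts.
  rw [coeff_coeffY, coeff_mul, ← Finsupp.image_sumElim_product_antidiagonal, Finset.sum_image,
    Finset.sum_product_right, map_sum]
  · refine Finset.sum_congr rfl fun b _ => ?_
    rw [coeff_mul]
    rfl
  · rintro ⟨⟨a, b⟩, c, e⟩ _ ⟨⟨a', b'⟩, c', e'⟩ _ h
    simp only [Prod.mk.injEq] at h
    have h1 : ∀ {a a' c c' : Fin d →₀ ℕ}, a.sumElim c = a'.sumElim c' → a = a' ∧ c = c' :=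
      fun h => ⟨Finsupp.ext fun i => DFunLike.congr_fun h (Sum.inl i),
        Finsupp.ext fun i => DFunLike.congr_fun h (Sum.inr i)⟩
    obtain ⟨rfl, rfl⟩ := h1 h.1
    obtain ⟨rfl, rfl⟩ := h1 h.2
    rfl

lemma coeffY_inclX (β : Fin d →₀ ℕ) (r : PSR k d) :
    coeffY β (inclX k d r) = if β = 0 then r else 0 := by
  ext α
  rw [coeff_coeffY]
  split_ifs with h
  · have : α.sumElim β = Finsupp.embDomain Function.Embedding.inl α := by
      ext (i | i)
      · exact (Finsupp.embDomain_apply_self Function.Embedding.inl α i).symm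
      · rw [Finsupp.embDomain_of_notMem_range _ _ _ (by rintro ⟨j, hj⟩; cases hj), h]
        rfl
    rw [this]
    exact coeff_embDomain_rename Function.Embedding.inl r α
  · refine coeff_rename_eq_zero _ _ ?_
    rintro ⟨m, hm⟩
    refine h (Finsupp.ext fun i => ?_)
    refine (DFunLike.congr_fun hm (Sum.inr i)).symm.trans ?_
    exact Finsupp.mapDomain_of_notMem_range _ _ (by rintro ⟨j, hj⟩; cases hj)

lemma coeffY_inclY (β : Fin d →₀ ℕ) (r : PSR k d) :
    coeffY β (inclY k d r) = C (coeff β r) := by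
  classical
  ext α
  rw [coeff_coeffY, coeff_C]
  split_ifs with h
  · have : α.sumElim β = Finsupp.embDomain Function.Embedding.inr β := by
      ext (i | i)
      · rw [Finsupp.embDomain_of_notMem_range _ _ _ (by rintro ⟨j, hj⟩; cases hj), h]
        rfl
      · exact (Finsupp.embDomain_apply_self Function.Embedding.inr β i).symm
    rw [this]
    exact coeff_embDomain_rename Function.Embedding.inr r β
  · refine coeff_rename_eq_zero _ _ ?_
    rintro ⟨m, hm⟩
    refine h (Finsupp.ext fun i => ?_)
    refine (DFunLike.congr_fun hm (Sum.inl i)).symm.trans ?_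
    exact Finsupp.mapDomain_of_notMem_range _ _ (by rintro ⟨j, hj⟩; cases hj)

lemma coeffY_inclX_mul (β : Fin d →₀ ℕ) (r : PSR k d) (s : PSS k d) :
    coeffY β (inclX k d r * s) = r * coeffY β s := by
  classical
  rw [coeffY_mul, Finset.sum_eq_single (0, β)]
  · rw [coeffY_inclX, if_pos rfl]
  · rintro ⟨a, b⟩ hab hne
    rw [coeffY_inclX, if_neg, zero_mul]
    rintro rfl
    rw [Finset.HasAntidiagonal.mem_antidiagonal] at hab
    simp at hab
    exact hne (by rw [hab])
  · intro h
    simp at h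

lemma coeffY_inclY_mul (β : Fin d →₀ ℕ) (r : PSR k d) (s : PSS k d) :
    coeffY β (inclY k d r * s) =
      ∑ b ∈ Finset.HasAntidiagonal.antidiagonal β, C (coeff b.1 r) * coeffY b.2 s := by
  rw [coeffY_mul]
  exact Finset.sum_congr rfl fun b _ => by rw [coeffY_inclY]

end PowerSeries

end SkewDuality

/-! ### The base change S ⊗ M and its y-linear functions -/

namespace SkewDuality

section BaseChange

open MvPowerSeries TensorProduct Koszul

variable {k : Type u} [Field k] {d : ℕ}

/-- `S` as an algebra over `R`, through the variables `x`. -/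
noncomputable abbrev algebraX (k : Type u) [Field k] (d : ℕ) : Algebra (PSR k d) (PSS k d) :=
  (inclX k d).toAlgebra

attribute [local instance] algebraX

lemma algebraX_smul (r : PSR k d) (s : PSS k d) : r • s = inclX k d r * s := rfl

/-- The retraction `y_j ↦ x_j` as a linear map over `R`. -/
noncomputable def diagRetractLin (j : Fin d) : PSS k d →ₗ[PSR k d] PSS k d where
  toFun := diagRetract k d j
  map_add' := map_add _
  map_smul' r s := by
    rw [algebraX_smul, map_mul, diagRetract_inclX]
    rfl

/-- The divided difference in the variable `y_j`, as a linear map over `R`. -/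
noncomputable def dividedDiff (j : Fin d) : PSS k d →ₗ[PSR k d] PSS k d where
  toFun s := (exists_sub_diagRetract j s).choose
  map_add' s t := by
    refine mul_left_cancel₀ (diagGen_ne_zero (k := k) j) ?_
    rw [mul_add, ← (exists_sub_diagRetract j s).choose_spec,
      ← (exists_sub_diagRetract j t).choose_spec, ← (exists_sub_diagRetract j (s + t)).choose_spec,
      map_add]
    ring
  map_smul' r s := by
    refine mul_left_cancel₀ (diagGen_ne_zero (k := k) j) ?_
    rw [RingHom.id_apply, mul_smul_comm, ← (exists_sub_diagRetract j s).choose_spec,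
      ← (exists_sub_diagRetract j (r • s)).choose_spec, smul_sub]
    exact congrArg (r • s - ·) ((diagRetractLin j).map_smul r s)

lemma sub_diagRetract (j : Fin d) (s : PSS k d) :
    s - diagRetract k d j s = diagGen k d j * dividedDiff j s :=
  (exists_sub_diagRetract j s).choose_spec

lemma dividedDiff_diagGen_mul (j : Fin d) (s : PSS k d) :
    dividedDiff j (diagGen k d j * s) = s := by
  refine mul_left_cancel₀ (diagGen_ne_zero (k := k) j) ?_
  rw [← sub_diagRetract, map_mul, diagRetract_diagGen_self, zero_mul, sub_zero]

variable (M : ModuleCat.{u} (PSR k d))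

/-- The base change of `M` along `R → S`, `xᵢ ↦ xᵢ`. -/
noncomputable def baseChange : ModuleCat.{u} (PSS k d) :=
  ModuleCat.of (PSS k d) (PSS k d ⊗[PSR k d] M)

variable {M}

/-- The pure tensors of the base change of `M`. -/
noncomputable def bc (s : PSS k d) (m : M) : baseChange M := s ⊗ₜ[PSR k d] m

lemma bc_add (s : PSS k d) (m m' : M) : bc s (m + m') = bc s m + bc s m' := tmul_add _ _ _

lemma smul_bc (s t : PSS k d) (m : M) : s • bc t m = bc (s * t) m := rfl

lemma inclX_smul_bc (r : PSR k d) (t : PSS k d) (m : M) :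
    inclX k d r • bc t m = bc t (r • m) := by
  rw [smul_bc]
  exact smul_tmul r t m

lemma baseChange_induction {p : baseChange M → Prop} (h0 : p 0) (h1 : ∀ s m, p (bc s m))
    (h2 : ∀ x y, p x → p y → p (x + y)) (x : baseChange M) : p x :=
  TensorProduct.induction_on x h0 h1 h2

/-- The additive map on the base change induced by a linear endomorphism of `S` over `R`. -/
noncomputable def bcMap (f : PSS k d →ₗ[PSR k d] PSS k d) : baseChange M →+ baseChange M :=
  (LinearMap.rTensor M f).toAddMonoidHom

lemma bcMap_bc (f : PSS k d →ₗ[PSR k d] PSS k d) (s : PSS k d) (m : M) :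
    bcMap f (bc s m) = bc (f s) m := rfl

variable (M) in
-- The retractions `y_j ↦ x_j` and the divided differences are linear over the series in `x`, so
-- they extend to `S ⊗_R M` for every `M`. The divided difference is a left inverse of
-- multiplication by `x_j - y_j`, which is therefore injective.
lemma reg_baseChange : Reg (baseChange M) (diagList k d) := by
  refine reg_of_operators (diagGen k d) (fun j => bcMap (diagRetractLin j)) (fun j x hx => ?_)
    (fun j x => ⟨bcMap (dividedDiff j) x, ?_⟩) (fun j x => ?_) (fun i j hij x => ?_) _
    (List.nodup_finRange d)
  · have h : bcMap (dividedDiff j) (diagGen k d j • x) = x := by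
      clear hx
      induction x using baseChange_induction with
      | h0 => simp
      | h1 s m => rw [smul_bc, bcMap_bc, dividedDiff_diagGen_mul]
      | h2 x y hx hy => rw [smul_add, map_add, hx, hy]
    rw [← h, hx, map_zero]
  · induction x using baseChange_induction with
    | h0 => simp
    | h1 s m =>
      rw [bcMap_bc, bcMap_bc, smul_bc, ← sub_diagRetract]
      exact (sub_tmul _ _ _).symm
    | h2 x y hx hy => rw [map_add, map_add, smul_add, ← hx, ← hy]; abel
  · induction x using baseChange_induction with
    | h0 => simp
    | h1 s m =>
      rw [smul_bc, bcMap_bc]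
      refine (congrArg (bc · m) ?_).trans (zero_tmul _ _)
      change diagRetract k d j (diagGen k d j * s) = 0
      rw [map_mul, diagRetract_diagGen_self, zero_mul]
    | h2 x y hx hy => rw [smul_add, map_add, hx, hy, add_zero]
  · induction x using baseChange_induction with
    | h0 => simp
    | h1 s m =>
      rw [smul_bc, bcMap_bc, bcMap_bc, smul_bc]
      refine congrArg (bc · m) ?_
      change diagRetract k d j (diagGen k d i * s) = diagGen k d i * diagRetract k d j s
      rw [map_mul, diagRetract_diagGen_ne hij]
    | h2 x y hx hy => rw [smul_add, map_add, hx, hy, map_add, smul_add]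

variable (k d) in
lemma reg_self : Reg (PSS k d) (diagList k d) := by
  refine reg_of_operators (diagGen k d) (fun j => (diagRetract k d j).toAddMonoidHom)
    (fun j x hx => ?_) (fun j x => exists_sub_diagRetract j x) (fun j x => ?_)
    (fun i j hij x => ?_) _ (List.nodup_finRange d)
  · exact (mul_eq_zero.mp hx).resolve_left (diagGen_ne_zero j)
  · change diagRetract k d j (diagGen k d j * x) = 0
    rw [map_mul, diagRetract_diagGen_self, zero_mul]
  · change diagRetract k d j (diagGen k d i * x) = diagGen k d i * diagRetract k d j x
    rw [map_mul, diagRetract_diagGen_ne hij]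

/-- The map `S ⊗ M → M`, `s ⊗ m ↦ μ(s) m`, where `μ` is the completed multiplication map. -/
noncomputable def counit (M : ModuleCat.{u} (PSR k d)) : baseChange M →+ M :=
  ((TensorProduct.lid (PSR k d) M).toLinearMap.comp (LinearMap.rTensor M
    ({ toFun := mulMap k d
       map_add' := map_add _
       map_smul' := fun r s => by
        rw [algebraX_smul, map_mul, mulMap_inclX]
        rfl } : PSS k d →ₗ[PSR k d] PSR k d))).toAddMonoidHom

lemma counit_bc (s : PSS k d) (m : M) : counit M (bc s m) = mulMap k d s • m := rfl

lemma counit_smul (s : PSS k d) (x : baseChange M) :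
    counit M (s • x) = mulMap k d s • counit M x := by
  induction x using baseChange_induction with
  | h0 => simp
  | h1 t m => rw [smul_bc, counit_bc, counit_bc, map_mul, mul_smul]
  | h2 x y hx hy => rw [smul_add, map_add, hx, hy, map_add, smul_add]

/-- On pure tensors the difference is `s - μ(s)(x)` times `1 ⊗ m`, and this factor lies in the ideal
of the diagonal. -/
lemma sub_bc_counit_mem (x : baseChange M) :
    x - bc 1 (counit M x) ∈ diagIdeal k d • (⊤ : Submodule (PSS k d) (baseChange M)) := by
  induction x using baseChange_induction with
  | h0 =>
    rw [map_zero]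
    simp [show bc (1 : PSS k d) (0 : M) = 0 from tmul_zero _ _]
  | h1 s m =>
    have h : bc s m - bc 1 (counit M (bc s m)) =
        (s - inclX k d (mulMap k d s)) • bc (1 : PSS k d) m := by
      rw [counit_bc, ← inclX_smul_bc, smul_bc, smul_bc, mul_one, mul_one]
      exact (sub_tmul _ _ _).symm
    rw [h]
    exact Submodule.smul_mem_smul (sub_inclX_mulMap_mem s) Submodule.mem_top
  | h2 x y hx hy =>
    have : x + y - bc 1 (counit M (x + y)) =
        (x - bc 1 (counit M x)) + (y - bc 1 (counit M y)) := by
      rw [map_add, bc_add]; abel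
    rw [this]
    exact Submodule.add_mem _ hx hy

lemma mem_smul_top_of_counit_eq_zero (x : baseChange M) (hx : counit M x = 0) :
    x ∈ diagIdeal k d • (⊤ : Submodule (PSS k d) (baseChange M)) := by
  have h := sub_bc_counit_mem x
  rwa [hx, show bc (1 : PSS k d) (0 : M) = 0 from tmul_zero _ _, sub_zero] at h

lemma counit_eq_zero_of_mem (x : baseChange M)
    (hx : x ∈ diagIdeal k d • (⊤ : Submodule (PSS k d) (baseChange M))) : counit M x = 0 := by
  induction hx using Submodule.smul_induction_on' with
  | smul s hs y _ => rw [counit_smul, mulMap_eq_zero_of_mem hs, zero_smul]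
  | add x _ y _ hx hy => rw [map_add, hx, hy, add_zero]

/-- The maximal ideal annihilates an element to the power `N`. -/
def PowKills (N : ℕ) (m : M) : Prop :=
  ∀ r ∈ RingHom.ker (constantCoeff (σ := Fin d) (R := k)) ^ N, r • m = 0

lemma PowKills.smul_X {N : ℕ} {m : M} (h : PowKills (N + 1) m) (i : Fin d) :
    PowKills N ((X i : PSR k d) • m) := fun r hr => by
  rw [smul_smul]
  refine h _ ?_
  rw [pow_succ]
  exact Ideal.mul_mem_mul hr (by simp [RingHom.mem_ker])

lemma PowKills.eq_zero {m : M} (h : PowKills 0 m) : m = 0 := by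
  simpa using h 1 (by simp)

/-- Writing `s = r(y) + ∑ xᵢ gᵢ` and moving `xᵢ` across the tensor product replaces `m` by the `xᵢ
m`, which are killed by a smaller power of the maximal ideal. -/
lemma bc_mem_of_powKills (V : AddSubgroup (baseChange M))
    (hV : ∀ (r : PSR k d) (m : M), inclY k d r • bc 1 m ∈ V) (N : ℕ) (m : M) (h : PowKills N m)
    (s : PSS k d) : bc s m ∈ V := by
  induction N generalizing m s with
  | zero =>
    rw [h.eq_zero, show bc s (0 : M) = 0 from tmul_zero _ _]
    exact V.zero_mem
  | succ N ih =>
    obtain ⟨r, g, hs⟩ := exists_eq_inclY_add_sum s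
    have h1 : bc s m = inclY k d r • bc 1 m + ∑ i, bc (g i) ((X i : PSR k d) • m) := by
      conv_lhs => rw [hs]
      rw [smul_bc, mul_one]
      refine (add_tmul _ _ _).trans (congrArg (bc (inclY k d r) m + ·) ?_)
      refine (sum_tmul _ _ _).trans (Finset.sum_congr rfl fun i _ => ?_)
      exact (inclX_smul_bc (X i) (g i) m)
    rw [h1]
    exact V.add_mem (hV r m) (V.sum_mem fun i _ => ih _ (h.smul_X i) _)

/-- For a module of finite length, the base change is generated by the elements of `M` as a module
over the power series in `y`. -/
lemma baseChange_induction_finLength (hM : IsFinLength M) (V : AddSubgroup (baseChange M))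
    (hV : ∀ (r : PSR k d) (m : M), inclY k d r • bc 1 m ∈ V) (x : baseChange M) : x ∈ V := by
  induction x using baseChange_induction with
  | h0 => exact V.zero_mem
  | h1 s m =>
    obtain ⟨N, hN⟩ := hM.2 m
    exact bc_mem_of_powKills V hV N m hN s
  | h2 x y hx hy => exact V.add_mem hx hy

open scoped ModuleCat

lemma algebra_smul_eq (a : k) (m : M) : a • m = (C a : PSR k d) • m := rfl

/-- The module `R m` is spanned by `k m` and the `R xᵢ m`, and each `xᵢ m` is killed by a smaller
power of the maximal ideal. -/
lemma exists_finite_of_powKills (N : ℕ) (m : M) (h : PowKills N m) :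
    ∃ V : Submodule k M, Module.Finite k V ∧ ∀ r : PSR k d, r • m ∈ V := by
  induction N generalizing m with
  | zero => exact ⟨⊥, inferInstance, fun r => by rw [h.eq_zero, smul_zero]; exact zero_mem _⟩
  | succ N ih =>
    choose V hV1 hV2 using fun i => ih _ (h.smul_X i)
    refine ⟨Submodule.span k {m} ⊔ ⨆ i, V i, ?_, fun r => ?_⟩
    · infer_instance
    · obtain ⟨g, hg⟩ := exists_eq_C_add_sum_X_mul r
      rw [hg, add_smul, Finset.sum_smul]
      refine Submodule.add_mem_sup ?_ (Submodule.sum_mem _ fun i _ => ?_)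
      · rw [← algebra_smul_eq]
        exact Submodule.smul_mem _ _ (Submodule.mem_span_singleton_self m)
      · rw [mul_comm, mul_smul]
        exact Submodule.mem_iSup_of_mem i (hV2 i _)

lemma finite_of_isFinLength (hM : IsFinLength M) : Module.Finite k M := by
  have := hM.1
  obtain ⟨n, g, hg⟩ := Module.Finite.exists_fin (R := PSR k d) (M := M)
  choose N hN using hM.2
  choose V hV1 hV2 using fun i => exists_finite_of_powKills (N (g i)) (g i) (hN (g i))
  have h : (⨆ i, V i) = ⊤ := by
    refine eq_top_iff.mpr fun m _ => ?_
    have hm : m ∈ Submodule.span (PSR k d) (Set.range g) := hg ▸ Submodule.mem_top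
    obtain ⟨c, rfl⟩ := (Submodule.mem_span_range_iff_exists_fun _).mp hm
    exact Submodule.sum_mem _ fun i _ => Submodule.mem_iSup_of_mem i (hV2 i _)
  rw [Module.finite_def, ← h, ← Module.Finite.iff_fg]
  infer_instance

/-- The coefficient of `y^β` as a linear map over `R`. -/
noncomputable def coeffYLin (β : Fin d →₀ ℕ) : PSS k d →ₗ[PSR k d] PSR k d where
  toFun := coeffY β
  map_add' := coeffY_add β
  map_smul' r s := coeffY_inclX_mul β r s

/-- The coefficient of `y^β` of an element of the base change. -/
noncomputable def bcCoeff (β : Fin d →₀ ℕ) : baseChange M →+ M :=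
  ((TensorProduct.lid (PSR k d) M).toLinearMap.comp
    (LinearMap.rTensor M (coeffYLin β))).toAddMonoidHom

lemma bcCoeff_bc (β : Fin d →₀ ℕ) (s : PSS k d) (m : M) :
    bcCoeff β (bc s m) = coeffY β s • m := rfl

lemma bcCoeff_inclY_smul (β : Fin d →₀ ℕ) (r : PSR k d) (x : baseChange M) :
    bcCoeff β (inclY k d r • x) =
      ∑ b ∈ Finset.HasAntidiagonal.antidiagonal β, (coeff b.1 r) • bcCoeff b.2 x := by
  induction x using baseChange_induction with
  | h0 => simp
  | h1 s m =>
    rw [smul_bc, bcCoeff_bc, coeffY_inclY_mul, Finset.sum_smul]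
    exact Finset.sum_congr rfl fun b _ => by rw [mul_smul, bcCoeff_bc, algebra_smul_eq]
  | h2 x y hx hy =>
    rw [smul_add, map_add, hx, hy, ← Finset.sum_add_distrib]
    exact Finset.sum_congr rfl fun b _ => by rw [map_add, smul_add]

variable (M) in
/-- The additive functions on the base change of `M` with values in `R`. -/
abbrev BCFun : Type u := baseChange M →+ PSR k d

/-- Linearity over the power series in `y`. -/
def YLinear (h : BCFun M) : Prop :=
  ∀ (r : PSR k d) (x : baseChange M), h (inclY k d r • x) = r * h x

lemma YLinear.sum {ι : Type*} [Fintype ι] {h : ι → BCFun M} (hh : ∀ i, YLinear (h i)) :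
    YLinear (∑ i, h i) := fun r x => by
  simp only [AddMonoidHom.finsetSum_apply, hh _ r x, Finset.mul_sum]

/-- Precomposition with multiplication by an element of `S`. -/
noncomputable def precomp (s : PSS k d) (h : BCFun M) : BCFun M :=
  h.comp (DistribSMul.toAddMonoidHom (baseChange M) s)

lemma precomp_apply (s : PSS k d) (h : BCFun M) (x : baseChange M) :
    precomp s h x = h (s • x) := rfl

lemma YLinear.precomp {h : BCFun M} (hh : YLinear h) (s : PSS k d) : YLinear (precomp s h) :=
  fun r x => by rw [precomp_apply, smul_comm, hh]; rfl

/-- Postcomposition with multiplication by an element of `R`. -/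
noncomputable def postmul (r : PSR k d) (h : BCFun M) : BCFun M := (AddMonoidHom.mulLeft r).comp h

lemma postmul_apply (r : PSR k d) (h : BCFun M) (x : baseChange M) :
    postmul r h x = r * h x := rfl

lemma YLinear.postmul {h : BCFun M} (hh : YLinear h) (r : PSR k d) : YLinear (postmul r h) :=
  fun r' x => by rw [postmul_apply, postmul_apply, hh, mul_left_comm]

/-- The functional on the base change of `M` induced by a functional on `M`. -/
noncomputable def liftDual (f : KDual M) : BCFun M where
  toFun x := fun β => f (bcCoeff β x)
  map_zero' := funext fun β => by
    change f (bcCoeff β 0) = 0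
    rw [map_zero, map_zero]
  map_add' x y := funext fun β => by
    change f (bcCoeff β (x + y)) = f (bcCoeff β x) + f (bcCoeff β y)
    rw [map_add, map_add]

lemma coeff_liftDual (f : KDual M) (x : baseChange M) (β : Fin d →₀ ℕ) :
    coeff β (liftDual f x) = f (bcCoeff β x) := rfl

lemma yLinear_liftDual (f : KDual M) : YLinear (liftDual f) := fun r x => by
  ext β
  rw [coeff_liftDual, bcCoeff_inclY_smul, map_sum, coeff_mul]
  exact Finset.sum_congr rfl fun b _ => map_smul f _ _

lemma liftDual_one (f : KDual M) (m : M) : liftDual f (bc 1 m) = C (f m) := by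
  classical
  ext β
  rw [coeff_liftDual, bcCoeff_bc, ← map_one (inclX k d), coeffY_inclX, coeff_C]
  split_ifs
  · rw [one_smul]
  · rw [zero_smul, map_zero]

/-- For finite length the elements `1 ⊗ m` generate the base change over the series in `y`. -/
lemma YLinear.ext_one (hM : IsFinLength M) {h h' : BCFun M} (hh : YLinear h) (hh' : YLinear h')
    (H : ∀ m : M, h (bc 1 m) = h' (bc 1 m)) : h = h' :=
  DFunLike.ext _ _ fun x => baseChange_induction_finLength hM (AddMonoidHom.eqLocus h h')
    (fun r m => show h _ = h' _ by rw [hh, hh', H]) x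

/-- The action of `R` on the functionals on `M`. -/
noncomputable def smulDual (r : PSR k d) (f : KDual M) : KDual M where
  toFun m := f (r • m)
  map_add' m m' := by rw [smul_add, map_add]
  map_smul' a m := by
    rw [algebra_smul_eq, smul_smul, mul_comm, mul_smul, ← algebra_smul_eq, map_smul,
      RingHom.id_apply]

lemma smulDual_apply (r : PSR k d) (f : KDual M) (m : M) : smulDual r f m = f (r • m) := rfl

/-! ### The residue pairing and its kernel -/

section Trace

variable {ι : Type*} [Fintype ι] (b : Module.Basis ι k M)

/-- The residue pairing: the map from functions on the base change of `M` to functionals on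
`M` with `r f̂ ↦ r f`, where `f̂` is induced by `f`. -/
noncomputable def trace : BCFun M →+ KDual M where
  toFun h := ∑ i, smulDual (h (bc 1 (b i))) (b.coord i)
  map_zero' := by
    refine Finset.sum_eq_zero fun i _ => LinearMap.ext fun m => ?_
    rw [smulDual_apply, AddMonoidHom.zero_apply, zero_smul, map_zero]
    rfl
  map_add' h h' := by
    rw [← Finset.sum_add_distrib]
    refine Finset.sum_congr rfl fun i _ => LinearMap.ext fun m => ?_
    rw [smulDual_apply, AddMonoidHom.add_apply, add_smul, map_add]
    rfl

lemma trace_apply (h : BCFun M) (m : M) :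
    trace b h m = ∑ i, b.coord i (h (bc 1 (b i)) • m) := by
  change (∑ i, smulDual (h (bc 1 (b i))) (b.coord i)) m = _
  rw [LinearMap.sum_apply]
  rfl

lemma trace_postmul (r : PSR k d) (h : BCFun M) :
    trace b (postmul r h) = smulDual r (trace b h) := by
  ext m
  rw [smulDual_apply, trace_apply, trace_apply]
  exact Finset.sum_congr rfl fun i _ => by rw [postmul_apply, mul_comm, mul_smul]

lemma trace_liftDual (f : KDual M) : trace b (liftDual f) = f := by
  ext m
  rw [trace_apply]
  conv_rhs => rw [← b.sum_repr m, map_sum]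
  refine Finset.sum_congr rfl fun i _ => ?_
  rw [liftDual_one, ← algebra_smul_eq, map_smul, map_smul, smul_eq_mul, smul_eq_mul, mul_comm]
  rfl

variable {b}

/-- Both sides are y-linear and agree on `1 ⊗ m`, as seen by expanding `m` in the basis. -/
lemma YLinear.eq_sum (hM : IsFinLength M) {h : BCFun M} (hh : YLinear h) :
    h = ∑ i, SkewDuality.postmul (h (bc 1 (b i))) (liftDual (b.coord i)) := by
  refine hh.ext_one hM (YLinear.sum fun i => (yLinear_liftDual _).postmul _) fun m => ?_
  rw [AddMonoidHom.finsetSum_apply]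
  conv_lhs => rw [← b.sum_repr m]
  have h1 : bc (1 : PSS k d) (∑ i, b.repr m i • b i) = ∑ i, inclY k d (C (b.repr m i)) • bc 1 (b i) := by
    refine (tmul_sum _ _ _).trans (Finset.sum_congr rfl fun i _ => ?_)
    rw [inclY_C, ← inclX_C, inclX_smul_bc]
    rfl
  rw [h1, map_sum]
  refine Finset.sum_congr rfl fun i _ => ?_
  rw [hh, postmul_apply, liftDual_one, mul_comm]
  rfl

variable (b) in
lemma baseChange_eq_sum (hM : IsFinLength M) (x : baseChange M) :
    x = ∑ i, inclY k d (liftDual (b.coord i) x) • bc 1 (b i) := by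
  let F : baseChange M →+ baseChange M :=
    ∑ i, (((smulAddHom (PSS k d) (baseChange M)).flip (bc 1 (b i))).comp
      (inclY k d).toAddMonoidHom).comp (liftDual (b.coord i))
  have hF : ∀ x, F x = ∑ i, inclY k d (liftDual (b.coord i) x) • bc 1 (b i) := fun x => by
    simp only [F, AddMonoidHom.finsetSum_apply]
    rfl
  have h := baseChange_induction_finLength hM (AddMonoidHom.eqLocus (AddMonoidHom.id _) F)
    (fun r m => ?_) x
  · exact (show x = F x from h).trans (hF x)
  · change inclY k d r • bc 1 m = F _
    rw [hF]
    simp only [yLinear_liftDual _ _ _, liftDual_one, map_mul, mul_smul, ← Finset.smul_sum]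
    congr 1
    conv_lhs => rw [← b.sum_repr m]
    refine (tmul_sum _ _ _).trans (Finset.sum_congr rfl fun i _ => ?_)
    rw [inclY_C, ← inclX_C, inclX_smul_bc]
    rfl

/-- Multiplication by a series in `x` acts on each y-coefficient through its action on `M`. -/
lemma precomp_inclX_liftDual (r : PSR k d) (f : KDual M) :
    precomp (inclX k d r) (liftDual f) = liftDual (smulDual r f) := by
  ext x : 1
  induction x using baseChange_induction with
  | h0 => simp
  | h1 s m =>
    ext β
    rw [precomp_apply, inclX_smul_bc, coeff_liftDual, coeff_liftDual, bcCoeff_bc, bcCoeff_bc,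
      smulDual_apply, smul_smul, smul_smul, mul_comm]
  | h2 x y hx hy => rw [map_add, map_add, hx, hy]

lemma precomp_postmul (s : PSS k d) (r : PSR k d) (h : BCFun M) :
    precomp s (postmul r h) = postmul r (precomp s h) := rfl

lemma precomp_sum (s : PSS k d) {κ : Type*} [Fintype κ] (h : κ → BCFun M) :
    precomp s (∑ i, h i) = ∑ i, precomp s (h i) := by
  ext x : 1
  simp [precomp_apply]

lemma smulDual_smulDual (r r' : PSR k d) (f : KDual M) :
    smulDual r (smulDual r' f) = smulDual (r * r') f := by
  ext m
  rw [smulDual_apply, smulDual_apply, smulDual_apply, smul_smul, mul_comm]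

lemma smulDual_sum (r : PSR k d) {κ : Type*} [Fintype κ] (f : κ → KDual M) :
    smulDual r (∑ i, f i) = ∑ i, smulDual r (f i) := by
  ext m
  simp [smulDual_apply]

lemma trace_precomp_inclX (hM : IsFinLength M) {h : BCFun M} (hh : YLinear h) (r : PSR k d) :
    trace b (precomp (inclX k d r) h) = smulDual r (trace b h) := by
  rw [hh.eq_sum (b := b) hM, precomp_sum, map_sum, map_sum, smulDual_sum]
  refine Finset.sum_congr rfl fun i _ => ?_
  rw [precomp_postmul, precomp_inclX_liftDual, trace_postmul, trace_postmul, trace_liftDual,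
    trace_liftDual, smulDual_smulDual, smulDual_smulDual, mul_comm]

lemma precomp_inclY {h : BCFun M} (hh : YLinear h) (r : PSR k d) :
    precomp (inclY k d r) h = postmul r h := DFunLike.ext _ _ fun x => hh r x

lemma precomp_mul (s t : PSS k d) (h : BCFun M) : precomp (s * t) h = precomp t (precomp s h) := by
  ext x : 1
  rw [precomp_apply, precomp_apply, precomp_apply, mul_smul]

lemma precomp_add (s t : PSS k d) (h : BCFun M) : precomp (s + t) h = precomp s h + precomp t h := by
  ext x : 1
  rw [precomp_apply, add_smul, map_add]
  rfl

lemma precomp_sub (s t : PSS k d) (h : BCFun M) : precomp (s - t) h = precomp s h - precomp t h := by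
  ext x : 1
  rw [precomp_apply, sub_smul, map_sub]
  rfl

/-- For y-linear functions, precomposition with `xᵢ` and with `yᵢ` both become the action of `xᵢ` on
functionals, so the generators `xᵢ - yᵢ` act as zero. -/
lemma trace_precomp_of_mem (hM : IsFinLength M) {h : BCFun M} (hh : YLinear h) {a : PSS k d}
    (ha : a ∈ diagIdeal k d) : trace b (precomp a h) = 0 := by
  induction ha using Submodule.span_induction generalizing h with
  | mem x hx =>
    obtain ⟨i, -, rfl⟩ := List.mem_map.mp (show x ∈ diagList k d from hx)
    rw [diagGen_eq_sub, precomp_sub, map_sub, precomp_inclY hh, trace_precomp_inclX hM hh,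
      trace_postmul, sub_self]
  | zero =>
    have : precomp (0 : PSS k d) h = 0 := by
      ext x : 1
      rw [precomp_apply, zero_smul, map_zero]
      rfl
    rw [this, map_zero]
  | add x y _ _ hx hy => rw [precomp_add, map_add, hx hh, hy hh, add_zero]
  | smul c x _ hx => rw [smul_eq_mul, precomp_mul, hx (hh.precomp c)]

lemma trace_precomp (hM : IsFinLength M) {h : BCFun M} (hh : YLinear h) (s : PSS k d) :
    trace b (precomp s h) = smulDual (mulMap k d s) (trace b h) := by
  have h1 := trace_precomp_of_mem (b := b) hM hh (sub_inclX_mulMap_mem s)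
  rwa [precomp_sub, map_sub, trace_precomp_inclX hM hh, sub_eq_zero] at h1

/-- With `h = ∑ rᵢ f̂ᵢ`, the function `∑ rᵢ(x) f̂ᵢ`, in which `rᵢ` acts on the argument through `x`,
is induced by the functional `∑ rᵢ fᵢ = trace h = 0`. Subtracting it gives `h = ∑ (rᵢ(y) - rᵢ(x))
f̂ᵢ`. -/
lemma exists_of_trace_eq_zero (hM : IsFinLength M) {h : BCFun M} (hh : YLinear h)
    (h0 : trace b h = 0) : ∃ (g : ι → BCFun M) (a : ι → PSS k d), (∀ i, YLinear (g i)) ∧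
      (∀ i, a i ∈ diagIdeal k d) ∧ h = ∑ i, precomp (a i) (g i) := by
  refine ⟨fun i => liftDual (b.coord i),
    fun i => inclY k d (h (bc 1 (b i))) - inclX k d (h (bc 1 (b i))),
    fun i => yLinear_liftDual _, fun i => ?_, ?_⟩
  · exact mem_diagIdeal_of_mulMap_eq_zero (by rw [map_sub, mulMap_inclX, mulMap_inclY, sub_self])
  · simp only [precomp_sub, precomp_inclX_liftDual, precomp_inclY (yLinear_liftDual _),
      Finset.sum_sub_distrib]
    rw [← hh.eq_sum hM]
    have h1 : ∑ i, liftDual (smulDual (h (bc 1 (b i))) (b.coord i)) = liftDual (trace b h) := by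
      ext x β
      rw [AddMonoidHom.finsetSum_apply, map_sum, coeff_liftDual]
      simp only [coeff_liftDual]
      exact (LinearMap.sum_apply _ _ _).symm
    rw [h1, h0]
    have h2 : liftDual (0 : KDual M) = 0 := rfl
    rw [h2, sub_zero]

end Trace

/-! ### Skew homomorphisms and the residue pairing -/

section Skew

variable {M' : ModuleCat.{u} (PSR k d)} (t : SkewHom M M')

/-- The automorphism of `S` induced by `σ`, as a semilinear map. -/
noncomputable def doubleSemilinear (s : PSAut k d) :
    PSS k d →ₛₗ[(s.ringEquiv : PSR k d →+* PSR k d)] PSS k d where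
  toFun := s.double
  map_add' := map_add _
  map_smul' r x := by
    rw [algebraX_smul, map_mul]
    exact congrArg (· * s.double x) (s.doubleHom_inclX r)

/-- The map on base changes induced by a skew homomorphism. -/
noncomputable def bcSkew : baseChange M →+ baseChange M' :=
  (TensorProduct.map (doubleSemilinear t.aut) t.map).toAddMonoidHom

lemma bcSkew_bc (s : PSS k d) (m : M) : bcSkew t (bc s m) = bc (t.aut.double s) (t.map m) := rfl

lemma bcSkew_smul (s : PSS k d) (x : baseChange M) :
    bcSkew t (s • x) = t.aut.double s • bcSkew t x := by
  induction x using baseChange_induction with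
  | h0 => simp
  | h1 s' m => rw [smul_bc, bcSkew_bc, bcSkew_bc, smul_bc, map_mul]
  | h2 x y hx hy => rw [smul_add, map_add, hx, hy, map_add, smul_add]

lemma counit_bcSkew (x : baseChange M) : counit M' (bcSkew t x) = t.map (counit M x) := by
  induction x using baseChange_induction with
  | h0 => simp
  | h1 s m =>
    rw [bcSkew_bc, counit_bc, counit_bc, t.aut.mulMap_double, LinearMap.map_smulₛₗ]
    rfl
  | h2 x y hx hy => rw [map_add, map_add, hx, hy, map_add, map_add]

/-- The action of a skew homomorphism on functions on the base changes. -/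
noncomputable def skewPullback (h : BCFun M') : BCFun M :=
  (t.aut.ringEquiv.symm : PSR k d →+ PSR k d).comp (h.comp (bcSkew t))

lemma skewPullback_apply (h : BCFun M') (x : baseChange M) :
    skewPullback t h x = t.aut.ringEquiv.symm (h (bcSkew t x)) := rfl

lemma YLinear.skewPullback {h : BCFun M'} (hh : YLinear h) : YLinear (skewPullback t h) :=
  fun r x => by
    have : t.aut.double (inclY k d r) = inclY k d (t.aut.ringEquiv r) := t.aut.doubleHom_inclY r
    rw [skewPullback_apply, bcSkew_smul, this, hh, map_mul, RingEquiv.symm_apply_apply]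
    rfl

/-- The action of a skew homomorphism on functionals. -/
noncomputable def dualPullback (f : KDual M') : KDual M where
  toFun m := t.aut.const.symm (f (t.map m))
  map_add' m m' := by rw [map_add, map_add, map_add]
  map_smul' a m := by
    rw [algebra_smul_eq, LinearMap.map_smulₛₗ]
    have : (t.aut.ringEquiv : PSR k d →+* PSR k d) (C a) = C (t.aut.const a) := t.aut.map_C a
    rw [this, ← algebra_smul_eq, map_smul, smul_eq_mul, map_mul, RingEquiv.symm_apply_apply]
    rfl

lemma dualPullback_apply (f : KDual M') (m : M) :
    dualPullback t f m = t.aut.const.symm (f (t.map m)) := rfl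

lemma skewPullback_postmul_liftDual (hM : IsFinLength M) (r : PSR k d) (f : KDual M') :
    skewPullback t (postmul r (liftDual f)) =
      postmul (t.aut.ringEquiv.symm r) (liftDual (dualPullback t f)) := by
  refine (((yLinear_liftDual f).postmul r).skewPullback t).ext_one hM
    ((yLinear_liftDual _).postmul _) fun m => ?_
  rw [skewPullback_apply, bcSkew_bc, map_one, postmul_apply, postmul_apply, liftDual_one,
    liftDual_one, map_mul, dualPullback_apply]
  exact congrArg _ (t.aut.symm.map_C _)

/-- By additivity it suffices to treat `r f̂`. Its pullback is `σ⁻¹(r)` times the function induced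
by the pullback of `f`, and `σ(σ⁻¹(r)) = r` turns the trace of that into the pullback of `r f`. -/
lemma trace_skewPullback {ι ι' : Type*} [Fintype ι] [Fintype ι'] (b : Module.Basis ι k M)
    (b' : Module.Basis ι' k M') (hM : IsFinLength M) (hM' : IsFinLength M') {h : BCFun M'}
    (hh : YLinear h) : trace b (skewPullback t h) = dualPullback t (trace b' h) := by
  have h1 : skewPullback t h =
      ∑ i, skewPullback t (postmul (h (bc 1 (b' i))) (liftDual (b'.coord i))) := by
    conv_lhs => rw [hh.eq_sum (b := b') hM']
    ext x : 1
    simp [skewPullback_apply]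
  rw [h1, map_sum]
  ext m
  rw [LinearMap.sum_apply, dualPullback_apply, trace_apply, map_sum]
  refine Finset.sum_congr rfl fun i _ => ?_
  rw [skewPullback_postmul_liftDual t hM, trace_postmul, trace_liftDual, smulDual_apply,
    dualPullback_apply, LinearMap.map_smulₛₗ]
  congr 3
  exact t.aut.ringEquiv.apply_symm_apply _

end Skew

end BaseChange

end SkewDuality

/-! ### Ext classes and augmentations in degree zero -/

namespace CategoryTheory.ProjectiveResolution

/-- A coboundary in degree zero would factor through the term of the cochain complex in degree one,
which is zero. -/
lemma eq_zero_of_extMk_eq_zero {C : Type*} [Category* C] [Abelian C] [HasExt C]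
    {X Y : C} (R : ProjectiveResolution X) (f : R.complex.X 0 ⟶ Y) (hf : R.complex.d 1 0 ≫ f = 0)
    (h : R.extMk f 1 rfl hf = 0) : f = 0 := by
  simp only [← R.extEquivCohomologyClass.apply_eq_iff_eq,
    extEquivCohomologyClass_extMk, extEquivCohomologyClass_zero,
    CochainComplex.HomComplex.CohomologyClass.mk_eq_zero_iff] at h
  rw [CochainComplex.HomComplex.Cocycle.toSingleMk_mem_coboundaries_iff _ _ _ _ _ 1 (by lia)] at h
  obtain ⟨g, hg⟩ := h
  have hz : g = 0 := (CochainComplex.isZero_of_isStrictlyLE R.cochainComplex 0 1).eq_of_src _ _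
  rw [hz, Limits.comp_zero] at hg
  rw [← cancel_epi (R.cochainComplexXIso (-(0 : ℕ)) 0 rfl).hom, Limits.comp_zero]
  exact hg.symm

lemma mapProjectiveResolution_aug {C D : Type*} [Category* C] [Category* D] [Abelian C] [Abelian D]
    (F : C ⥤ D) [F.Additive] [F.PreservesProjectiveObjects] [F.PreservesHomology] {X : C}
    (P : ProjectiveResolution X) : (F.mapProjectiveResolution P).aug = F.map P.aug := by
  have h : ((HomologicalComplex.singleMapHomologicalComplex F (ComplexShape.down ℕ) 0).hom.app X).f 0 =
      𝟙 (F.obj X) := by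
    refine (HomologicalComplex.singleMapHomologicalComplex_hom_app_self F _ 0 X).trans ?_
    exact (Category.comp_id _).trans (F.map_id X)
  exact (congrArg (F.map P.aug ≫ ·) h).trans (Category.comp_id _)

end CategoryTheory.ProjectiveResolution

/-! ### The resolutions of the diagonal and of M -/

namespace SkewDuality

section Resolutions

open MvPowerSeries TensorProduct Koszul

variable {k : Type u} [Field k] {d : ℕ}

attribute [local instance] algebraX

variable (k d) in
/-- The Koszul complex of the diagonal. -/
noncomputable abbrev diagKos : Cx (PSS k d) := kos (diagList k d)

/-- The augmentation of the Koszul complex of the diagonal. -/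
noncomputable def diagAug : (diagKos k d).X 0 →ₗ[PSS k d] diagModule k d where
  toFun p := mulMap k d (kosBot (diagList k d) p)
  map_add' p q := by rw [map_add, map_add]; rfl
  map_smul' s p := by rw [map_smul, smul_eq_mul, map_mul]; rfl

/-- This is exactness with coefficients in `S`, read through `S ⊗ K = K`. -/
lemma diagKos_exact (n : ℕ) (x : (diagKos k d).X (n + 1)) (hx : (diagKos k d).d n x = 0) :
    ∃ y, (diagKos k d).d (n + 1) y = x := by
  obtain ⟨w, hw⟩ := exactTensor_kos _ (reg_self k d) n ((1 : PSS k d) ⊗ₜ x)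
    (by rw [LinearMap.lTensor_tmul, hx, tmul_zero])
  refine ⟨TensorProduct.lid _ _ w, ?_⟩
  have h : ∀ w, TensorProduct.lid _ _ (((diagKos k d).d (n + 1)).lTensor (PSS k d) w) =
      (diagKos k d).d (n + 1) (TensorProduct.lid _ _ w) := fun w => by
    induction w with
    | zero => simp
    | tmul s q => simp
    | add a b ha hb => rw [map_add, map_add, ha, hb, map_add, map_add]
  rw [← h, hw, lid_tmul, one_smul]

lemma diagKos_exact_zero (x : (diagKos k d).X 0) :
    diagAug x = 0 ↔ ∃ y, (diagKos k d).d 0 y = x := by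
  have h : ∀ w, TensorProduct.lid _ _ (((diagKos k d).d 0).lTensor (PSS k d) w) =
      (diagKos k d).d 0 (TensorProduct.lid _ _ w) := fun w => by
    induction w with
    | zero => simp
    | tmul s q => simp
    | add a b ha hb => rw [map_add, map_add, ha, hb, map_add, map_add]
  have h1 := exists_kos_d_zero (diagList k d) ((1 : PSS k d) ⊗ₜ[PSS k d] x)
  rw [kosTensorBot_tmul, Ideal.smul_eq_mul, Ideal.mul_top, smul_eq_mul, mul_one] at h1
  constructor
  · intro hx
    obtain ⟨w, hw⟩ := h1.mpr (mem_diagIdeal_of_mulMap_eq_zero hx)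
    refine ⟨TensorProduct.lid _ _ w, ?_⟩
    rw [← h, hw, lid_tmul, one_smul]
  · rintro ⟨y, rfl⟩
    exact mulMap_eq_zero_of_mem (h1.mp ⟨1 ⊗ₜ y, LinearMap.lTensor_tmul _ _ _ _⟩)

variable (k d) in
/-- The Koszul resolution of the diagonal module. -/
noncomputable def diagRes : ProjectiveResolution (diagModule k d) :=
  ProjectiveResolution.ofExact (fun n => (diagKos k d).X n) (fun n => ModuleCat.ofHom ((diagKos k d).d n))
    (fun n => ModuleCat.hom_ext (LinearMap.ext fun x => (diagKos k d).d_d n x))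
    (ModuleCat.ofHom (Y := ↑(diagModule k d)) diagAug)
    (fun n => by
      have := free_kos (diagList k d) n
      have : Module.Projective (PSS k d) ((diagKos k d).X n) := Module.Projective.of_free
      exact (IsProjective.iff_projective _).mp this)
    (ModuleCat.hom_ext (LinearMap.ext fun x => (diagKos_exact_zero _).mpr ⟨x, rfl⟩))
    (fun r => ⟨(kosBot _).symm (inclX k d r), by
      change mulMap k d (kosBot _ ((kosBot _).symm (inclX k d r))) = r
      rw [LinearEquiv.apply_symm_apply]
      exact mulMap_inclX _⟩)
    (fun x hx => (diagKos_exact_zero x).mp hx) diagKos_exact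

section
variable (M : ModuleCat.{u} (PSR k d))

/-- The functor sending an `S`-module `P` to `S ⊗_R M ⊗_S P`, as a module over the power series
in `y`. -/
noncomputable abbrev bcFunctor : ModuleCat.{u} (PSS k d) ⥤ ModuleCat.{u} (PSR k d) :=
  (tensoringLeft (ModuleCat.{u} (PSS k d))).obj (baseChange M) ⋙
    ModuleCat.restrictScalars (inclY k d)

/-- The terms of the resolution of `M`. -/
noncomputable def resX (n : ℕ) : ModuleCat.{u} (PSR k d) := (bcFunctor M).obj ((diagKos k d).X n)

/-- The identification of the terms of the resolution with tensor products. -/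
noncomputable def resTmul {M : ModuleCat.{u} (PSR k d)} (n : ℕ) :
    (baseChange M ⊗[PSS k d] (diagKos k d).X n) ≃+ resX M n := AddEquiv.refl _

/-- The differentials of the resolution of `M`. -/
noncomputable def resD (n : ℕ) : resX M (n + 1) ⟶ resX M n :=
  (bcFunctor M).map (ModuleCat.ofHom ((diagKos k d).d n))

variable {M}

lemma resD_resTmul (n : ℕ) (z : baseChange M ⊗[PSS k d] (diagKos k d).X (n + 1)) :
    resD M n (resTmul (n + 1) z) = resTmul n (((diagKos k d).d n).lTensor _ z) := rfl

lemma smul_resTmul (n : ℕ) (r : PSR k d) (z : baseChange M ⊗[PSS k d] (diagKos k d).X n) :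
    r • resTmul n z = resTmul n (inclY k d r • z) := rfl

variable (M)

/-- The augmentation of the resolution of `M`. -/
noncomputable def resAug : resX M 0 →ₗ[PSR k d] M where
  toFun z := counit M (kosTensorBot (diagList k d) ((resTmul 0).symm z))
  map_add' z w := by rw [map_add, map_add, map_add]
  map_smul' r z := by
    obtain ⟨z, rfl⟩ := (resTmul 0).surjective z
    rw [smul_resTmul, AddEquiv.symm_apply_apply, AddEquiv.symm_apply_apply, map_smul, counit_smul,
      mulMap_inclY]
    rfl

variable {M}

lemma resAug_apply (z : baseChange M ⊗[PSS k d] (diagKos k d).X 0) :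
    resAug M (resTmul 0 z) = counit M (kosTensorBot (diagList k d) z) := rfl

lemma resAug_eq_zero_iff (z : resX M 0) :
    resAug M z = 0 ↔ ∃ w, resD M 0 w = z := by
  obtain ⟨z, rfl⟩ := (resTmul 0).surjective z
  have h1 := exists_kos_d_zero (diagList k d) z
  rw [resAug_apply]
  constructor
  · intro h
    obtain ⟨w, hw⟩ := h1.mpr (mem_smul_top_of_counit_eq_zero _ h)
    exact ⟨resTmul 1 w, (resD_resTmul 0 w).trans (congrArg _ hw)⟩
  · rintro ⟨w, hw⟩
    obtain ⟨w, rfl⟩ := (resTmul 1).surjective w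
    exact counit_eq_zero_of_mem _ (h1.mp ⟨w, (resTmul 0).injective ((resD_resTmul 0 w).symm.trans hw)⟩)

open scoped ModuleCat in
-- The functions induced by the dual basis of `M` are coordinates: they exhibit the base change as a
-- direct summand of a finite free module over the series in `y`.
lemma projective_baseChange (hM : IsFinLength M) :
    Projective ((ModuleCat.restrictScalars (inclY k d)).obj (baseChange M)) := by
  have := finite_of_isFinLength hM
  let b := Module.finBasis k M
  let Z := (ModuleCat.restrictScalars (inclY k d)).obj (baseChange M)
  let i : Z →ₗ[PSR k d] (Fin (Module.finrank k M) → PSR k d) :=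
    { toFun := fun x j => liftDual (b.coord j) x
      map_add' := fun x y => funext fun j => map_add (liftDual (b.coord j)) x y
      map_smul' := fun r x => funext fun j => yLinear_liftDual (b.coord j) r x }
  let p : (Fin (Module.finrank k M) → PSR k d) →ₗ[PSR k d] Z :=
    Fintype.linearCombination (PSR k d) (fun j => (show Z from bc 1 (b j)))
  have hp : p ∘ₗ i = LinearMap.id := LinearMap.ext fun x => (baseChange_eq_sum b hM x).symm
  have : Module.Projective (PSR k d) Z := Module.Projective.of_split i p hp
  exact (IsProjective.iff_projective (R := PSR k d) Z).mp this

variable (M) in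
/-- The resolution of `M` by the base change of the Koszul resolution of the diagonal. -/
noncomputable def res (hM : IsFinLength M) : ProjectiveResolution M :=
  ProjectiveResolution.ofExact (resX M) (resD M)
    (fun n => by
      refine ((bcFunctor M).map_comp _ _).symm.trans ?_
      have h : ModuleCat.ofHom ((diagKos k d).d (n + 1)) ≫ ModuleCat.ofHom ((diagKos k d).d n) = 0 :=
        ModuleCat.hom_ext (LinearMap.ext fun x => (diagKos k d).d_d n x)
      rw [h, Functor.map_zero]
      rfl)
    (ModuleCat.ofHom (X := ↑(resX M 0)) (resAug M))
    (fun n => projective_map_kos (bcFunctor M) (by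
      have := projective_baseChange hM
      exact Projective.of_iso ((ModuleCat.restrictScalars (inclY k d)).mapIso
        (ρ_ (baseChange M))).symm this) _ n)
    (ModuleCat.hom_ext (LinearMap.ext fun x => (resAug_eq_zero_iff _).mpr ⟨x, rfl⟩))
    (fun m => ⟨resTmul 0 (bc 1 m ⊗ₜ (kosBot _).symm 1), by
      refine (resAug_apply _).trans ?_
      rw [kosTensorBot_tmul, LinearEquiv.apply_symm_apply, one_smul, counit_bc, map_one, one_smul]⟩)
    (fun x hx => (resAug_eq_zero_iff x).mp hx)
    (fun n x hx => by
      obtain ⟨x, rfl⟩ := (resTmul (n + 1)).surjective x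
      obtain ⟨w, hw⟩ := exactTensor_kos _ (reg_baseChange M) n x ((resTmul n).injective
        (((resD_resTmul n x).symm.trans hx).trans (map_zero _).symm))
      exact ⟨resTmul (n + 2) w, (resD_resTmul (n + 1) w).trans (congrArg _ hw)⟩)

end

end Resolutions

end SkewDuality

/-! ### Ext in the top degree -/

namespace SkewDuality

section ExtComputation

open MvPowerSeries TensorProduct Koszul
open scoped ModuleCat

variable {k : Type u} [Field k] {d : ℕ}

attribute [local instance] algebraX

variable (k d) in
/-- The generator of the top degree of the Koszul complex of the diagonal. -/
noncomputable def topGen : (diagKos k d).X d := kosTop (diagList k d) d length_diagList 1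

lemma exists_eq_smul_topGen (q : (diagKos k d).X d) : ∃ a : PSS k d, q = a • topGen k d := by
  obtain ⟨a, rfl⟩ := (kosTop (diagList k d) d length_diagList).surjective q
  exact ⟨a, by rw [topGen, ← map_smul, smul_eq_mul, mul_one]⟩

/-- The tensor product with the top degree of the Koszul complex of the diagonal. -/
noncomputable def topEquiv (X : ModuleCat.{u} (PSS k d)) :
    (X ⊗[PSS k d] (diagKos k d).X d) ≃ₗ[PSS k d] X :=
  (TensorProduct.congr (LinearEquiv.refl _ X)
    (kosTop (diagList k d) d length_diagList).symm).trans (TensorProduct.rid _ _)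

lemma topEquiv_tmul_topGen (X : ModuleCat.{u} (PSS k d)) (x : X) :
    topEquiv X (x ⊗ₜ topGen k d) = x := by
  change (kosTop (diagList k d) d length_diagList).symm (topGen k d) • x = x
  rw [topGen, LinearEquiv.symm_apply_apply, one_smul]

lemma topEquiv_symm_apply (X : ModuleCat.{u} (PSS k d)) (x : X) :
    (topEquiv X).symm x = x ⊗ₜ topGen k d :=
  (LinearEquiv.symm_apply_eq _).mpr (topEquiv_tmul_topGen X x).symm

variable (k d) in
/-- `R` as a module over itself. -/
noncomputable abbrev ringMod : ModuleCat.{u} (PSR k d) := ModuleCat.of (PSR k d) (PSR k d)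

variable {M : ModuleCat.{u} (PSR k d)}

/-- The function `x ↦ φ(x ⊗ p)` on the base change of `M`. -/
noncomputable def slot {n : ℕ} (φ : resX M n ⟶ ringMod k d) :
    (diagKos k d).X n →+ BCFun M :=
  AddMonoidHom.mk' (fun p => AddMonoidHom.mk' (fun x => φ (resTmul n (x ⊗ₜ p)))
    (fun x y => by rw [add_tmul, map_add, map_add]))
    (fun p q => by
      ext x : 1
      change φ (resTmul n (x ⊗ₜ (p + q))) = φ (resTmul n (x ⊗ₜ p)) + φ (resTmul n (x ⊗ₜ q))
      rw [tmul_add, map_add, map_add])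

lemma slot_apply {n : ℕ} (φ : resX M n ⟶ ringMod k d) (p : (diagKos k d).X n) (x : baseChange M) :
    slot φ p x = φ (resTmul n (x ⊗ₜ p)) := rfl

lemma yLinear_slot {n : ℕ} (φ : resX M n ⟶ ringMod k d) (p : (diagKos k d).X n) :
    YLinear (slot φ p) := fun r x => by
  rw [slot_apply, ← smul_tmul', ← smul_resTmul, map_smul]
  rfl

lemma slot_smul {n : ℕ} (φ : resX M n ⟶ ringMod k d) (s : PSS k d) (p : (diagKos k d).X n) :
    slot φ (s • p) = precomp s (slot φ p) := by
  ext x : 1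
  rw [slot_apply, precomp_apply, slot_apply, tmul_smul, smul_tmul']

lemma slot_add {n : ℕ} (φ ψ : resX M n ⟶ ringMod k d) (p : (diagKos k d).X n) :
    slot (φ + ψ) p = slot φ p + slot ψ p := rfl

lemma slot_sum {n : ℕ} {κ : Type*} [Fintype κ] (φ : κ → (resX M n ⟶ ringMod k d))
    (p : (diagKos k d).X n) : slot (∑ i, φ i) p = ∑ i, slot (φ i) p :=
  map_sum (AddMonoidHom.mk' (fun φ : resX M n ⟶ ringMod k d => slot φ p)
    (fun φ ψ => slot_add φ ψ p)) φ _

/-- The map between terms of the resolution of `M` induced by a map between terms of the Koszul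
complex. -/
noncomputable def resMap {m n : ℕ} (G : (diagKos k d).X m →ₗ[PSS k d] (diagKos k d).X n) :
    resX M m ⟶ resX M n := (bcFunctor M).map (ModuleCat.ofHom G)

lemma slot_resMap_comp {m n : ℕ} (G : (diagKos k d).X m →ₗ[PSS k d] (diagKos k d).X n)
    (φ : resX M n ⟶ ringMod k d) (p : (diagKos k d).X m) :
    slot (resMap G ≫ φ) p = slot φ (G p) := rfl

/-- The cochain of a function on the base change of `M`, as a linear map. -/
noncomputable def cochainLin (h : BCFun M) (hh : YLinear h) : resX M d →ₗ[PSR k d] PSR k d where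
  toFun z := h (topEquiv (baseChange M) ((resTmul d).symm z))
  map_add' z w := by rw [map_add, map_add, map_add]
  map_smul' r z := by
    obtain ⟨z, rfl⟩ := (resTmul d).surjective z
    rw [smul_resTmul, AddEquiv.symm_apply_apply, AddEquiv.symm_apply_apply, map_smul, hh]
    rfl

/-- The cochain of a function on the base change of `M`. -/
noncomputable def cochain (h : BCFun M) (hh : YLinear h) : resX M d ⟶ ringMod k d :=
  ModuleCat.ofHom (X := ↑(resX M d)) (cochainLin h hh)

lemma cochain_apply (h : BCFun M) (hh : YLinear h) (z : baseChange M ⊗[PSS k d] (diagKos k d).X d) :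
    cochain h hh (resTmul d z) = h (topEquiv _ z) := rfl

lemma slot_cochain (h : BCFun M) (hh : YLinear h) : slot (cochain h hh) (topGen k d) = h := by
  ext x : 1
  rw [slot_apply, cochain_apply, topEquiv_tmul_topGen]

lemma apply_resTmul (φ : resX M d ⟶ ringMod k d) (z : baseChange M ⊗[PSS k d] (diagKos k d).X d) :
    φ (resTmul d z) = slot φ (topGen k d) (topEquiv _ z) := by
  rw [slot_apply, ← topEquiv_symm_apply, LinearEquiv.symm_apply_apply]

lemma hom_ext_slot {φ ψ : resX M d ⟶ ringMod k d}
    (h : slot φ (topGen k d) = slot ψ (topGen k d)) : φ = ψ := by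
  refine ModuleCat.hom_ext (LinearMap.ext fun z => ?_)
  obtain ⟨z, rfl⟩ := (resTmul d).surjective z
  exact (apply_resTmul φ z).trans (by rw [h]; exact (apply_resTmul ψ z).symm)

/-- The Koszul complex vanishes above degree `d`, so every cochain of degree `d` is a cocycle. -/
lemma resD_comp_eq_zero {N : ModuleCat.{u} (PSR k d)} (φ : resX M d ⟶ N) : resD M d ≫ φ = 0 := by
  have : Subsingleton ((diagKos k d).X (d + 1)) :=
    subsingleton_kos _ _ (by rw [length_diagList]; omega)
  have h : Subsingleton (baseChange M ⊗[PSS k d] (diagKos k d).X (d + 1)) := inferInstance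
  have h' : Subsingleton (resX M (d + 1)) := h
  exact ModuleCat.hom_ext (LinearMap.ext fun z => by
    rw [Subsingleton.elim z 0, map_zero, map_zero])

section
variable (hM : IsFinLength M)

lemma res_d (n : ℕ) : (res M hM).complex.d (n + 1) n = resD M n := ProjectiveResolution.ofExact_d n

lemma res_d_comp (φ : resX M d ⟶ ringMod k d) :
    (res M hM).complex.d (d + 1) d ≫ (show (res M hM).complex.X d ⟶ ringMod k d from φ) = 0 :=
  (congrArg (· ≫ φ) (res_d hM d)).trans (resD_comp_eq_zero φ)

/-- The class in `Ext^d(M, R)` of a cochain. -/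
noncomputable def extClass : (resX M d ⟶ ringMod k d) →+ ExtR d M :=
  AddMonoidHom.mk' (fun φ => (res M hM).extMk φ (d + 1) rfl (res_d_comp hM φ))
    (fun φ ψ => ((res M hM).add_extMk φ ψ (d + 1) rfl (res_d_comp hM φ) (res_d_comp hM ψ)).symm)

lemma extClass_surjective : Function.Surjective (extClass hM) := fun e => by
  obtain ⟨φ, hφ, h⟩ := (res M hM).extMk_surjective e (d + 1) rfl
  exact ⟨φ, h⟩

lemma smul_extClass (r : PSR k d) (φ : resX M d ⟶ ringMod k d) :
    r • extClass hM φ = extClass hM (r • φ) := by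
  rw [Abelian.Ext.smul_eq_comp_mk₀]
  refine ((res M hM).extMk_comp_mk₀ φ (d + 1) rfl (res_d_comp hM φ) _).trans ?_
  have h : φ ≫ (r • 𝟙 (ringMod k d)) = r • φ := ModuleCat.hom_ext (LinearMap.ext fun z => rfl)
  exact congrArg (extClass hM) h

lemma slot_smul_left {n : ℕ} (r : PSR k d) (φ : resX M n ⟶ ringMod k d) (p : (diagKos k d).X n) :
    slot (r • φ) p = postmul r (slot φ p) := rfl

variable {ι : Type*} [Fintype ι] (b : Module.Basis ι k M)

/-- The functional on `M` of a cochain. -/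
noncomputable def traceClass : (resX M d ⟶ ringMod k d) →+ KDual M :=
  AddMonoidHom.mk' (fun φ => trace b (slot φ (topGen k d)))
    (fun φ ψ => by rw [slot_add, map_add])

lemma traceClass_apply (φ : resX M d ⟶ ringMod k d) :
    traceClass b φ = trace b (slot φ (topGen k d)) := rfl

lemma traceClass_surjective : Function.Surjective (traceClass b) := fun f =>
  ⟨cochain (liftDual f) (yLinear_liftDual f), by
    rw [traceClass_apply, slot_cochain, trace_liftDual]⟩

variable {b}

include hM in
lemma trace_slot_of_mem {n : ℕ} (φ : resX M n ⟶ ringMod k d) (p : (diagKos k d).X n)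
    (hp : p ∈ diagIdeal k d • (⊤ : Submodule (PSS k d) ((diagKos k d).X n))) :
    trace b (slot φ p) = 0 := by
  induction hp using Submodule.smul_induction_on' with
  | smul a ha p _ => rw [slot_smul, trace_precomp_of_mem hM (yLinear_slot φ p) ha]
  | add p _ q _ hp hq => rw [map_add, map_add, hp, hq, add_zero]

lemma slot_resD_comp {n : ℕ} (ψ : resX M n ⟶ ringMod k d) (p : (diagKos k d).X (n + 1)) :
    slot (resD M n ≫ ψ) p = slot ψ ((diagKos k d).d n p) := rfl

/-- A coboundary takes on the generator the value of `ψ` at `d(topGen)`, which lies in the ideal of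
the diagonal times the previous term; the trace vanishes there. -/
lemma traceClass_eq_zero_of_extClass (φ : resX M d ⟶ ringMod k d) (h : extClass hM φ = 0) :
    traceClass b φ = 0 := by
  rw [traceClass_apply]
  obtain hd | ⟨p, hp⟩ : d = 0 ∨ ∃ p, p + 1 = d := by
    cases d with
    | zero => exact Or.inl rfl
    | succ p => exact Or.inr ⟨p, rfl⟩
  -- Coboundaries come from the preceding degree, so `d = 0` is treated apart: there a zero class
  -- has the zero cochain.
  · subst hd
    have : φ = 0 := ProjectiveResolution.eq_zero_of_extMk_eq_zero (res M hM) φ (res_d_comp hM φ) h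
    subst this
    have h0 : slot (0 : resX M 0 ⟶ ringMod k 0) (topGen k 0) = 0 := rfl
    rw [h0, map_zero]
  · obtain ⟨ψ, hψ⟩ := ((res M hM).extMk_eq_zero_iff φ (d + 1) rfl (res_d_comp hM φ) p hp).mp h
    subst hp
    have hφ : φ = resD M p ≫ ψ :=
      hψ.symm.trans (congrArg (fun D : resX M (p + 1) ⟶ resX M p => D ≫ ψ) (res_d hM p))
    rw [hφ, slot_resD_comp ψ (topGen k (p + 1))]
    exact trace_slot_of_mem hM ψ _ (kos_d_mem (diagList k (p + 1)) p (topGen k (p + 1)))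

/-- The function of the cochain is `∑ aᵢ gᵢ` with `aᵢ` in the ideal of the diagonal. Multiplication
by such `aᵢ` on the top Koszul term factors through the differential, so each summand is a
coboundary. -/
lemma extClass_eq_zero_of_traceClass (φ : resX M d ⟶ ringMod k d) (h : traceClass b φ = 0) :
    extClass hM φ = 0 := by
  obtain ⟨g, a, hg, ha, hs⟩ := exists_of_trace_eq_zero hM (yLinear_slot φ (topGen k d)) h
  obtain hd | ⟨p, hp⟩ : d = 0 ∨ ∃ p, p + 1 = d := by
    cases d with
    | zero => exact Or.inl rfl
    | succ p => exact Or.inr ⟨p, rfl⟩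
  · subst hd
    -- With no variables the ideal of the diagonal is zero.
    have ha' : ∀ i, a i = 0 := fun i => by simpa [diagIdeal, diagList] using ha i
    have h0 : φ = 0 := hom_ext_slot (by
      rw [hs]
      refine (Finset.sum_eq_zero fun i _ => ?_).trans rfl
      ext x : 1
      rw [precomp_apply, ha', zero_smul, map_zero]
      rfl)
    rw [h0, map_zero]
  · choose G hG using fun i => exists_comp_d_eq_smul (diagList k d) p
      (length_diagList.trans hp.symm) (a i) (ha i)
    refine ((res M hM).extMk_eq_zero_iff φ (d + 1) rfl (res_d_comp hM φ) p hp).mpr ?_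
    subst hp
    -- As `G i ∘ d = a i`, composing with the differential gives the summand of `g i` precomposed
    -- with `a i`.
    let ψ : resX M p ⟶ ringMod k (p + 1) :=
      ∑ i, resMap (G i) ≫ cochain (g i) (hg i)
    refine ⟨ψ, (congrArg (fun D : resX M (p + 1) ⟶ resX M p => D ≫ ψ) (res_d hM p)).trans ?_⟩
    refine hom_ext_slot ?_
    rw [hs, slot_resD_comp ψ (topGen k (p + 1)), slot_sum]
    refine Finset.sum_congr rfl fun i _ => ?_
    rw [slot_resMap_comp, hG i (topGen k (p + 1)), slot_smul, slot_cochain]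

end

lemma exists_addEquiv_of_ker_eq {A B C : Type*} [AddCommGroup A] [AddCommGroup B] [AddCommGroup C]
    (f : A →+ B) (g : A →+ C) (hf : Function.Surjective f) (hg : Function.Surjective g)
    (h : ∀ a, f a = 0 ↔ g a = 0) : ∃ e : B ≃+ C, ∀ a, e (f a) = g a := by
  have hk : f.ker = g.ker := AddSubgroup.ext fun a => h a
  refine ⟨(QuotientAddGroup.quotientKerEquivOfSurjective f hf).symm.trans
    ((QuotientAddGroup.quotientAddEquivOfEq hk).trans
      (QuotientAddGroup.quotientKerEquivOfSurjective g hg)), fun a => ?_⟩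
  have h1 : (QuotientAddGroup.quotientKerEquivOfSurjective f hf).symm (f a) = (a : A ⧸ f.ker) := by
    rw [AddEquiv.symm_apply_eq]
    rfl
  rw [AddEquiv.trans_apply, h1]
  rfl

section
variable (hM : IsFinLength M)

/-- A basis of a module of finite length over the constants. -/
noncomputable def constBasis : Module.Basis (Fin (Module.finrank k M)) k M :=
  have := finite_of_isFinLength hM
  Module.finBasis k M

lemma exists_extDual : ∃ e : ExtR d M ≃+ KDual M,
    ∀ φ, e (extClass hM φ) = traceClass (constBasis hM) φ :=
  exists_addEquiv_of_ker_eq (extClass hM) (traceClass (constBasis hM)) (extClass_surjective hM)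
    (traceClass_surjective _) fun φ => ⟨traceClass_eq_zero_of_extClass hM φ,
      extClass_eq_zero_of_traceClass hM φ⟩

/-- The isomorphism from `Ext^d(M, R)` to the functionals on `M` that is determined by the Koszul
resolution. -/
noncomputable def extDual : ExtR d M ≃+ KDual M := (exists_extDual hM).choose

lemma extDual_extClass (φ : resX M d ⟶ ringMod k d) :
    extDual hM (extClass hM φ) = trace (constBasis hM) (slot φ (topGen k d)) :=
  (exists_extDual hM).choose_spec φ

lemma extDual_smul (r : PSR k d) (e : ExtR d M) :
    extDual hM (r • e) = smulDual r (extDual hM e) := by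
  obtain ⟨φ, rfl⟩ := extClass_surjective hM e
  rw [smul_extClass, extDual_extClass, extDual_extClass, slot_smul_left, trace_postmul]

end

end ExtComputation

end SkewDuality

/-! ### Lifts of automorphisms to the Koszul resolution -/

namespace SkewDuality

section Lifts

open MvPowerSeries TensorProduct Koszul

variable {k : Type u} [Field k] {d : ℕ}

attribute [local instance] algebraX

lemma diagRes_d (n : ℕ) :
    (diagRes k d).complex.d (n + 1) n = ModuleCat.ofHom ((diagKos k d).d n) :=
  ProjectiveResolution.ofExact_d n

/-- The differentials of the Koszul resolution of the diagonal. -/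
noncomputable def diagResD (k : Type u) [Field k] (d : ℕ) (i j : ℕ) :
    (diagKos k d).X i ⟶ (diagKos k d).X j := (diagRes k d).complex.d i j

lemma diagResD_mem (i j : ℕ) (p : (diagKos k d).X i) :
    diagResD k d i j p ∈ diagIdeal k d • (⊤ : Submodule (PSS k d) ((diagKos k d).X j)) := by
  by_cases h : j + 1 = i
  · subst h
    have : diagResD k d (j + 1) j = ModuleCat.ofHom ((diagKos k d).d j) := diagRes_d j
    rw [this]
    exact kos_d_mem (diagList k d) j p
  · have : diagResD k d i j = 0 := (diagRes k d).complex.shape i j h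
    rw [this]
    exact Submodule.zero_mem _

/-- The base change of the differentials of the Koszul resolution to the diagonal vanishes. -/
lemma whiskerLeft_diagResD (i j : ℕ) : diagModule k d ◁ diagResD k d i j = 0 := by
  have key : ∀ (r : diagModule k d) (q : (diagKos k d).X j),
      q ∈ diagIdeal k d • (⊤ : Submodule (PSS k d) ((diagKos k d).X j)) →
      r ⊗ₜ[PSS k d] q = 0 := fun r q hq => by
    induction hq using Submodule.smul_induction_on' with
    | smul a ha q _ =>
      have : a • r = 0 := by
        change mulMap k d a * (show PSR k d from r) = 0
        rw [mulMap_eq_zero_of_mem ha, zero_mul]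
      rw [← smul_tmul, this, zero_tmul]
    | add q _ q' _ h h' => rw [tmul_add, h, h', add_zero]
  refine ModuleCat.MonoidalCategory.tensor_ext fun r p => ?_
  exact key r _ (diagResD_mem i j p)

lemma tensorSc_diagRes_g (n : ℕ) : (tensorSc (diagModule k d) (diagRes k d).complex n).g = 0 :=
  whiskerLeft_diagResD _ _

lemma tensorSc_diagRes_f (n : ℕ) : (tensorSc (diagModule k d) (diagRes k d).complex n).f = 0 :=
  whiskerLeft_diagResD _ _

section
variable (s : PSAut k d)

/-- The lift of `σ` to a semilinear endomorphism of the Koszul resolution, as a chain map. -/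
noncomputable def chainLift : (diagRes k d).complex ⟶
    ((ModuleCat.restrictScalars.{u} s.double.toRingHom).mapProjectiveResolution
      (diagRes k d)).complex :=
  ProjectiveResolution.lift (diagModuleMap s) (diagRes k d) _

/-- The components of `chainLift`. -/
noncomputable def chainLiftApp (n : ℕ) : (diagKos k d).X n ⟶
    (ModuleCat.restrictScalars.{u} s.double.toRingHom).obj ((diagKos k d).X n) :=
  (chainLift s).f n

/-- The lift of `σ` to a semilinear endomorphism of the Koszul resolution. -/
noncomputable def semiLift (n : ℕ) :
    (diagKos k d).X n →ₛₗ[(s.double : PSS k d →+* PSS k d)] (diagKos k d).X n where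
  toFun := (chainLiftApp s n).hom
  map_add' := map_add (chainLiftApp s n).hom
  map_smul' a p := map_smul (chainLiftApp s n).hom a p

lemma semiLift_d (n : ℕ) (p : (diagKos k d).X (n + 1)) :
    semiLift s n ((diagKos k d).d n p) = (diagKos k d).d n (semiLift s (n + 1) p) := by
  have h : chainLiftApp s (n + 1) ≫ (ModuleCat.restrictScalars.{u} s.double.toRingHom).map
      (diagResD k d (n + 1) n) = diagResD k d (n + 1) n ≫ chainLiftApp s n :=
    (chainLift s).comm (n + 1) n
  have h' : diagResD k d (n + 1) n = ModuleCat.ofHom ((diagKos k d).d n) := diagRes_d n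
  rw [h'] at h
  exact (congrArg (fun g => ModuleCat.Hom.hom g p) h).symm

lemma chainLift_comm_zero : (chainLift s).f 0 ≫
    ((ModuleCat.restrictScalars.{u} s.double.toRingHom).mapProjectiveResolution
      (diagRes k d)).π.f 0 = (diagRes k d).π.f 0 ≫ diagModuleMap s :=
  ProjectiveResolution.lift_commutes_zero _ _ _

lemma diagAug_semiLift (p : (diagKos k d).X 0) :
    diagAug (semiLift s 0 p) = s.ringEquiv (diagAug p : PSR k d) := by
  have h : chainLiftApp s 0 ≫ (ModuleCat.restrictScalars.{u} s.double.toRingHom).map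
      (diagRes k d).aug = (diagRes k d).aug ≫ diagModuleMap s :=
    (congrArg ((chainLift s).f 0 ≫ ·) (ProjectiveResolution.mapProjectiveResolution_aug
      (ModuleCat.restrictScalars.{u} s.double.toRingHom) (diagRes k d))).symm.trans
      (chainLift_comm_zero s)
  exact congrArg (fun g => ModuleCat.Hom.hom g p) h

/-- The factor by which the lift of `σ` acts on the top degree of the Koszul resolution. -/
noncomputable def liftFactor : PSS k d := (exists_eq_smul_topGen (semiLift s d (topGen k d))).choose

lemma semiLift_topGen : semiLift s d (topGen k d) = liftFactor s • topGen k d :=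
  (exists_eq_smul_topGen (semiLift s d (topGen k d))).choose_spec

lemma double_symm_double (a : PSS k d) : s.double (s.symm.double a) = a :=
  s.double.apply_symm_apply a

/-- The composite of the lifts of `σ⁻¹` and `σ`. -/
noncomputable def roundTrip (n : ℕ) : (diagKos k d).X n →ₗ[PSS k d] (diagKos k d).X n where
  toFun p := semiLift s n (semiLift s.symm n p)
  map_add' p q := by rw [map_add, map_add]
  map_smul' a p := by
    rw [LinearMap.map_smulₛₗ, LinearMap.map_smulₛₗ]
    exact congrArg (· • semiLift s n (semiLift s.symm n p)) (double_symm_double s a)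

/-- The composite of the lifts of `σ⁻¹` and `σ`, as a chain map. -/
noncomputable def roundTripHom : (diagRes k d).complex ⟶ (diagRes k d).complex :=
  ChainComplex.ofHom (fun n => (ModuleCat.ofHom (roundTrip s n) :
      (diagKos k d).X n ⟶ (diagKos k d).X n)) fun n => by
    refine (congrArg (fun D : (diagKos k d).X (n + 1) ⟶ (diagKos k d).X n =>
      ModuleCat.ofHom (roundTrip s (n + 1)) ≫ D) (diagRes_d n)).trans (Eq.trans ?_
      (congrArg (fun D : (diagKos k d).X (n + 1) ⟶ (diagKos k d).X n =>
        D ≫ ModuleCat.ofHom (roundTrip s n)) (diagRes_d n)).symm)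
    refine ModuleCat.hom_ext (LinearMap.ext fun p => ?_)
    change (diagKos k d).d n (semiLift s (n + 1) (semiLift s.symm (n + 1) p)) =
      semiLift s n (semiLift s.symm n ((diagKos k d).d n p))
    rw [semiLift_d, semiLift_d]

lemma roundTripHom_aug : (roundTripHom s).f 0 ≫ (diagRes k d).aug = (diagRes k d).aug :=
  ModuleCat.hom_ext (LinearMap.ext fun p => by
    exact (diagAug_semiLift s (semiLift s.symm 0 p)).trans
      ((congrArg s.ringEquiv (diagAug_semiLift s.symm p)).trans (s.ringEquiv.apply_symm_apply _)))

/-- The composite lifts the identity of the diagonal module, so it is homotopic to the identity.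
Both terms of a homotopy involve a differential, whose image lies in the ideal of the diagonal times
its target. -/
lemma roundTrip_sub_mem (p : (diagKos k d).X d) : roundTrip s d p - p ∈
    diagIdeal k d • (⊤ : Submodule (PSS k d) ((diagKos k d).X d)) := by
  have h1 : roundTripHom s ≫ (diagRes k d).π =
      (diagRes k d).π ≫ (ChainComplex.single₀ _).map (𝟙 _) := by
    rw [CategoryTheory.Functor.map_id, Category.comp_id]
    refine HomologicalComplex.to_single_hom_ext ?_
    exact roundTripHom_aug s
  have h2 : 𝟙 (diagRes k d).complex ≫ (diagRes k d).π =
      (diagRes k d).π ≫ (ChainComplex.single₀ _).map (𝟙 _) := by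
    rw [CategoryTheory.Functor.map_id, Category.comp_id, Category.id_comp]
  let H := ProjectiveResolution.liftHomotopy (𝟙 (diagModule k d)) _ _ h1 h2
  let H1 : (diagKos k d).X _ ⟶ (diagKos k d).X d := H.hom ((ComplexShape.down ℕ).next d) d
  let H2 : (diagKos k d).X d ⟶ (diagKos k d).X _ := H.hom d ((ComplexShape.down ℕ).prev d)
  have h3 : (ModuleCat.ofHom (roundTrip s d) : (diagKos k d).X d ⟶ (diagKos k d).X d) =
      diagResD k d d _ ≫ H1 + H2 ≫ diagResD k d _ d + 𝟙 _ := H.comm d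
  have h4 : roundTrip s d p = H1 (diagResD k d d _ p) + diagResD k d _ d (H2 p) + p :=
    congrArg (fun g => ModuleCat.Hom.hom g p) h3
  rw [h4, add_sub_cancel_right]
  refine Submodule.add_mem _ ?_ (diagResD_mem _ _ _)
  -- In the term where the differential comes first, linearity of the homotopy preserves the
  -- multiples of the ideal.
  have h5 := Submodule.mem_map_of_mem (f := H1.hom)
    (diagResD_mem d ((ComplexShape.down ℕ).next d) p)
  rw [Submodule.map_smul''] at h5
  exact Submodule.smul_mono le_rfl le_top h5

/-- On the generator the round trip multiplies by `σ(c_{σ⁻¹}) c_σ`, which is therefore congruent to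
`1` modulo the ideal of the diagonal. -/
lemma mulMap_liftFactor :
    mulMap k d (liftFactor s) * s.ringEquiv (mulMap k d (liftFactor s.symm)) = 1 := by
  have h1 := roundTrip_sub_mem s (topGen k d)
  have h2 : roundTrip s d (topGen k d) - topGen k d =
      (s.double (liftFactor s.symm) * liftFactor s - 1) • topGen k d := by
    change semiLift s d (semiLift s.symm d (topGen k d)) - topGen k d = _
    rw [semiLift_topGen, LinearMap.map_smulₛₗ, semiLift_topGen, sub_smul, one_smul, mul_smul]
    rfl
  rw [h2] at h1
  have h3 : s.double (liftFactor s.symm) * liftFactor s - 1 ∈ diagIdeal k d := by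
    -- The top term is free of rank one, so membership in `I K_d` can be read off from the
    -- coordinate.
    let e := kosTop (diagList k d) d length_diagList
    have h4 := Submodule.mem_map_of_mem (f := e.symm.toLinearMap) h1
    rw [Submodule.map_smul''] at h4
    have h5 := Submodule.smul_mono (le_refl (diagIdeal k d)) le_top h4
    rw [Ideal.smul_eq_mul, Ideal.mul_top] at h5
    have h6 : e.symm.toLinearMap ((s.double (liftFactor s.symm) * liftFactor s - 1) • topGen k d) =
        s.double (liftFactor s.symm) * liftFactor s - 1 := by
      rw [map_smul]
      change _ • e.symm (e 1) = _
      rw [LinearEquiv.symm_apply_apply, smul_eq_mul, mul_one]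
    rwa [h6] at h5
  have h7 := mulMap_eq_zero_of_mem h3
  rw [map_sub, map_mul, map_one, s.mulMap_double, sub_eq_zero] at h7
  rw [mul_comm, h7]

end

/-! ### The twist L and the action of automorphisms on it -/

section Twist

/-- The class in `L` of an element of the top degree of the Koszul complex. -/
noncomputable def twistClass : (diagModule k d ⊗[PSS k d] (diagKos k d).X d) →ₗ[PSS k d]
    ((Tor (ModuleCat.{u} (PSS k d)) d).obj (diagModule k d)).obj (diagModule k d) :=
  (torClass (diagModule k d) (diagRes k d) d (tensorSc_diagRes_g d)).hom

lemma twistClass_bijective : Function.Bijective (twistClass (k := k) (d := d)) := by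
  have := isIso_torClass (diagModule k d) (diagRes k d) d (tensorSc_diagRes_g d)
    (tensorSc_diagRes_f d)
  exact ConcreteCategory.bijective_of_isIso
    (torClass (diagModule k d) (diagRes k d) d (tensorSc_diagRes_g d))

variable (k d) in
/-- The elements of `R`, as elements of the diagonal module. -/
noncomputable def toDiag : PSR k d ≃+ diagModule k d := AddEquiv.refl _

lemma smul_toDiag (a : PSS k d) (r : PSR k d) :
    a • toDiag k d r = toDiag k d (mulMap k d a * r) := rfl

lemma diagModuleMap_toDiag (s : PSAut k d) (r : PSR k d) :
    (diagModuleMap s).hom (toDiag k d r) = toDiag k d (s.ringEquiv r) := rfl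

/-- The elements `r ⊗ q` of `L`, where `q` is the generator of the top degree of the Koszul
complex. -/
noncomputable def twistGen : PSR k d →ₗ[PSR k d] twistModule k d where
  toFun r := twistClass (toDiag k d r ⊗ₜ topGen k d)
  map_add' r r' :=
    (congrArg twistClass (by rw [map_add, add_tmul])).trans (map_add twistClass _ _)
  map_smul' r r' := by
    have h : toDiag k d (r * r') ⊗ₜ[PSS k d] topGen k d =
        inclX k d r • (toDiag k d r' ⊗ₜ[PSS k d] topGen k d) := by
      rw [smul_tmul', smul_toDiag, mulMap_inclX]
    exact (congrArg twistClass h).trans (map_smul twistClass (inclX k d r) _)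

lemma twistGen_apply (r : PSR k d) :
    twistGen r = twistClass (toDiag k d r ⊗ₜ topGen k d) := rfl

lemma twistGen_bijective : Function.Bijective (twistGen (k := k) (d := d)) := by
  have h : (twistGen (k := k) (d := d) : PSR k d → twistModule k d) =
      twistClass ∘ (topEquiv (diagModule k d)).symm ∘ toDiag k d := funext fun r =>
    congrArg twistClass (topEquiv_symm_apply (diagModule k d) (toDiag k d r)).symm
  rw [h]
  exact twistClass_bijective.comp ((topEquiv (diagModule k d)).symm.bijective.comp
    (toDiag k d).bijective)

variable (k d) in
/-- `L` is free of rank one. -/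
noncomputable def twistEquiv : PSR k d ≃ₗ[PSR k d] twistModule k d :=
  LinearEquiv.ofBijective twistGen twistGen_bijective

lemma twistClass_tmul_smul (r : PSR k d) (a : PSS k d) :
    twistClass (toDiag k d r ⊗ₜ (a • topGen k d)) = twistGen (r * mulMap k d a) := by
  rw [twistGen_apply, tmul_smul, smul_tmul', smul_toDiag, mul_comm]

lemma tensorChange_app_tmul {A B : Type u} [CommRing A] [CommRing B] (e : A ≃+* B)
    {X : ModuleCat.{u} A} {X' : ModuleCat.{u} B}
    (f : X ⟶ (ModuleCat.restrictScalars e.toRingHom).obj X') (Y : ModuleCat.{u} B) (x : X)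
    (x' : X') (hx : f.hom x = x') (y : Y) :
    ((tensorChange e f).app Y).hom (x ⊗ₜ[A] (show (ModuleCat.restrictScalars e.toRingHom).obj Y
      from y)) = x' ⊗ₜ[B] y := by
  subst hx
  exact ModuleCat.restrictScalars_μ_tmul e.toRingHom X' Y (f.hom x) y

/-- On `R ⊗ K_d` the action is `σ` on the first factor and the lift of `σ` on the second; the factor
`liftFactor s` passes to `R` through the multiplication map. -/
lemma twistMap_twistGen (s : PSAut k d) (r : PSR k d) :
    twistMap s (twistGen r) = twistGen (s.ringEquiv r * mulMap k d (liftFactor s)) := by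
  have h := torClass_torChange s.double d (diagModuleMap s) (diagModuleMap s) (diagRes k d)
    (diagRes k d) (chainLift s) (chainLift_comm_zero s) (tensorSc_diagRes_g d)
    (tensorSc_diagRes_g d)
  have h1 := congrArg (fun g => ModuleCat.Hom.hom g (toDiag k d r ⊗ₜ[PSS k d] topGen k d)) h
  have h2 : twistMap s (twistGen r) =
      twistClass (toDiag k d (s.ringEquiv r) ⊗ₜ semiLift s d (topGen k d)) :=
    h1.trans (congrArg twistClass (tensorChange_app_tmul s.double (diagModuleMap s)
      ((diagKos k d).X d) (toDiag k d r) _ (diagModuleMap_toDiag s r)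
      (semiLift s d (topGen k d))))
  rw [h2, semiLift_topGen, twistClass_tmul_smul]

end Twist

end Lifts

end SkewDuality

/-! ### Naturality of the duality -/

namespace SkewDuality

section Naturality

open MvPowerSeries TensorProduct Koszul
open scoped ModuleCat

variable {k : Type u} [Field k] {d : ℕ}

attribute [local instance] algebraX

variable {M M' : ModuleCat.{u} (PSR k d)} (t : SkewHom M M')

/-- The map on base changes induced by a skew homomorphism, as a semilinear map. -/
noncomputable def bcSkewLin :
    baseChange M →ₛₗ[(t.aut.double : PSS k d →+* PSS k d)] baseChange M' where
  toFun := bcSkew t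
  map_add' := map_add _
  map_smul' := bcSkew_smul t

/-- The semilinear map `x ⊗ p ↦ τ(x) ⊗ σ(p)`. -/
noncomputable def tensorSkew (n : ℕ) : (baseChange M ⊗[PSS k d] (diagKos k d).X n)
    →ₛₗ[(t.aut.double : PSS k d →+* PSS k d)] (baseChange M' ⊗[PSS k d] (diagKos k d).X n) :=
  TensorProduct.map (bcSkewLin t) (semiLift t.aut n)

lemma tensorSkew_tmul (n : ℕ) (x : baseChange M) (p : (diagKos k d).X n) :
    tensorSkew t n (x ⊗ₜ p) = bcSkew t x ⊗ₜ semiLift t.aut n p := rfl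

lemma tensorSkew_d (n : ℕ) (z : baseChange M ⊗[PSS k d] (diagKos k d).X (n + 1)) :
    tensorSkew t n (((diagKos k d).d n).lTensor _ z) =
      ((diagKos k d).d n).lTensor _ (tensorSkew t (n + 1) z) := by
  induction z with
  | zero => simp
  | tmul x p =>
    rw [LinearMap.lTensor_tmul, tensorSkew_tmul, tensorSkew_tmul, LinearMap.lTensor_tmul,
      semiLift_d]
  | add z w hz hw => rw [map_add, map_add, hz, hw, map_add, map_add]

/-- The restriction of scalars along `σ`. -/
noncomputable abbrev skewRestrict : ModuleCat.{u} (PSR k d) ⥤ ModuleCat.{u} (PSR k d) :=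
  ModuleCat.restrictScalars t.aut.ringEquiv.toRingHom

/-- The map on resolutions induced by a skew homomorphism, as a linear map. -/
noncomputable def resSkewLin (n : ℕ) : resX M n →ₗ[PSR k d] (skewRestrict t).obj (resX M' n) where
  toFun z := resTmul n (tensorSkew t n ((resTmul n).symm z))
  map_add' z w := by rw [map_add, map_add, map_add]; rfl
  map_smul' r z := by
    obtain ⟨z, rfl⟩ := (resTmul n).surjective z
    have h : t.aut.double (inclY k d r) = inclY k d (t.aut.ringEquiv r) := t.aut.doubleHom_inclY r
    have h' : resTmul n (tensorSkew t n (inclY k d r • z)) =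
        t.aut.ringEquiv r • resTmul n (tensorSkew t n z) := by
      rw [LinearMap.map_smulₛₗ, smul_resTmul, ← h]
      rfl
    exact h'

/-- The map on resolutions induced by a skew homomorphism. -/
noncomputable def resSkew (n : ℕ) : resX M n ⟶ (skewRestrict t).obj (resX M' n) :=
  ModuleCat.ofHom (X := ↑(resX M n)) (Y := ↑((skewRestrict t).obj (resX M' n))) (resSkewLin t n)

lemma resSkew_d (n : ℕ) : resSkew t (n + 1) ≫ (skewRestrict t).map (resD M' n) =
    resD M n ≫ resSkew t n := by
  refine ModuleCat.hom_ext (LinearMap.ext fun z => ?_)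
  obtain ⟨z, rfl⟩ := (resTmul (n + 1)).surjective z
  exact congrArg (resTmul n) (tensorSkew_d t n z).symm

lemma kosTensorBot_tensorSkew (z : baseChange M ⊗[PSS k d] (diagKos k d).X 0) :
    counit M' (kosTensorBot (diagList k d) (tensorSkew t 0 z)) =
      t.map (counit M (kosTensorBot (diagList k d) z)) := by
  induction z with
  | zero => simp
  | tmul x p =>
    rw [tensorSkew_tmul, kosTensorBot_tmul, kosTensorBot_tmul, counit_smul, counit_smul,
      counit_bcSkew, LinearMap.map_smulₛₗ]
    exact congrArg (· • t.map (counit M x)) (diagAug_semiLift t.aut p)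
  | add z w hz hw => rw [map_add, map_add, map_add, hz, hw, map_add, map_add, map_add]

lemma resSkew_aug (hM : IsFinLength M) (hM' : IsFinLength M') :
    resSkew t 0 ≫ (skewRestrict t).map (res M' hM').aug = (res M hM).aug ≫ t.toRestrict := by
  refine ModuleCat.hom_ext (LinearMap.ext fun z => ?_)
  obtain ⟨z, rfl⟩ := (resTmul 0).surjective z
  exact kosTensorBot_tensorSkew t z

lemma resSkew_comm (hM : IsFinLength M) (hM' : IsFinLength M') (i j : ℕ) :
    (show (res M hM).complex.X i ⟶ (skewRestrict t).obj ((res M' hM').complex.X i) from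
      resSkew t i) ≫ (skewRestrict t).map ((res M' hM').complex.d i j) =
      (res M hM).complex.d i j ≫ (show (res M hM).complex.X j ⟶
        (skewRestrict t).obj ((res M' hM').complex.X j) from resSkew t j) := by
  by_cases h : j + 1 = i
  · subst h
    refine (congrArg (fun D : resX M' (j + 1) ⟶ resX M' j =>
      resSkew t (j + 1) ≫ (skewRestrict t).map D) (res_d hM' j)).trans ((resSkew_d t j).trans ?_)
    exact (congrArg (fun D : resX M (j + 1) ⟶ resX M j => D ≫ resSkew t j) (res_d hM j)).symm
  · have h1 : (res M hM).complex.d i j = 0 := (res M hM).complex.shape i j h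
    have h2 : (res M' hM').complex.d i j = 0 := (res M' hM').complex.shape i j h
    rw [h1, h2, Functor.map_zero, Limits.comp_zero, Limits.zero_comp]

/-- The map on cochains induced by a skew homomorphism. -/
noncomputable def cochainPullback (φ : resX M' d ⟶ ringMod k d) : resX M d ⟶ ringMod k d :=
  (resSkew t d ≫ (skewRestrict t).map φ) ≫
    (ModuleCat.restrictScalarsIsoOfEquiv t.aut.ringEquiv).hom

lemma slot_cochainPullback (φ : resX M' d ⟶ ringMod k d) :
    slot (cochainPullback t φ) (topGen k d) =
      skewPullback t (slot φ (semiLift t.aut d (topGen k d))) := rfl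

/-- The maps `resSkew` form a chain map over `τ` between the resolutions, so restriction along `σ`
and precomposition with `τ` are computed on cochains; `σ⁻¹` is then applied to the values. -/
lemma extMap_extClass (hM : IsFinLength M) (hM' : IsFinLength M') (φ : resX M' d ⟶ ringMod k d) :
    extMap t (extClass hM' φ) = extClass hM (cochainPullback t φ) := by
  have h0 : (res M hM).complex.d (d + 1) d ≫ (show (res M hM).complex.X d ⟶ _ from
      resSkew t d ≫ (skewRestrict t).map φ) = 0 :=
    (congrArg (· ≫ resSkew t d ≫ (skewRestrict t).map φ) (res_d hM d)).trans
      (resD_comp_eq_zero _)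
  have h1 := ProjectiveResolution.mk₀_comp_mapExactFunctor_extMk (skewRestrict t) (res M' hM')
    (res M hM) (e := resSkew t) t.toRestrict (resSkew_comm t hM hM') (resSkew_aug t hM hM') φ
    (d + 1) rfl (res_d_comp hM' φ) h0
  refine (congrArg (fun e => Abelian.Ext.comp e (Abelian.Ext.mk₀
    (ModuleCat.restrictScalarsIsoOfEquiv t.aut.ringEquiv).hom) (add_zero d)) h1).trans ?_
  exact (res M hM).extMk_comp_mk₀ _ (d + 1) rfl h0 _

/-- The pullback of a cochain is evaluated at the lift of the generator, which is `c_σ` times the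
generator. The trace turns this into the action of `μ(c_σ)`. -/
lemma extDual_extMap (hM : IsFinLength M) (hM' : IsFinLength M') (e : ExtR d M') :
    extDual hM (extMap t e) =
      dualPullback t (smulDual (mulMap k d (liftFactor t.aut)) (extDual hM' e)) := by
  obtain ⟨φ, rfl⟩ := extClass_surjective hM' e
  rw [extMap_extClass t hM hM', extDual_extClass, slot_cochainPullback,
    trace_skewPullback t _ (constBasis hM') hM hM' (yLinear_slot _ _), semiLift_topGen, slot_smul,
    trace_precomp hM' (yLinear_slot _ _), extDual_extClass]

/-- The duality isomorphism `L ⊗ Ext^d(M, R) ≅ Hom_k(M, k)`. -/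
noncomputable def duality (hM : IsFinLength M) :
    (twistModule k d ⊗[PSR k d] ExtR d M) ≃+ KDual M :=
  ((TensorProduct.congr (twistEquiv k d).symm (LinearEquiv.refl (PSR k d) (ExtR d M))).trans
    (TensorProduct.lid (PSR k d) (ExtR d M))).toAddEquiv.trans (extDual hM)

lemma duality_tmul (hM : IsFinLength M) (r : PSR k d) (e : ExtR d M) :
    duality hM (twistGen r ⊗ₜ e) = smulDual r (extDual hM e) := by
  have h : (twistEquiv k d).symm (twistGen r) = r := (twistEquiv k d).symm_apply_apply r
  rw [← extDual_smul]
  refine congrArg (extDual hM) ?_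
  change (twistEquiv k d).symm (twistGen r) • e = r • e
  rw [h]

lemma duality_smul (hM : IsFinLength M) (r : PSR k d) (z : twistModule k d ⊗[PSR k d] ExtR d M) :
    duality hM (r • z) = smulDual r (duality hM z) := by
  refine (congrArg (extDual hM) (map_smul ((TensorProduct.congr (twistEquiv k d).symm
    (LinearEquiv.refl (PSR k d) (ExtR d M))).trans (TensorProduct.lid (PSR k d) (ExtR d M))) r
      z)).trans ?_
  exact extDual_smul hM r _

lemma duality_natural (hM : IsFinLength M) (hM' : IsFinLength M')
    (z : twistModule k d ⊗[PSR k d] ExtR d M') :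
    duality hM (TensorProduct.map (twistMap t.aut.symm) (extMap t) z) =
      dualPullback t (duality hM' z) := by
  induction z with
  | zero =>
    rw [map_zero, map_zero, map_zero]
    refine LinearMap.ext fun m => ?_
    exact (map_zero t.aut.const.symm).symm
  | tmul l e =>
    obtain ⟨r, rfl⟩ := twistGen_bijective.2 l
    rw [TensorProduct.map_tmul, twistMap_twistGen, duality_tmul, duality_tmul, extDual_extMap t hM hM']
    refine LinearMap.ext fun m => ?_
    rw [smulDual_apply, dualPullback_apply, dualPullback_apply, smulDual_apply, smulDual_apply,
      LinearMap.map_smulₛₗ, smul_smul]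
    congr 3
    -- The factor from `L`, for `σ⁻¹`, and the factor from Ext, for `σ`, cancel after `σ` is applied
    -- to the former.
    change mulMap k d (liftFactor t.aut) * t.aut.ringEquiv (t.aut.ringEquiv.symm r *
      mulMap k d (liftFactor t.aut.symm)) = r
    rw [map_mul, RingEquiv.apply_symm_apply, mul_left_comm, mulMap_liftFactor, mul_one]
  | add z w hz hw =>
    rw [map_add, map_add, hz, hw, map_add]
    refine LinearMap.ext fun m => ?_
    exact (map_add t.aut.const.symm _ _).symm

end Naturality

end SkewDuality

open SkewDuality
open scoped TensorProduct
theorem mainTheorem10 (k : Type u) [Field k] (n : ℕ) (hn : 1 ≤ n) :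
    Nonempty (twistModule k (n - 1) ≃ₗ[PSR k (n - 1)] PSR k (n - 1)) ∧
    ∃ θ : ∀ M : ModuleCat.{u} (PSR k (n - 1)), IsFinLength M →
        ((twistModule k (n - 1) ⊗[PSR k (n - 1)] ExtR (n - 1) M) ≃+ KDual M),
      (∀ (M : ModuleCat.{u} (PSR k (n - 1))) (hM : IsFinLength M) (r : PSR k (n - 1))
        (z : twistModule k (n - 1) ⊗[PSR k (n - 1)] ExtR (n - 1) M) (m : M),
        θ M hM (r • z) m = θ M hM z (r • m)) ∧
      ∀ (M M' : ModuleCat.{u} (PSR k (n - 1))) (hM : IsFinLength M) (hM' : IsFinLength M')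
        (t : SkewHom M M')
        (z : twistModule k (n - 1) ⊗[PSR k (n - 1)] ExtR (n - 1) M') (m : M),
        θ M hM (TensorProduct.map (twistMap t.aut.symm) (extMap t) z) m =
          t.aut.const.symm (θ M' hM' z (t.map m)) := by
  refine ⟨⟨(twistEquiv k (n - 1)).symm⟩, fun M hM => duality hM, fun M hM r z m => ?_,
    fun M M' hM hM' t z m => ?_⟩
  · exact DFunLike.congr_fun (duality_smul hM r z) m
  · exact DFunLike.congr_fun (duality_natural t hM hM' z) m
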